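/- \textbf{Setting.} Fix a period $T>0$, an order $d$, an integer step $\tau\ge 1$ and a function $a:[0,\infty)\to\mathbb C$, integrable on bounded intervals. For a second order process $\xi$ let $\xi^{(d)}(t,s)=\sum_{l=0}^d(-1)^l\binom dl\xi(t-ls)$ and let $\xi_{kj}$ be the Fourier coefficients of $u\mapsto\xi^{(d)}(u+jT,\tau T)$ on $[0,T)$ with respect to $\tilde e_k(u)=T^{-1/2}e^{2\pi i(-1)^k[k/2]u/T}$, $k=1,2,\dots$. The density $f$ of $\xi$ is a function on $(-\pi,\pi]$ with values in positive semidefinite infinite matrices, with integrable trace, such that $\mathsf E\,\xi_{kl}\overline{\xi_{nj}}=\frac1{2\pi}\int_{-\pi}^{\pi}e^{i(l-j)\lambda}(1-e^{-i\tau_1\lambda})^d(1-e^{i\tau_2\lambda})^d\lambda^{-2d}f_{kn}(\lambda)\,d\lambda$ for steps $\tau_1,\tau_2\geq 1$. The signal $\xi$ and the noise $\eta$ have periodically stationary increments with mean zero, are uncorrelated and have densities $f$ and $g$. Let $a_{kj}$ be the Fourier coefficients of $a(\cdot+jT)$ on $[0,T)$, $\vec a_j=(a_{1j},a_{3j},a_{2j},a_{5j},a_{4j},\dots)^\top$,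 $\sum_m d_\tau(m)x^m=(\sum_m x^{\tau m})^d$, $\vec b_j=\sum_{m=0}^{j}d_\tau(j-m)\vec a_m\in\ell^2$, and assume $\sum_j (j+1)\|\vec b_j\|<\infty$. The functional $A\xi=\int_0^\infty a(t)\xi(-t)\,dt$ is understood through its representation $A\xi=\sum_j\vec b_j^{\,\top}\vec\xi_{-j}$, and it is estimated linearly from $\xi_{kj}+\eta_{kj}$, $j\le0$. Put $\beta(\lambda)=(1-e^{-i\lambda\tau})^d(i\lambda)^{-d}$, $\rho=|\beta|^2$, $\vec B(\lambda)=\sum_{j\ge0}\vec b_je^{-ij\lambda}$, and for $\ell^2$-valued $h$ $$\Delta(h;f,g)=\frac1{2\pi}\int_{-\pi}^{\pi}\big[(\beta\vec B-h)^\top f\,\overline{(\beta\vec B-h)}+h^\top g\,\overline h\big]\,d\lambda .$$ This is the mean square error of the estimate with spectral characteristic $h$. Let $L_2^0(F)$ be the closure in $L_2(F)$ of the span of $e^{ij\lambda}\beta(\lambda)\delta_k$, $j\le0$, $k\ge1$, and $\Delta(f,g)$ the infimum of $\Delta(h;f,g)$ over that span with $F=f+g$. A pair $(f^0,g^0)\in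 D$ is least favourable in $D$ if $\Delta(f^0,g^0)=\max_{D}\Delta(f,g)$. A characteristic $h^0$ is minimax for $D$ if $h^0\in H_D=\bigcap_{(f,g)\in D}L_2^0(f+g)$ and $\sup_D\Delta(h^0;f,g)=\min_{h\in H_D}\sup_D\Delta(h;f,g)$. \textbf{Classes.} $D=D_0^k\times D_\varepsilon^k$, where $D_0^k$ consists of the densities $f$ with, respectively, (1) $\frac1{2\pi}\int f=P$; (2) $\frac1{2\pi}\int\mathrm{Tr} f=p$; (3) $\frac1{2\pi}\int f_{jj}=p_j$ for all $j$; (4) $\frac1{2\pi}\int\langle B_1,f\rangle=p$; and $D_\varepsilon^k$ of the densities $g$ such that, for some density $W$, respectively, (1) $\mathrm{Tr}\,g=(1-\varepsilon)\mathrm{Tr}\,g_1+\varepsilon\mathrm{Tr}\,W$, $\frac1{2\pi}\int\mathrm{Tr}\,g=q$; (2) $g_{jj}=(1-\varepsilon)g^1_{jj}+\varepsilon w_{jj}$, $\frac1{2\pi}\int g_{jj}=q_j$ for all $j$; (3) $\langle B_2,g\rangle=(1-\varepsilon)\langle B_2,g_1\rangle+\varepsilon\langle B_2,W\rangle$, $\frac1{2\pi}\int\langle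 B_2,g\rangle=q$; (4) $g=(1-\varepsilon)g_1+\varepsilon W$, $\frac1{2\pi}\int g=Q$. Here $0\le\varepsilon\le1$, $g_1$ is a fixed density, $B_1,B_2$ are positive semidefinite matrices bounded in $\ell^2$, $\langle B,f\rangle=\mathrm{Tr}(Bf)$. \textbf{Factorizations.} Let $f^0\in D_0^k$, $g^0\in D_\varepsilon^k$ admit canonical factorizations $f^0=\Phi\Phi^*$, $g^0=\Omega\Omega^*$, $f^0+g^0=\Theta\Theta^*$ with causal factors $\Phi=\sum_{m\ge0}\phi(m)e^{-im\lambda}$, etc., and $(f^0+g^0)^{-1}=\Psi^*\Psi$ with a causal $\Psi$ such that $\Psi\Theta=E_M$, $\Theta\Psi=E_\infty$ ($M\leq\infty$). Let $w$ be a causal function with $|w|^2=\rho$, put $\Phi_\tau=w\Phi=\sum_m\phi_\tau(m)e^{-im\lambda}$, $\Omega_\tau=w\Omega=\sum_m\omega_\tau(m)e^{-im\lambda}$, $\Psi_\tau=w^{-1}\Psi=\sum_m\psi_\tau(m)e^{-im\lambda}$, the latter also causal and with square summable rows. Assume that the operators $(\widetilde\Phi_\tau x)_l=\sum_{j\le l}\phi_\tau^\top(l-j)x_j$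 and, likewise, $\widetilde\Omega_\tau$ are bounded in $\ell^2$. Put $c^f(m)=\sum_l\overline{\phi_\tau(l)}(\widetilde\Phi_\tau\mathbf b)_{l+m}$, $s^f_m=\sum_j\overline{\psi_\tau(j)}c^f(j+m)$, $h_f=\sum_{m\ge0}s^f_me^{-im\lambda}$, and define $s^g_m$, $h_g$ in the same way from $\omega_\tau$. \textbf{Equations.} Suppose that, for some multipliers, almost everywhere, for the given $k$, (1) $h_gh_g^*=\Theta^\top\vec\alpha\vec\alpha^*\overline\Theta$, $h_fh_f^*=(\alpha^2+\gamma)\Theta^\top\overline\Theta$, where $\gamma\le0$ and $\gamma=0$ if $\mathrm{Tr}\,g^0>(1-\varepsilon)\mathrm{Tr}\,g_1$; (2) $h_gh_g^*=\alpha^2\Theta^\top\overline\Theta$, $h_fh_f^*=\Theta^\top\mathrm{diag}(\alpha_j^2+\gamma_j)\overline\Theta$, where $\gamma_j\le0$ and $\gamma_j=0$ if $g^0_{jj}>(1-\varepsilon)g^1_{jj}$; (3) $h_gh_g^*=\Theta^\top\mathrm{diag}(\alpha_j^2)\overline\Theta$, $h_fh_f^*=(\alpha^2+\gamma)\Theta^\top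 B_2^\top\overline\Theta$, where $\gamma\le0$ and $\gamma=0$ if $\langle B_2,g^0\rangle>(1-\varepsilon)\langle B_2,g_1\rangle$; (4) $h_gh_g^*=\alpha^2\Theta^\top B_1^\top\overline\Theta$, $h_fh_f^*=\Theta^\top(\vec\alpha\vec\alpha^*+\Gamma)\overline\Theta$, where $\Gamma\le0$ and $\Gamma=0$ if $g^0>(1-\varepsilon)g_1$ (that is, the difference is positive semidefinite and not zero); with real $\alpha,\alpha_j$, $\vec\alpha\in\ell^2$, and multiplier matrices bounded in $\ell^2$. \textbf{Theorem.} Let $k\in\{1,2,3,4\}$, let $f^0,g^0$ be as above and satisfy the minimality condition that $\rho^{-1}(f^0+g^0)^{-1}$ is integrable (entrywise). If the factors of $f^0,g^0$ solve the problem $\|\widetilde\Phi_\tau\mathbf b\|^2-\sum_m\|s^f_m\|^2\to\sup$ over all $f=\Phi\Phi^*\in D_0^k$, $g=\Theta\Theta^*-\Phi\Phi^*\in D_\varepsilon^k$ factored in this way, then $(f^0,g^0)$ is least favourable in $D_0^k\times D_\varepsilon^k$, and the spectral characteristic of the optimal estimate for $(f^0,g^0)$ is minimax and equals $\beta\,\Psi_\tau^\top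 h_f$. If instead they solve the problem $\|\widetilde\Omega_\tau\mathbf b\|^2-\sum_m\|s^g_m\|^2\to\sup$ over all $g=\Omega\Omega^*\in D_\varepsilon^k$, $f=\Theta\Theta^*-\Omega\Omega^*\in D_0^k$ factored in this way, then the same holds with the characteristic $\beta(\vec B-\Psi_\tau^\top h_g)$. -/

import Mathlib

open MeasureTheory Filter Topology
open scoped ENNReal NNReal ComplexConjugate ComplexOrder

noncomputable section

namespace PCFilter

/-! ## Frequency domain -/

/-- Lebesgue measure on the frequency interval `(-π, π]`. -/
def freqMeasure : Measure ℝ := volume.restrict (Set.Ioc (-Real.pi) Real.pi)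

/-- The coefficient of `e^{-i n lam}` in the Fourier expansion of `F`. -/
def coef (F : ℝ → ℂ) (n : ℤ) : ℂ :=
  (1 / (2 * Real.pi) : ℂ) * ∫ lam, F lam * Complex.exp (Complex.I * n * lam) ∂freqMeasure

/-- The factor `|1 - e^{i lam τ}|^{2d} / lam^{2d}`. -/
def incWeight (d τ : ℕ) (lam : ℝ) : ℝ :=
  ‖1 - Complex.exp (Complex.I * lam * τ)‖ ^ (2 * d) / lam ^ (2 * d)

/-- The factor `(1 - e^{-i lam τ})^d / (i lam)^d`. -/
def incFactor (d τ : ℕ) (lam : ℝ) : ℂ :=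
  (1 - Complex.exp (-(Complex.I * lam * τ))) ^ d / (Complex.I * lam) ^ d

/-- Infinite matrices; the coordinates `1, 2, …` are numbered from `0`. -/
abbrev Mat := Matrix ℕ ℕ ℂ

/-- The index set `{1, …, M}` (numbered from `0`) of the innovations, `M ≤ ∞`. -/
abbrev Idx (M : ℕ∞) := {m : ℕ // (m : ℕ∞) < M}

/-- The trace of an infinite matrix. -/
def trace (A : Mat) : ℂ := ∑' k, A k k

/-- The pairing `⟨B, A⟩ = ∑ B_{kl} conj(A_{kl})`; it is the trace of `B A` for Hermitian `A`. -/
def pairing (B A : Mat) : ℂ := ∑' k, ∑' l, B k l * conj (A k l)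

/-- The value `v^⊤ A conj(v)` (real for Hermitian `A`). -/
def qform (A : Mat) (v : ℕ → ℂ) : ℝ := (∑' k, ∑' l, v k * A k l * conj (v l)).re

/-- The infinite matrix `A` determines a bounded operator in `ℓ²`. -/
def IsBoundedMat (A : Mat) : Prop :=
  ∃ C : ℝ, ∀ x y : ℕ →₀ ℂ,
    ‖x.sum fun k c => y.sum fun l e => c * A k l * e‖ ^ 2 ≤
      C * (x.sum fun _ c => ‖c‖ ^ 2) * (y.sum fun _ e => ‖e‖ ^ 2)

/-- Spectral densities: measurable functions with values in the positive semidefinite infinite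
matrices, with an integrable kernel (trace) norm. -/
structure IsSpectralDensity (f : ℝ → Mat) : Prop where
  measurable : ∀ k l, AEStronglyMeasurable (fun lam => f lam k l) freqMeasure
  posSemidef : ∀ᵐ lam ∂freqMeasure, (f lam).PosSemidef
  trace_finite : ∑' k, ∫⁻ lam, ‖f lam k k‖ₑ ∂freqMeasure < ∞

/-! ## The functional and its coefficients -/

/-- The integer frequency of the basis function `ẽ_k`; `k` is numbered from `0`, so the values
are `0, 1, -1, 2, -2, …`. -/
def basisFreq (k : ℕ) : ℤ := (-1) ^ (k + 1) * (((k + 1) / 2 : ℕ) : ℤ)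

/-- The orthonormal basis `ẽ_k` of `L²([0,T))`. -/
def basisFun (T : ℝ) (k : ℕ) (v : ℝ) : ℂ :=
  (1 / Real.sqrt T : ℂ) * Complex.exp (2 * Real.pi * Complex.I * basisFreq k * v / T)

/-- The interchange of the positions `2k` and `2k+1`, `k ≥ 1` (in numbering from `1`). -/
def swapIndex (k : ℕ) : ℕ := if k = 0 then 0 else if Odd k then k + 1 else k - 1

/-- The vector `a_j`, whose entries are the Fourier coefficients of `a(· + jT)` on `[0,T)`, in the
order `a_{1j}, a_{3j}, a_{2j}, a_{5j}, a_{4j}, …`. -/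
def aVec (T : ℝ) (a : ℝ → ℂ) (j k : ℕ) : ℂ :=
  ∫ v in Set.Ico 0 T, a (v + j * T) * conj (basisFun T (swapIndex k) v)

/-- The coefficients `d_τ(k)` of `(∑_j x^{τ j})^d`. -/
def dCoef (d τ k : ℕ) : ℂ :=
  PowerSeries.coeff k ((PowerSeries.mk fun n => if τ ∣ n then (1 : ℂ) else 0) ^ d)

/-- The vectors `b_j = (D^τ a)_j = ∑_{m ≤ j} d_τ(j-m) a_m`. -/
def bVec (T : ℝ) (d τ : ℕ) (a : ℝ → ℂ) (j k : ℕ) : ℂ :=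
  ∑ m ∈ Finset.range (j + 1), dCoef d τ (j - m) * aVec T a m k

/-- The `ℓ²` norm of a vector. -/
def l2norm (v : ℕ → ℂ) : ℝ := Real.sqrt (∑' k, ‖v k‖ ^ 2)

/-- The conditions on the coefficients `b_j` of the functional. -/
structure CoeffCondition (b : ℕ → ℕ → ℂ) : Prop where
  mem : ∀ j, Memℓp (b j) 2
  summable : Summable fun j => l2norm (b j)
  summable_weighted : Summable fun j : ℕ => ((j : ℝ) + 1) * l2norm (b j)

/-- `B_τ(e^{-i lam}) = ∑_j b_j e^{-i lam j}`. -/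
def symbolB (b : ℕ → ℕ → ℂ) (lam : ℝ) (k : ℕ) : ℂ :=
  ∑' j : ℕ, b j k * Complex.exp (-(Complex.I * lam * j))

/-! ## Linear estimates in the frequency domain -/

/-- The spectral characteristic of the finite linear estimate
`∑ x_{kj} (ξ_{k,-j} + η_{k,-j})`, `j ≥ 0`; the pair `(k, j)` is the index of `x`. -/
def polyChar (d τ : ℕ) (x : (ℕ × ℕ) →₀ ℂ) (lam : ℝ) (k : ℕ) : ℂ :=
  incFactor d τ lam * x.sum fun i c =>
    if i.1 = k then c * Complex.exp (-(Complex.I * lam * i.2)) else 0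

/-- The squared norm of `h` in `L²(F)`. -/
def normSqL2 (F : ℝ → Mat) (h : ℝ → ℕ → ℂ) : ℝ≥0∞ :=
  ∫⁻ lam, ENNReal.ofReal (qform (F lam) (h lam)) ∂freqMeasure

/-- The subspace `L²⁰(F)`: the closed linear span in `L²(F)` of the functions
`e^{i lam j} (1 - e^{-i lam τ})^d (i lam)^{-d} δ_k`, `j ≤ 0`. -/
structure MemL20 (d τ : ℕ) (F : ℝ → Mat) (h : ℝ → ℕ → ℂ) : Prop where
  measurable : ∀ k, AEStronglyMeasurable (fun lam => h lam k) freqMeasure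
  vector : ∀ᵐ lam ∂freqMeasure, Memℓp (h lam) 2
  finite : normSqL2 F h < ∞
  approx : ∀ ε : ℝ≥0∞, 0 < ε → ∃ x : (ℕ × ℕ) →₀ ℂ,
    normSqL2 F (fun lam k => h lam k - polyChar d τ x lam k) < ε

/-- The mean square error `Δ(h; f, g)` of the linear estimate with spectral characteristic `h`,
when the signal and the (uncorrelated) noise have the spectral densities `f` and `g`. -/
def mse (d τ : ℕ) (b : ℕ → ℕ → ℂ) (h : ℝ → ℕ → ℂ) (f g : ℝ → Mat) : ℝ≥0∞ :=
  ENNReal.ofReal (1 / (2 * Real.pi)) *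
    (normSqL2 f (fun lam k => incFactor d τ lam * symbolB b lam k - h lam k) + normSqL2 g h)

/-- The mean square error `Δ(f, g)` of the optimal estimate (the squared distance to the closed
span of the observations). -/
def optMse (d τ : ℕ) (b : ℕ → ℕ → ℂ) (f g : ℝ → Mat) : ℝ≥0∞ :=
  ⨅ x : (ℕ × ℕ) →₀ ℂ, mse d τ b (polyChar d τ x) f g

/-- `h` is the spectral characteristic of the optimal linear estimate. -/
def IsOptimalChar (d τ : ℕ) (b : ℕ → ℕ → ℂ) (f g : ℝ → Mat) (h : ℝ → ℕ → ℂ) : Prop :=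
  MemL20 d τ (fun lam => f lam + g lam) h ∧ mse d τ b h f g = optMse d τ b f g

/-- Least favourable densities in the class `D`. -/
def IsLeastFavourable (d τ : ℕ) (b : ℕ → ℕ → ℂ) (D : Set ((ℝ → Mat) × (ℝ → Mat)))
    (f₀ g₀ : ℝ → Mat) : Prop :=
  (f₀, g₀) ∈ D ∧ ∀ q ∈ D, optMse d τ b q.1 q.2 ≤ optMse d τ b f₀ g₀

/-- The set `H_D` of the spectral characteristics that are admissible for every pair in `D`. -/
def commonChars (d τ : ℕ) (D : Set ((ℝ → Mat) × (ℝ → Mat))) : Set (ℝ → ℕ → ℂ) :=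
  {h | ∀ q ∈ D, MemL20 d τ (fun lam => q.1 lam + q.2 lam) h}

/-- Minimax (robust) spectral characteristics for the class `D`. -/
def IsMinimaxChar (d τ : ℕ) (b : ℕ → ℕ → ℂ) (D : Set ((ℝ → Mat) × (ℝ → Mat)))
    (h₀ : ℝ → ℕ → ℂ) : Prop :=
  h₀ ∈ commonChars d τ D ∧
    ∀ h ∈ commonChars d τ D, (⨆ q ∈ D, mse d τ b h₀ q.1 q.2) ≤ ⨆ q ∈ D, mse d τ b h q.1 q.2

/-! ## The processes -/

section Processes

variable {Ω : Type*} [MeasurableSpace Ω] {μ : Measure Ω}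

/-- The increment `X^{(d)}(t, s) = ∑_l (-1)^l C(d,l) X(t - l s)`. -/
def increment (d : ℕ) (X : ℝ → Lp ℂ 2 μ) (t s : ℝ) : Lp ℂ 2 μ :=
  ∑ l ∈ Finset.range (d + 1), ((-1 : ℂ) ^ l * (d.choose l : ℂ)) • X (t - l * s)

/-- The components `ξ_{kj}` of the generated increment sequence: the Fourier coefficients of
`u ↦ X^{(d)}(u + jT, τT)` on `[0,T)`. -/
def genSeq (T : ℝ) (d τ : ℕ) (X : ℝ → Lp ℂ 2 μ) (k : ℕ) (j : ℤ) : Lp ℂ 2 μ :=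
  ∫ v in Set.Ico 0 T, conj (basisFun T k v) • increment d X (v + j * T) (τ * T)

/-- A second order process with periodically stationary `d`th increments of period `T`, whose
generated increment sequence has mean zero and the spectral density `f`. -/
structure HasIncrementDensity (T : ℝ) (d : ℕ) (X : ℝ → Lp ℂ 2 μ) (f : ℝ → Mat) : Prop where
  locallyIntegrable : LocallyIntegrable X volume
  mean_periodic : ∀ (t : ℝ) (τ : ℤ), ∫ ω, increment d X (t + T) (τ * T) ω ∂μ =
    ∫ ω, increment d X t (τ * T) ω ∂μ
  cov_periodic : ∀ (t s : ℝ) (τ₁ τ₂ : ℤ),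
    inner ℂ (increment d X (s + T) (τ₂ * T)) (increment d X (t + T) (τ₁ * T)) =
      inner ℂ (increment d X s (τ₂ * T)) (increment d X t (τ₁ * T))
  mean_zero : ∀ (τ k : ℕ) (j : ℤ), 0 < τ → ∫ ω, genSeq T d τ X k j ω ∂μ = 0
  covariance : ∀ (τ₁ τ₂ k n : ℕ) (l j : ℤ), 0 < τ₁ → 0 < τ₂ →
    inner ℂ (genSeq T d τ₂ X n j) (genSeq T d τ₁ X k l) =
      (1 / (2 * Real.pi) : ℂ) * ∫ lam : ℝ,
        Complex.exp (Complex.I * ((l - j : ℤ) : ℂ) * lam) *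
          (1 - Complex.exp (-(Complex.I * τ₁ * lam))) ^ d *
          (1 - Complex.exp (Complex.I * τ₂ * lam)) ^ d / (lam : ℂ) ^ (2 * d) * f lam k n
        ∂freqMeasure

/-- A signal `X` and a noise `Y`, with uncorrelated increments and with the spectral densities
`f` and `g`. -/
structure IsFilteringModel (T : ℝ) (d : ℕ) (X Y : ℝ → Lp ℂ 2 μ) (f g : ℝ → Mat) : Prop where
  signal : HasIncrementDensity T d X f
  noise : HasIncrementDensity T d Y g
  uncorrelated : ∀ t s t' s' : ℝ, inner ℂ (increment d Y t' s') (increment d X t s) = 0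

/-- The functional `Aξ`, represented as `∑_j b_j^⊤ ξ_{-j}` through the increments. -/
def signalFunctional (T : ℝ) (d τ : ℕ) (b : ℕ → ℕ → ℂ) (X : ℝ → Lp ℂ 2 μ) : Lp ℂ 2 μ :=
  ∑' j : ℕ, ∑' k : ℕ, b j k • genSeq T d τ X k (-(j : ℤ))

/-- The finite linear estimate `∑ x_{kj} (ξ_{k,-j} + η_{k,-j})`, `j ≥ 0`. -/
def finiteEstimate (T : ℝ) (d τ : ℕ) (X Y : ℝ → Lp ℂ 2 μ) (x : (ℕ × ℕ) →₀ ℂ) : Lp ℂ 2 μ :=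
  x.sum fun i c => c • (genSeq T d τ X i.1 (-(i.2 : ℤ)) + genSeq T d τ Y i.1 (-(i.2 : ℤ)))

/-- The closed linear span `H⁰(ξ+η)` of the observed increments. -/
def observed (T : ℝ) (d τ : ℕ) (X Y : ℝ → Lp ℂ 2 μ) : Set (Lp ℂ 2 μ) :=
  closure (Set.range (finiteEstimate T d τ X Y))

/-- `Z` is the mean square optimal linear estimate, i.e. the projection of `Aξ` on `H⁰(ξ+η)`. -/
def IsOptimalEstimate (T : ℝ) (d τ : ℕ) (b : ℕ → ℕ → ℂ) (X Y : ℝ → Lp ℂ 2 μ)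
    (Z : Lp ℂ 2 μ) : Prop :=
  Z ∈ observed T d τ X Y ∧
    ∀ V ∈ observed T d τ X Y, inner ℂ V (signalFunctional T d τ b X - Z) = 0

/-- The estimate `Z` has the spectral characteristic `h`: some finite estimates converge to `Z`
in mean square while their spectral characteristics converge to `h` in `L²(f+g)`. -/
def HasSpectralChar (T : ℝ) (d τ : ℕ) (X Y : ℝ → Lp ℂ 2 μ) (f g : ℝ → Mat) (Z : Lp ℂ 2 μ)
    (h : ℝ → ℕ → ℂ) : Prop :=
  ∃ x : ℕ → ((ℕ × ℕ) →₀ ℂ),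
    Tendsto (fun n => finiteEstimate T d τ X Y (x n)) atTop (𝓝 Z) ∧
    Tendsto (fun n => normSqL2 (fun lam => f lam + g lam)
      (fun lam k => h lam k - polyChar d τ (x n) lam k)) atTop (𝓝 0)

/-- The mean square error of the optimal linear estimate of `Aξ`. -/
def optimalError (T : ℝ) (d τ : ℕ) (b : ℕ → ℕ → ℂ) (X Y : ℝ → Lp ℂ 2 μ) : ℝ :=
  Metric.infDist (signalFunctional T d τ b X) (observed T d τ X Y) ^ 2

end Processes

/-! ## Factorizations -/

/-- `F` is square integrable with the expansion `F(lam) = ∑_{n ≥ 0} c(n) e^{-i n lam}`. -/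
structure IsCausalSeries (c : ℕ → ℂ) (F : ℝ → ℂ) : Prop where
  memLp : MemLp F 2 freqMeasure
  coef_nonneg : ∀ n : ℕ, coef F n = c n
  coef_neg : ∀ n : ℤ, n < 0 → coef F n = 0

/-- The coefficients of a matrix function. -/
def matCoef {ι κ : Type} (Φ : ℝ → Matrix ι κ ℂ) (n : ℕ) : Matrix ι κ ℂ :=
  fun i j => coef (fun lam => Φ lam i j) n

/-- `Φ(e^{-i lam}) = ∑_{n ≥ 0} φ(n) e^{-i n lam}`, entry by entry in mean square. -/
def IsCausal {ι κ : Type} (Φ : ℝ → Matrix ι κ ℂ) : Prop :=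
  ∀ i j, IsCausalSeries (fun n => matCoef Φ n i j) (fun lam => Φ lam i j)

/-- The canonical factorization `f = Φ(e^{-i lam}) Φ(e^{-i lam})^*` with a causal `∞ × M` matrix
function with square summable coefficients. The last field is what makes it canonical: the
innovations belong to the closed span of the present and the past of the sequence. -/
structure IsCanonicalFactorization {M : ℕ∞} (f : ℝ → Mat) (Φ : ℝ → Matrix ℕ (Idx M) ℂ) :
    Prop where
  causal : IsCausal Φ
  sq_integrable : ∫⁻ lam, ∑' k, ∑' i, ‖Φ lam k i‖ₑ ^ 2 ∂freqMeasure < ∞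
  factor : ∀ᵐ lam ∂freqMeasure, ∀ k l, HasSum (fun i => Φ lam k i * conj (Φ lam l i)) (f lam k l)
  innovation : ∀ (i : Idx M) (ε : ℝ≥0∞), 0 < ε → ∃ x : (ℕ × ℕ) →₀ ℂ,
    ∫⁻ lam, ∑' m : Idx M, ‖(x.sum fun p c =>
      c * Complex.exp (-(Complex.I * lam * p.2)) * Φ lam p.1 m) -
        (if m = i then 1 else 0)‖ₑ ^ 2 ∂freqMeasure < ε

/-- A causal function `w_τ` with `|w_τ(e^{-i lam})|² = |1 - e^{i lam τ}|^{2d} / lam^{2d}`. -/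
structure IsWeightFactor (d τ : ℕ) (w : ℝ → ℂ) : Prop where
  causal : IsCausalSeries (fun n => coef w n) w
  factor : ∀ᵐ lam ∂freqMeasure, ‖w lam‖ ^ 2 = incWeight d τ lam

/-- `Φ_τ = w_τ Φ`, and likewise for `Θ`, `Ω`. -/
def tauFactor {M : ℕ∞} (w : ℝ → ℂ) (Φ : ℝ → Matrix ℕ (Idx M) ℂ) : ℝ → Matrix ℕ (Idx M) ℂ :=
  fun lam => w lam • Φ lam

/-- `Ψ_τ`, determined by `Ψ = w_τ Ψ_τ`. -/
def tauInv {M : ℕ∞} (w : ℝ → ℂ) (Ψ : ℝ → Matrix (Idx M) ℕ ℂ) : ℝ → Matrix (Idx M) ℕ ℂ :=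
  fun lam => (w lam)⁻¹ • Ψ lam

/-- The factorization `G = Ψ(e^{-i lam})^* Ψ(e^{-i lam})` of the inverse `G` of `Θ Θ^*`: the causal
matrix function `Ψ` is inverse to `Θ`, that is `Ψ Θ = E_M` and `Θ Ψ = E_∞`. The function `Ψ_τ` is
causal too, and its rows are square summable. -/
structure IsInverseFactorization {M : ℕ∞} (w : ℝ → ℂ) (Θ : ℝ → Matrix ℕ (Idx M) ℂ)
    (Ψ : ℝ → Matrix (Idx M) ℕ ℂ) (G : ℝ → Mat) : Prop where
  causal : IsCausal Ψ
  causal_tau : IsCausal (tauInv w Ψ)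
  rows : ∀ i, ∫⁻ lam, ∑' k, ‖tauInv w Ψ lam i k‖ₑ ^ 2 ∂freqMeasure < ∞
  left_inv : ∀ᵐ lam ∂freqMeasure, ∀ i n,
    HasSum (fun k => Ψ lam i k * Θ lam k n) (if i = n then 1 else 0)
  right_inv : ∀ᵐ lam ∂freqMeasure, ∀ k l,
    HasSum (fun m => Θ lam k m * Ψ lam m l) (if k = l then 1 else 0)
  factor : ∀ᵐ lam ∂freqMeasure, ∀ k l,
    HasSum (fun m => conj (Ψ lam m k) * Ψ lam m l) (G lam k l)

/-- The minimality condition: `lam^{2d} |1 - e^{i lam τ}|^{-2d} G(lam)` is integrable, where `G` is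
the inverse of `f + g`. -/
def MinimalityCondition (d τ : ℕ) (G : ℝ → Mat) : Prop :=
  ∀ k l, Integrable (fun lam => (((incWeight d τ lam)⁻¹ : ℝ) : ℂ) * G lam k l) freqMeasure

/-- The operator `Φ̃` with the matrix entries `φ^⊤(l-j)`, `j ≤ l`, applied to `b`. -/
def tildeOp {M : ℕ∞} (φ : ℕ → Matrix ℕ (Idx M) ℂ) (b : ℕ → ℕ → ℂ) (l : ℕ) (i : Idx M) : ℂ :=
  ∑ j ∈ Finset.range (l + 1), ∑' k, φ (l - j) k i * b j k

/-- `Φ̃` is a bounded operator in the space `ℓ²`. -/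
def IsL2Operator {M : ℕ∞} (φ : ℕ → Matrix ℕ (Idx M) ℂ) : Prop :=
  ∃ C : ℝ≥0, ∀ x : (ℕ × ℕ) →₀ ℂ,
    ∑' l, ∑' i, ‖tildeOp φ (fun j k => x (j, k)) l i‖ₑ ^ 2 ≤ C * x.sum fun _ c => ‖c‖ₑ ^ 2

/-- `c(m) = ∑_l conj(φ(l)) (Φ̃ b)_{l+m}`. -/
def cVec {M : ℕ∞} (φ : ℕ → Matrix ℕ (Idx M) ℂ) (b : ℕ → ℕ → ℂ) (m k : ℕ) : ℂ :=
  ∑' l, ∑' i, conj (φ l k i) * tildeOp φ b (l + m) i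

/-- `(conj(ψ) C)_m = ∑_j conj(ψ(j)) c(j+m)`. -/
def psiC {M N : ℕ∞} (ψ : ℕ → Matrix (Idx N) ℕ ℂ) (φ : ℕ → Matrix ℕ (Idx M) ℂ)
    (b : ℕ → ℕ → ℂ) (m : ℕ) (i : Idx N) : ℂ :=
  ∑' j, ∑' k, conj (ψ j i k) * cVec φ b (j + m) k

/-- `h(e^{-i lam}) = ∑_m (conj(ψ) C)_m e^{-i lam m}`, in mean square. -/
def IsPsiCSeries {M N : ℕ∞} (ψ : ℕ → Matrix (Idx N) ℕ ℂ) (φ : ℕ → Matrix ℕ (Idx M) ℂ)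
    (b : ℕ → ℕ → ℂ) (h : ℝ → Idx N → ℂ) : Prop :=
  ∀ i, IsCausalSeries (fun m => psiC ψ φ b m i) (fun lam => h lam i)

/-- The objective `‖Φ̃ b‖² - ‖conj(ψ) C‖²`. -/
def objective {M N : ℕ∞} (ψ : ℕ → Matrix (Idx N) ℕ ℂ) (φ : ℕ → Matrix ℕ (Idx M) ℂ)
    (b : ℕ → ℕ → ℂ) : ℝ :=
  (∑' l, ∑' i, ‖tildeOp φ b l i‖ ^ 2) - ∑' m, ∑' i, ‖psiC ψ φ b m i‖ ^ 2

/-- The factors of `f` and of `f + g` determine a solution of the problem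
`‖Φ̃_τ b‖² - ‖conj(ψ_τ) C^f_τ‖² → sup` over `f = Φ Φ^* ∈ D_f`, `g = Θ Θ^* - Φ Φ^* ∈ D_g`. -/
def SolvesProblemF (b : ℕ → ℕ → ℂ) (w : ℝ → ℂ) (Df Dg : Set (ℝ → Mat)) {M₀ N₀ : ℕ∞}
    (Φ₀ : ℝ → Matrix ℕ (Idx M₀) ℂ) (Ψ₀ : ℝ → Matrix (Idx N₀) ℕ ℂ) : Prop :=
  ∀ (M N : ℕ∞) (f g G : ℝ → Mat) (Φ : ℝ → Matrix ℕ (Idx M) ℂ) (Θ : ℝ → Matrix ℕ (Idx N) ℂ)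
    (Ψ : ℝ → Matrix (Idx N) ℕ ℂ), f ∈ Df → g ∈ Dg →
    IsCanonicalFactorization f Φ →
    IsCanonicalFactorization (fun lam => f lam + g lam) Θ →
    IsInverseFactorization w Θ Ψ G →
    IsL2Operator (matCoef (tauFactor w Φ)) →
    objective (matCoef (tauInv w Ψ)) (matCoef (tauFactor w Φ)) b ≤
      objective (matCoef (tauInv w Ψ₀)) (matCoef (tauFactor w Φ₀)) b

/-- The factors of `g` and of `f + g` determine a solution of the problem
`‖Ω̃_τ b‖² - ‖conj(ψ_τ) C^g_τ‖² → sup` over `g = Ω Ω^* ∈ D_g`, `f = Θ Θ^* - Ω Ω^* ∈ D_f`. -/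
def SolvesProblemG (b : ℕ → ℕ → ℂ) (w : ℝ → ℂ) (Df Dg : Set (ℝ → Mat)) {M₀ N₀ : ℕ∞}
    (Ω₀ : ℝ → Matrix ℕ (Idx M₀) ℂ) (Ψ₀ : ℝ → Matrix (Idx N₀) ℕ ℂ) : Prop :=
  ∀ (M N : ℕ∞) (f g G : ℝ → Mat) (Om : ℝ → Matrix ℕ (Idx M) ℂ) (Θ : ℝ → Matrix ℕ (Idx N) ℂ)
    (Ψ : ℝ → Matrix (Idx N) ℕ ℂ), f ∈ Df → g ∈ Dg →
    IsCanonicalFactorization g Om →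
    IsCanonicalFactorization (fun lam => f lam + g lam) Θ →
    IsInverseFactorization w Θ Ψ G →
    IsL2Operator (matCoef (tauFactor w Om)) →
    objective (matCoef (tauInv w Ψ)) (matCoef (tauFactor w Om)) b ≤
      objective (matCoef (tauInv w Ψ₀)) (matCoef (tauFactor w Ω₀)) b

/-- The spectral characteristic
`(1-e^{-i lam τ})^d (i lam)^{-d} Ψ_τ^⊤ ∑_m (conj(ψ_τ) C^f_τ)_m e^{-i lam m}`. -/
def charF {N : ℕ∞} (d τ : ℕ) (w : ℝ → ℂ) (Ψ : ℝ → Matrix (Idx N) ℕ ℂ) (hf : ℝ → Idx N → ℂ)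
    (lam : ℝ) (k : ℕ) : ℂ :=
  incFactor d τ lam * ∑' i, tauInv w Ψ lam i k * hf lam i

/-- The spectral characteristic
`(1-e^{-i lam τ})^d (i lam)^{-d} (B_τ - Ψ_τ^⊤ ∑_m (conj(ψ_τ) C^g_τ)_m e^{-i lam m})`. -/
def charG {N : ℕ∞} (d τ : ℕ) (b : ℕ → ℕ → ℂ) (w : ℝ → ℂ) (Ψ : ℝ → Matrix (Idx N) ℕ ℂ)
    (hg : ℝ → Idx N → ℂ) (lam : ℝ) (k : ℕ) : ℂ :=
  incFactor d τ lam * (symbolB b lam k - ∑' i, tauInv w Ψ lam i k * hg lam i)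

/-! ## Classes of densities and the equations -/

/-- The data of the classes `D_0^k` and `D_ε^k`. -/
structure ClassData where
  P : Mat
  p : ℝ
  pk : ℕ → ℝ
  B₁ : Mat
  ε : ℝ
  g₁ : ℝ → Mat
  q : ℝ
  qk : ℕ → ℝ
  B₂ : Mat
  Q : Mat
  B₁_posSemidef : B₁.PosSemidef
  B₁_bounded : IsBoundedMat B₁
  B₂_posSemidef : B₂.PosSemidef
  B₂_bounded : IsBoundedMat B₂
  ε_nonneg : 0 ≤ ε
  ε_le_one : ε ≤ 1
  g₁_density : IsSpectralDensity g₁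

/-- The normalized integral `(1/2π) ∫ F`. -/
def avg (F : ℝ → ℂ) : ℂ := (1 / (2 * Real.pi) : ℂ) * ∫ lam, F lam ∂freqMeasure

namespace ClassData

/-- The classes `D_0^1, …, D_0^4` (numbered from `0`). -/
def signalClass (C : ClassData) : Fin 4 → Set (ℝ → Mat)
  | 0 => {f | IsSpectralDensity f ∧ ∀ k l, avg (fun lam => f lam k l) = C.P k l}
  | 1 => {f | IsSpectralDensity f ∧ avg (fun lam => trace (f lam)) = C.p}
  | 2 => {f | IsSpectralDensity f ∧ ∀ k, avg (fun lam => f lam k k) = C.pk k}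
  | 3 => {f | IsSpectralDensity f ∧ avg (fun lam => pairing C.B₁ (f lam)) = C.p}

/-- The classes `D_ε^1, …, D_ε^4` (numbered from `0`). -/
def noiseClass (C : ClassData) : Fin 4 → Set (ℝ → Mat)
  | 0 => {g | IsSpectralDensity g ∧
      (∃ W, IsSpectralDensity W ∧ ∀ᵐ lam ∂freqMeasure,
        trace (g lam) = (1 - C.ε) * trace (C.g₁ lam) + C.ε * trace (W lam)) ∧
      avg (fun lam => trace (g lam)) = C.q}
  | 1 => {g | IsSpectralDensity g ∧
      (∃ W, IsSpectralDensity W ∧ ∀ᵐ lam ∂freqMeasure, ∀ k,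
        g lam k k = (1 - C.ε) * C.g₁ lam k k + C.ε * W lam k k) ∧
      ∀ k, avg (fun lam => g lam k k) = C.qk k}
  | 2 => {g | IsSpectralDensity g ∧
      (∃ W, IsSpectralDensity W ∧ ∀ᵐ lam ∂freqMeasure,
        pairing C.B₂ (g lam) =
          (1 - C.ε) * pairing C.B₂ (C.g₁ lam) + C.ε * pairing C.B₂ (W lam)) ∧
      avg (fun lam => pairing C.B₂ (g lam)) = C.q}
  | 3 => {g | IsSpectralDensity g ∧
      (∃ W, IsSpectralDensity W ∧ ∀ᵐ lam ∂freqMeasure, ∀ k l,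
        g lam k l = (1 - C.ε) * C.g₁ lam k l + C.ε * W lam k l) ∧
      ∀ k l, avg (fun lam => g lam k l) = C.Q k l}

/-- The class `D_0^k × D_ε^k`. -/
def pairClass (C : ClassData) (k : Fin 4) : Set ((ℝ → Mat) × (ℝ → Mat)) :=
  C.signalClass k ×ˢ C.noiseClass k

end ClassData

/-- The matrix `Θ^⊤ A conj(Θ)`. -/
def sandwich {N : ℕ∞} (Θ : Matrix ℕ (Idx N) ℂ) (A : Mat) (m n : Idx N) : ℂ :=
  ∑' k, Θ k m * ∑' l, A k l * conj (Θ l n)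

/-- The equation `h h^* = Θ^⊤ A conj(Θ)` between functions of the frequency. -/
def FactorEquation {N : ℕ∞} (h : ℝ → Idx N → ℂ) (Θ : ℝ → Matrix ℕ (Idx N) ℂ) (A : ℝ → Mat) :
    Prop :=
  ∀ᵐ lam ∂freqMeasure, ∀ m n, h lam m * conj (h lam n) = sandwich (Θ lam) (A lam) m n

/-- The matrix `α α^*`. -/
def outer (α : ℕ → ℂ) : Mat := fun k l => α k * conj (α l)

/-- The four pairs of equations, with the Lagrange multipliers and the complementary functions;
`hg` and `hf` stand for `h⁰_{τ,g}` and `h⁰_{τ,f}`. In the fourth pair, `g₀ > (1-ε) g₁` is the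
strict order of Hermitian matrices (the difference is positive semidefinite and not zero). -/
def MultiplierEquations (C : ClassData) (g₀ : ℝ → Mat) {N : ℕ∞} (Θ : ℝ → Matrix ℕ (Idx N) ℂ)
    (hf hg : ℝ → Idx N → ℂ) : Fin 4 → Prop
  | 0 => ∃ (v : ℕ → ℂ) (α : ℝ) (γ : ℝ → ℝ), Memℓp v 2 ∧
      (∀ᵐ lam ∂freqMeasure, γ lam ≤ 0 ∧
        ((1 - C.ε) * (trace (C.g₁ lam)).re < (trace (g₀ lam)).re → γ lam = 0)) ∧
      FactorEquation hg Θ (fun _ => outer v) ∧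
      FactorEquation hf Θ (fun lam => ((α ^ 2 + γ lam : ℝ) : ℂ) • (1 : Mat))
  | 1 => ∃ (α : ℝ) (αk : ℕ → ℝ) (γ : ℕ → ℝ → ℝ), (∃ K, ∀ k, |αk k| ≤ K) ∧
      (∀ᵐ lam ∂freqMeasure, (∃ K, ∀ k, |γ k lam| ≤ K) ∧ ∀ k, γ k lam ≤ 0 ∧
        ((1 - C.ε) * (C.g₁ lam k k).re < (g₀ lam k k).re → γ k lam = 0)) ∧
      FactorEquation hg Θ (fun _ => ((α ^ 2 : ℝ) : ℂ) • (1 : Mat)) ∧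
      FactorEquation hf Θ
        (fun lam => Matrix.diagonal fun k => ((αk k ^ 2 + γ k lam : ℝ) : ℂ))
  | 2 => ∃ (αk : ℕ → ℝ) (α : ℝ) (γ : ℝ → ℝ), (∃ K, ∀ k, |αk k| ≤ K) ∧
      (∀ᵐ lam ∂freqMeasure, γ lam ≤ 0 ∧
        ((1 - C.ε) * (pairing C.B₂ (C.g₁ lam)).re < (pairing C.B₂ (g₀ lam)).re → γ lam = 0)) ∧
      FactorEquation hg Θ (fun _ => Matrix.diagonal fun k => ((αk k ^ 2 : ℝ) : ℂ)) ∧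
      FactorEquation hf Θ (fun lam => ((α ^ 2 + γ lam : ℝ) : ℂ) • C.B₂.transpose)
  | 3 => ∃ (α : ℝ) (v : ℕ → ℂ) (Γ : ℝ → Mat), Memℓp v 2 ∧
      (∀ᵐ lam ∂freqMeasure, (-(Γ lam)).PosSemidef ∧ IsBoundedMat (Γ lam) ∧
        ((g₀ lam - ((1 - C.ε : ℝ) : ℂ) • C.g₁ lam).PosSemidef ∧
          g₀ lam ≠ ((1 - C.ε : ℝ) : ℂ) • C.g₁ lam → Γ lam = 0)) ∧
      FactorEquation hg Θ (fun _ => ((α ^ 2 : ℝ) : ℂ) • C.B₁.transpose) ∧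
      FactorEquation hf Θ (fun lam => outer v + Γ lam)

/-- The densities `f₀, g₀` are least favourable in `D`, and `h₀`, the spectral characteristic of
the optimal estimate for `f₀, g₀`, is minimax. The last two fields say what this means for the
processes: the optimal estimate of `Aξ` has the spectral characteristic `h₀` and the error
`Δ(f₀,g₀)` for all processes with the densities `f₀, g₀`, and no processes with densities in `D`
have a larger error of the optimal estimate. -/
structure IsRobustSolution.{u} (T : ℝ) (d τ : ℕ) (b : ℕ → ℕ → ℂ)
    (D : Set ((ℝ → Mat) × (ℝ → Mat))) (f₀ g₀ : ℝ → Mat) (h₀ : ℝ → ℕ → ℂ) : Prop where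
  leastFavourable : IsLeastFavourable d τ b D f₀ g₀
  optimal : IsOptimalChar d τ b f₀ g₀ h₀
  minimax : IsMinimaxChar d τ b D h₀
  estimate : ∀ (S : Type u) [MeasurableSpace S] (μ : Measure S) [IsProbabilityMeasure μ]
    (X Y : ℝ → Lp ℂ 2 μ), IsFilteringModel T d X Y f₀ g₀ →
    (∃ Z, IsOptimalEstimate T d τ b X Y Z ∧ HasSpectralChar T d τ X Y f₀ g₀ Z h₀) ∧
    ENNReal.ofReal (optimalError T d τ b X Y) = optMse d τ b f₀ g₀
  worstCase : ∀ (S S' : Type u) [MeasurableSpace S] [MeasurableSpace S'] (μ : Measure S)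
    (μ' : Measure S') [IsProbabilityMeasure μ] [IsProbabilityMeasure μ']
    (X₀ Y₀ : ℝ → Lp ℂ 2 μ) (X Y : ℝ → Lp ℂ 2 μ') (f g : ℝ → Mat), (f, g) ∈ D →
    IsFilteringModel T d X₀ Y₀ f₀ g₀ → IsFilteringModel T d X Y f g →
    optimalError T d τ b X Y ≤ optimalError T d τ b X₀ Y₀

end PCFilter

end

open PCFilter

universe u

/-! The proof exhibits a saddle point: a characteristic h⁰ that is optimal for (f⁰, g⁰) and whose
error over D is largest at (f⁰, g⁰). For (f, g) in D, Δ(f,g) ≤ Δ(h⁰;f,g) ≤ Δ(h⁰;f⁰,g⁰) = Δ(f⁰,g⁰),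
so the pair is least favourable. For h in H_D, the supremum of Δ(h;·) is at least Δ(h;f⁰,g⁰) ≥
Δ(f⁰,g⁰), so h⁰ is minimax.

Optimality. Since ΦΦ* ≤ ΘΘ*, the matrix R = ΨΦ = Ψ_τ^{}Φ_τ is a contraction. The series h_f is the
causal projection of E = conj(R) Φ_τ^⊤ B, while conj(Θ_τ) E = conj(Φ_τ) Φ_τ^⊤ B. The discarded part
of E has only negative coefficients, and its pairing with the causal Θ_τ has no nonnegative ones
(`coef_causal_part_eq`). Hence f βB and (f+g) βs, with s = Ψ_τ^⊤ h_f, have the same products with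
all finite estimates (`coef_bform_charVec`, `iform_eq_of_coef`). These are the normal equations, and
Pythagoras makes h⁰ = βs optimal. The same argument for the noise gives t = Ψ_τ^⊤ h_g, and adding
the two systems gives B = s + t (`symbolB_eq_of_orthogonal`). So the two formulas for the
characteristic agree, and βB − h⁰ = βt.

Saddle point. Put u_f = Ψ^⊤ h_f and u_g = Ψ^⊤ h_g. As |β| = |w|, the error Δ(h⁰;f,g) is the average
of u_g^⊤ f conj(u_g) + u_f^⊤ g conj(u_f). Inverting Θ in a multiplier equation gives u u* =
multiplier matrix (`sandwich_factor`). The left side has rank at most one, which makes every case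
explicit. The signal term then depends only on the averages fixed in D_0^k, and the noise term is
largest at g⁰ by complementary slackness (`MultiplierEquations.saddle`).

Two facts make this rigorous. Square summable rows of Ψ_τ force 1/w to be integrable, hence d = 0 or
τ = 1, and ρ is bounded above and below (`order_zero_or_step_one`). Moreover s is then bounded and
causal, so its Fejér means are uniformly bounded finite estimates. A subsequence of them converges
in L²(F) for every density F simultaneously, which puts h⁰ in H_D. The statements on processes
follow from the isometry between finite sums of the ξ_{kj} and their characteristics. -/

noncomputable section

namespace PCFilter

/-! ## Square summable families -/

section SquareSummable

variable {ι κ : Type*}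

/-- Square summable families. -/
def SqSum (v : ι → ℂ) : Prop := Summable fun k => ‖v k‖ ^ 2

/-- The squared `ℓ²` norm. -/
def nsq (v : ι → ℂ) : ℝ := ∑' k, ‖v k‖ ^ 2

theorem nsq_nonneg (v : ι → ℂ) : 0 ≤ nsq v := tsum_nonneg fun _ => by positivity

theorem memℓp_two_iff {v : ℕ → ℂ} : Memℓp v 2 ↔ SqSum v := by
  rw [memℓp_gen_iff (by norm_num)]; simp [SqSum]

theorem SqSum.mono {v w : ι → ℂ} (hw : SqSum w) (h : ∀ i, ‖v i‖ ≤ ‖w i‖) : SqSum v :=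
  hw.of_nonneg_of_le (fun _ => by positivity) fun i => by gcongr; exact h i

theorem nsq_mono {v w : ι → ℂ} (hw : SqSum w) (h : ∀ i, ‖v i‖ ≤ ‖w i‖) : nsq v ≤ nsq w :=
  (hw.mono h).tsum_le_tsum (fun i => by gcongr; exact h i) hw

theorem SqSum.conj {v : ι → ℂ} (hv : SqSum v) : SqSum fun i => conj (v i) :=
  hv.mono fun i => by simp

theorem nsq_conj (v : ι → ℂ) : nsq (fun i => conj (v i)) = nsq v := by simp [nsq]

theorem SqSum.zero : SqSum (fun _ : ι => (0 : ℂ)) := by simp [SqSum, summable_zero]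

theorem nsq_zero : nsq (fun _ : ι => (0 : ℂ)) = 0 := by simp [nsq]

theorem norm_add_sq_le_two (a b : ℂ) : ‖a + b‖ ^ 2 ≤ 2 * ‖a‖ ^ 2 + 2 * ‖b‖ ^ 2 := by
  have := norm_add_le a b
  nlinarith [sq_nonneg (‖a‖ - ‖b‖), norm_nonneg (a + b), norm_nonneg a, norm_nonneg b]

theorem SqSum.add {v w : ι → ℂ} (hv : SqSum v) (hw : SqSum w) : SqSum fun i => v i + w i :=
  ((hv.mul_left 2).add (hw.mul_left 2)).of_nonneg_of_le (fun _ => by positivity)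
    fun i => norm_add_sq_le_two _ _

theorem nsq_add_le {v w : ι → ℂ} (hv : SqSum v) (hw : SqSum w) :
    nsq (fun i => v i + w i) ≤ 2 * nsq v + 2 * nsq w := by
  unfold nsq
  rw [← tsum_mul_left, ← tsum_mul_left, ← (hv.mul_left 2).tsum_add (hw.mul_left 2)]
  exact (hv.add hw).tsum_le_tsum (fun i => norm_add_sq_le_two _ _)
    ((hv.mul_left 2).add (hw.mul_left 2))

theorem SqSum.const_mul {v : ι → ℂ} (hv : SqSum v) (c : ℂ) : SqSum fun i => c * v i := by
  unfold SqSum; simp only [norm_mul, mul_pow]; exact hv.mul_left _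

theorem nsq_const_mul (v : ι → ℂ) (c : ℂ) : nsq (fun i => c * v i) = ‖c‖ ^ 2 * nsq v := by
  simp only [nsq, norm_mul, mul_pow, tsum_mul_left]

theorem SqSum.neg {v : ι → ℂ} (hv : SqSum v) : SqSum fun i => - v i := hv.mono fun i => by simp

theorem nsq_neg (v : ι → ℂ) : nsq (fun i => - v i) = nsq v := by simp [nsq]

theorem SqSum.sub {v w : ι → ℂ} (hv : SqSum v) (hw : SqSum w) : SqSum fun i => v i - w i := by
  simpa [sub_eq_add_neg] using hv.add hw.neg

theorem nsq_sub_le {v w : ι → ℂ} (hv : SqSum v) (hw : SqSum w) :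
    nsq (fun i => v i - w i) ≤ 2 * nsq v + 2 * nsq w := by
  simpa [sub_eq_add_neg, nsq_neg] using nsq_add_le hv hw.neg

theorem SqSum.summable_norm_mul {v w : ι → ℂ} (hv : SqSum v) (hw : SqSum w) :
    Summable fun i => ‖v i * w i‖ :=
  (Summable.add hv hw).of_nonneg_of_le (fun _ => by positivity) fun i => by
    rw [norm_mul]; nlinarith [sq_nonneg (‖v i‖ - ‖w i‖), sq_nonneg ‖v i‖, sq_nonneg ‖w i‖]

theorem SqSum.summable_mul {v w : ι → ℂ} (hv : SqSum v) (hw : SqSum w) :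
    Summable fun i => v i * w i := (hv.summable_norm_mul hw).of_norm

theorem sq_tsum_norm_mul_le {v w : ι → ℂ} (hv : SqSum v) (hw : SqSum w) :
    (∑' i, ‖v i * w i‖) ^ 2 ≤ nsq v * nsq w := by
  have h := (hv.summable_norm_mul hw).hasSum.pow 2
  refine le_of_tendsto h (Eventually.of_forall fun s => ?_)
  have h1 := Finset.sum_mul_sq_le_sq_mul_sq s (fun i => ‖v i‖) (fun i => ‖w i‖)
  simp only [norm_mul]
  refine h1.trans ?_
  gcongr
  · exact nsq_nonneg v
  · exact hv.sum_le_tsum s fun _ _ => by positivity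
  · exact hw.sum_le_tsum s fun _ _ => by positivity

theorem tsum_norm_mul_le {v w : ι → ℂ} (hv : SqSum v) (hw : SqSum w) :
    ∑' i, ‖v i * w i‖ ≤ √(nsq v) * √(nsq w) := by
  rw [← Real.sqrt_mul (nsq_nonneg v)]
  exact Real.le_sqrt_of_sq_le (sq_tsum_norm_mul_le hv hw)

theorem norm_tsum_mul_sq_le {v w : ι → ℂ} (hv : SqSum v) (hw : SqSum w) :
    ‖∑' i, v i * w i‖ ^ 2 ≤ nsq v * nsq w :=
  (pow_le_pow_left₀ (norm_nonneg _) (norm_tsum_le_tsum_norm (hv.summable_norm_mul hw)) 2).trans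
    (sq_tsum_norm_mul_le hv hw)

theorem SqSum.of_sum_le {v : ι → ℂ} {C : ℝ} (h : ∀ s : Finset ι, ∑ i ∈ s, ‖v i‖ ^ 2 ≤ C) :
    SqSum v ∧ nsq v ≤ C := by
  have hs : SqSum v := summable_of_sum_le (fun _ => by positivity) h
  exact ⟨hs, hs.tsum_le_of_sum_le h⟩

/-- Testing with a = conj v gives S² ≤ C S for every finite part S of the squared norm. This is the
tool for vectors accessible only through finite linear combinations: Fejér means, adjoints, images
under bounded matrices. -/
theorem SqSum.of_dual {v : ι → ℂ} {C : ℝ} (hC : 0 ≤ C)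
    (h : ∀ (s : Finset ι) (a : ι → ℂ), ‖∑ i ∈ s, a i * v i‖ ^ 2 ≤ C * ∑ i ∈ s, ‖a i‖ ^ 2) :
    SqSum v ∧ nsq v ≤ C := by
  refine SqSum.of_sum_le fun s => ?_
  have h1 := h s (fun i => conj (v i))
  have h2 : ∑ i ∈ s, conj (v i) * v i = ((∑ i ∈ s, ‖v i‖ ^ 2 : ℝ) : ℂ) := by
    push_cast; exact Finset.sum_congr rfl fun i _ => by rw [mul_comm, Complex.mul_conj']
  have h0 : 0 ≤ ∑ i ∈ s, ‖v i‖ ^ 2 := Finset.sum_nonneg fun _ _ => by positivity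
  rw [h2, Complex.norm_real, Real.norm_of_nonneg h0] at h1
  simp only [RCLike.norm_conj] at h1
  rcases h0.eq_or_lt with h3 | h3
  · rw [← h3]; exact hC
  · nlinarith

open Classical in
/-- The restriction of a family to a finite set of indices. -/
def trunc (s : Finset ι) (v : ι → ℂ) (i : ι) : ℂ := if i ∈ s then v i else 0

theorem norm_trunc_le (s : Finset ι) (v : ι → ℂ) (i : ι) : ‖trunc s v i‖ ≤ ‖v i‖ := by
  unfold trunc; split_ifs <;> simp

theorem tsum_trunc_mul (s : Finset ι) (v w : ι → ℂ) :
    ∑' i, trunc s v i * w i = ∑ i ∈ s, v i * w i := by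
  rw [tsum_eq_sum (s := s) (fun i hi => by simp [trunc, hi])]
  exact Finset.sum_congr rfl fun i hi => by simp [trunc, hi]

theorem SqSum.trunc (s : Finset ι) (v : ι → ℂ) : SqSum (trunc s v) :=
  summable_of_ne_finset_zero (s := s) fun i hi => by simp [PCFilter.trunc, hi]

theorem nsq_trunc (s : Finset ι) (v : ι → ℂ) : nsq (trunc s v) = ∑ i ∈ s, ‖v i‖ ^ 2 := by
  unfold nsq
  rw [tsum_eq_sum (s := s) (fun i hi => by simp [trunc, hi])]
  exact Finset.sum_congr rfl fun i hi => by simp [trunc, hi]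

theorem nsq_trunc_le {v : ι → ℂ} (hv : SqSum v) (s : Finset ι) : nsq (trunc s v) ≤ nsq v :=
  nsq_mono hv fun i => norm_trunc_le s v i

theorem norm_trunc_sub_le (s : Finset ι) (v : ι → ℂ) (i : ι) :
    ‖trunc s v i - v i‖ ≤ ‖v i‖ := by
  unfold trunc; split_ifs <;> simp

theorem tendsto_nsq_trunc_sub {v : ι → ℂ} (hv : SqSum v) :
    Tendsto (fun s : Finset ι => nsq (fun i => trunc s v i - v i)) atTop (𝓝 0) := by
  have h : (0 : ℝ) = ∑' i : ι, (0 : ℝ) := by simp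
  rw [h]
  refine tendsto_tsum_of_dominated_convergence (bound := fun i => ‖v i‖ ^ 2) hv (fun i => ?_)
    (Eventually.of_forall fun s i => ?_)
  · refine tendsto_const_nhds.congr' ?_
    filter_upwards [eventually_ge_atTop {i}] with s hs
    have : i ∈ s := hs (Finset.mem_singleton_self i)
    simp [trunc, this]
  · rw [Real.norm_of_nonneg (by positivity)]
    gcongr; exact norm_trunc_sub_le s v i

/-- Bounded sequences that converge entry by entry converge weakly. -/
theorem tendsto_tsum_mul_of_bounded {β : Type*} {l : Filter β} {q : β → ι → ℂ} {q₀ y : ι → ℂ}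
    {K : ℝ} (hq : ∀ n, SqSum (q n) ∧ nsq (q n) ≤ K) (hq₀ : SqSum q₀) (hy : SqSum y)
    (hlim : ∀ i, Tendsto (fun n => q n i) l (𝓝 (q₀ i))) :
    Tendsto (fun n => ∑' i, q n i * y i) l (𝓝 (∑' i, q₀ i * y i)) := by
  rw [Metric.tendsto_nhds]
  intro ε hε
  rcases l.eq_or_neBot with rfl | hl
  · simp
  have hK : 0 ≤ K := by
    obtain ⟨n⟩ := hl.nonempty
    exact (nsq_nonneg _).trans (hq n).2
  set K' := 2 * K + 2 * nsq q₀ with hK'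
  have hK'0 : 0 ≤ K' := by have := nsq_nonneg q₀; positivity
  have h1 := tendsto_nsq_trunc_sub hy
  -- The tail of `y` is made small against the uniform bound `K'` of `q n - q₀`, and on the
  -- remaining finite set entrywise convergence suffices. The denominator `K' + 1` covers `K' = 0`.
  have h2 : ∀ᶠ s : Finset ι in atTop,
      nsq (fun i => trunc s y i - y i) < (ε / 2) ^ 2 / (K' + 1) :=
    h1.eventually (gt_mem_nhds (by positivity))
  obtain ⟨s, hs⟩ := h2.exists
  have h3 : Tendsto (fun n => ∑ i ∈ s, (q n i - q₀ i) * y i) l (𝓝 0) := by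
    have : (0 : ℂ) = ∑ i ∈ s, (q₀ i - q₀ i) * y i := by simp
    rw [this]
    exact tendsto_finsetSum _ fun i _ => ((hlim i).sub_const _).mul_const _
  filter_upwards [Metric.tendsto_nhds.1 h3 (ε / 2) (by positivity)] with n hn
  rw [dist_zero_right] at hn
  have hd := (hq n).1.sub hq₀
  have hyt := (SqSum.trunc s y).sub hy
  have e1 : ∑' i, q n i * y i - ∑' i, q₀ i * y i =
      ∑ i ∈ s, (q n i - q₀ i) * y i - ∑' i, (q n i - q₀ i) * (trunc s y i - y i) := by
    rw [← ((hq n).1.summable_mul hy).tsum_sub (hq₀.summable_mul hy)]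
    have e2 : ∑ i ∈ s, (q n i - q₀ i) * y i = ∑' i, (q n i - q₀ i) * trunc s y i := by
      have := tsum_trunc_mul s y (fun i => q n i - q₀ i)
      simp only [mul_comm (trunc s y _)] at this
      rw [this]; exact Finset.sum_congr rfl fun i _ => mul_comm _ _
    rw [e2, ← (hd.summable_mul (SqSum.trunc s y)).tsum_sub (hd.summable_mul hyt)]
    exact tsum_congr fun i => by ring
  rw [dist_eq_norm, e1]
  have h4 : ‖∑' i, (q n i - q₀ i) * (trunc s y i - y i)‖ ≤ ε / 2 := by
    refine (pow_le_pow_iff_left₀ (norm_nonneg _) (by positivity) two_ne_zero).1 ?_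
    refine (norm_tsum_mul_sq_le hd hyt).trans ?_
    have h5 : nsq (fun i => q n i - q₀ i) ≤ K' :=
      (nsq_sub_le (hq n).1 hq₀).trans (by have := (hq n).2; linarith)
    calc _ ≤ K' * ((ε / 2) ^ 2 / (K' + 1)) := by
          gcongr; exact nsq_nonneg _
      _ ≤ (K' + 1) * ((ε / 2) ^ 2 / (K' + 1)) := by gcongr; linarith
      _ = _ := by field_simp
  calc _ ≤ _ := norm_sub_le _ _
    _ < ε / 2 + ε / 2 := by linarith
    _ = ε := by ring

/-! ### Hilbert–Schmidt matrices -/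

/-- Hilbert–Schmidt matrices. -/
def IsHS (Φ : Matrix κ ι ℂ) : Prop := SqSum fun p : κ × ι => Φ p.1 p.2

/-- The squared Hilbert–Schmidt norm. -/
def hsq (Φ : Matrix κ ι ℂ) : ℝ := nsq fun p : κ × ι => Φ p.1 p.2

/-- The vector `Φ^⊤ v`. -/
def tmul (Φ : Matrix κ ι ℂ) (v : κ → ℂ) (i : ι) : ℂ := ∑' k, v k * Φ k i

theorem IsHS.col {Φ : Matrix κ ι ℂ} (h : IsHS Φ) (i : ι) : SqSum fun k => Φ k i :=
  h.comp_injective (i := fun k => (k, i)) fun _ _ h => by simpa using h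

theorem IsHS.row {Φ : Matrix κ ι ℂ} (h : IsHS Φ) (k : κ) : SqSum fun i => Φ k i :=
  h.comp_injective (i := fun i => (k, i)) fun _ _ h => by simpa using h

theorem IsHS.transpose {Φ : Matrix κ ι ℂ} (h : IsHS Φ) : IsHS Φ.transpose :=
  (Equiv.prodComm ι κ).summable_iff (f := fun p : κ × ι => ‖Φ p.1 p.2‖ ^ 2) |>.2 h

theorem IsHS.hasSum_nsq_col {Φ : Matrix κ ι ℂ} (h : IsHS Φ) :
    HasSum (fun i => nsq fun k => Φ k i) (hsq Φ) := by
  have h1 : IsHS Φ.transpose := h.transpose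
  have h2 : HasSum (fun p : ι × κ => ‖Φ p.2 p.1‖ ^ 2) (hsq Φ) :=
    (Equiv.prodComm ι κ).hasSum_iff (f := fun p : κ × ι => ‖Φ p.1 p.2‖ ^ 2) |>.2
      (Summable.hasSum h)
  exact h2.prod_fiberwise fun i => (h.col i).hasSum

theorem IsHS.tmul {Φ : Matrix κ ι ℂ} (h : IsHS Φ) {v : κ → ℂ} (hv : SqSum v) :
    SqSum (tmul Φ v) ∧ nsq (tmul Φ v) ≤ hsq Φ * nsq v := by
  have h1 : ∀ i, ‖PCFilter.tmul Φ v i‖ ^ 2 ≤ (nsq fun k => Φ k i) * nsq v := fun i => by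
    rw [mul_comm]; exact norm_tsum_mul_sq_le hv (h.col i)
  have h2 := h.hasSum_nsq_col.mul_right (nsq v)
  have h3 : SqSum (PCFilter.tmul Φ v) := h2.summable.of_nonneg_of_le (fun _ => by positivity) h1
  exact ⟨h3, (h3.tsum_le_tsum h1 h2.summable).trans_eq h2.tsum_eq⟩

theorem tmul_add {Φ : Matrix κ ι ℂ} {i : ι} (h : SqSum fun k => Φ k i) {v w : κ → ℂ}
    (hv : SqSum v) (hw : SqSum w) :
    tmul Φ (fun k => v k + w k) i = tmul Φ v i + tmul Φ w i := by
  unfold tmul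
  rw [← (hv.summable_mul h).tsum_add (hw.summable_mul h)]
  exact tsum_congr fun k => by ring

theorem tmul_sub {Φ : Matrix κ ι ℂ} {i : ι} (h : SqSum fun k => Φ k i) {v w : κ → ℂ}
    (hv : SqSum v) (hw : SqSum w) :
    tmul Φ (fun k => v k - w k) i = tmul Φ v i - tmul Φ w i := by
  unfold tmul
  rw [← (hv.summable_mul h).tsum_sub (hw.summable_mul h)]
  exact tsum_congr fun k => by ring

theorem tmul_const_mul (Φ : Matrix κ ι ℂ) (c : ℂ) (v : κ → ℂ) (i : ι) :
    tmul Φ (fun k => c * v k) i = c * tmul Φ v i := by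
  simp only [tmul, mul_assoc, tsum_mul_left]

theorem tmul_sum {β : Type*} {Φ : Matrix κ ι ℂ} {i : ι} (h : SqSum fun k => Φ k i)
    (s : Finset β) (a : β → ℂ) {v : β → κ → ℂ} (hv : ∀ j, SqSum (v j)) :
    (SqSum fun k => ∑ j ∈ s, a j * v j k) ∧
      tmul Φ (fun k => ∑ j ∈ s, a j * v j k) i = ∑ j ∈ s, a j * tmul Φ (v j) i := by
  classical
  induction s using Finset.induction_on with
  | empty => simp [SqSum.zero, tmul]
  | insert j s hj ih =>
    simp only [Finset.sum_insert hj]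
    refine ⟨((hv j).const_mul _).add ih.1, ?_⟩
    rw [tmul_add h ((hv j).const_mul _) ih.1, ih.2, tmul_const_mul]

end SquareSummable

/-! ## Forms of positive semidefinite matrices of finite trace -/

section Forms

/-- Positive semidefinite infinite matrices of finite trace. -/
structure IsTracePos (A : Mat) : Prop where
  posSemidef : A.PosSemidef
  summable : Summable fun k => (A k k).re

/-- The trace as a real number. -/
def rtr (A : Mat) : ℝ := ∑' k, (A k k).re

/-- The sesquilinear form `u^⊤ A conj(v)`. -/
def bform (A : Mat) (u v : ℕ → ℂ) : ℂ := ∑' p : ℕ × ℕ, u p.1 * A p.1 p.2 * conj (v p.2)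

variable {A B : Mat}

theorem _root_.Matrix.PosSemidef.diag_re_nonneg (h : A.PosSemidef) (k : ℕ) : 0 ≤ (A k k).re :=
  (Complex.nonneg_iff.1 h.diag_nonneg).1

theorem _root_.Matrix.PosSemidef.diag_eq_re (h : A.PosSemidef) (k : ℕ) :
    A k k = ((A k k).re : ℂ) :=
  Complex.ext rfl (by simpa using (Complex.nonneg_iff.1 h.diag_nonneg).2.symm)

theorem _root_.Matrix.PosSemidef.enorm_diag (h : A.PosSemidef) (k : ℕ) :
    ‖A k k‖ₑ = ENNReal.ofReal (A k k).re := by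
  rw [h.diag_eq_re k]
  simp [← ofReal_norm, Complex.norm_real, abs_of_nonneg (h.diag_re_nonneg k)]

theorem _root_.Matrix.PosSemidef.conj_entry (h : A.PosSemidef) (k l : ℕ) :
    conj (A k l) = A l k := by
  have := h.1.apply l k; simpa using this

theorem _root_.Matrix.PosSemidef.sum_nonneg (h : A.PosSemidef) (s : Finset ℕ) (v : ℕ → ℂ) :
    0 ≤ ∑ p ∈ s ×ˢ s, v p.1 * A p.1 p.2 * conj (v p.2) := by
  classical
  -- `Matrix.PosSemidef` conjugates the left vector, whereas the forms of this file conjugate the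
  -- right one. Hence conj v is inserted.
  have := h.2 (Finsupp.onFinset s (fun i => if i ∈ s then conj (v i) else 0) (by simp_all))
  rw [Finsupp.sum_of_support_subset (s := s) _ Finsupp.support_onFinset_subset _ (by simp)] at this
  rw [Finset.sum_product]
  refine this.trans_eq (Finset.sum_congr rfl fun i hi => ?_)
  rw [Finsupp.sum_of_support_subset (s := s) _ Finsupp.support_onFinset_subset _ (by simp)]
  exact Finset.sum_congr rfl fun j hj => by simp [hi, hj]

/-- The vector with entries 1 at k and t A_{kl} at l gives a real quadratic in t that is nonnegative
everywhere. The choice t = -1/A_{ll} yields the bound. If A_{ll} = 0 the quadratic is affine, and a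
sufficiently negative t would make it negative unless A_{kl} = 0. -/
theorem _root_.Matrix.PosSemidef.norm_sq_le (h : A.PosSemidef) (k l : ℕ) :
    ‖A k l‖ ^ 2 ≤ (A k k).re * (A l l).re := by
  classical
  rcases eq_or_ne k l with rfl | hkl
  · rw [h.diag_eq_re k]; simp [abs_of_nonneg (h.diag_re_nonneg k), sq]
  have key : ∀ t : ℝ, 0 ≤ (A k k).re + 2 * t * ‖A k l‖ ^ 2 + t ^ 2 * ‖A k l‖ ^ 2 * (A l l).re := by
    intro t
    have h1 := h.sum_nonneg {k, l} (fun i => if i = k then 1 else t * A k l)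
    have h2 := (Complex.nonneg_iff.1 h1).1
    rw [Finset.sum_product, Finset.sum_pair hkl, Finset.sum_pair hkl, Finset.sum_pair hkl] at h2
    simp only [if_true, if_neg hkl.symm, map_mul, map_one, Complex.conj_ofReal, mul_one,
      one_mul] at h2
    rw [h.conj_entry k l] at h2
    have e1 : A k l * A l k = ((‖A k l‖ ^ 2 : ℝ) : ℂ) := by
      rw [← h.conj_entry k l, Complex.mul_conj']; push_cast; ring
    have e2 : A k k + A k l * (↑t * A l k) + (↑t * A k l * A l k + ↑t * A k l * A l l * (↑t * A l k))
        = (((A k k).re + 2 * t * ‖A k l‖ ^ 2 + t ^ 2 * ‖A k l‖ ^ 2 * (A l l).re : ℝ) : ℂ) := by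
      have e3 : ↑t * A k l * A l l * (↑t * A l k) = t ^ 2 * (A k l * A l k) * A l l := by ring
      have e4 : A k l * (↑t * A l k) = t * (A k l * A l k) := by ring
      have e5 : ↑t * A k l * A l k = t * (A k l * A l k) := by ring
      rw [e3, e4, e5, e1, h.diag_eq_re k, h.diag_eq_re l]; push_cast; simp; ring
    rw [e2, Complex.ofReal_re] at h2
    exact h2
  have hk := h.diag_re_nonneg k
  have hl := h.diag_re_nonneg l
  by_cases h0 : ‖A k l‖ ^ 2 = 0
  · rw [h0]; positivity
  have hp : 0 < ‖A k l‖ ^ 2 := lt_of_le_of_ne (by positivity) (Ne.symm h0)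
  rcases hl.eq_or_lt with h3 | h3
  · have h4 := key (-(((A k k).re + 1) / ‖A k l‖ ^ 2))
    rw [← h3] at h4
    have : 2 * -(((A k k).re + 1) / ‖A k l‖ ^ 2) * ‖A k l‖ ^ 2 = -2 * ((A k k).re + 1) := by
      generalize ‖A k l‖ ^ 2 = x at h0
      field_simp
    rw [this] at h4
    nlinarith
  · have h4 := key (-(1 / (A l l).re))
    have e : (A k k).re + 2 * -(1 / (A l l).re) * ‖A k l‖ ^ 2 +
      (-(1 / (A l l).re)) ^ 2 * ‖A k l‖ ^ 2 * (A l l).re =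
      (A k k).re - ‖A k l‖ ^ 2 / (A l l).re := by field_simp; ring
    rw [e, sub_nonneg, div_le_iff₀ h3] at h4
    exact h4

theorem _root_.Matrix.PosSemidef.norm_le (h : A.PosSemidef) (k l : ℕ) :
    ‖A k l‖ ≤ √(A k k).re * √(A l l).re := by
  rw [← Real.sqrt_mul (h.diag_re_nonneg k)]
  exact Real.le_sqrt_of_sq_le (h.norm_sq_le k l)

theorem _root_.Matrix.PosSemidef.norm_le_half (h : A.PosSemidef) (k l : ℕ) :
    ‖A k l‖ ≤ (A k k).re + (A l l).re := by
  have h1 := h.norm_sq_le k l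
  nlinarith [norm_nonneg (A k l), h.diag_re_nonneg k, h.diag_re_nonneg l,
    sq_nonneg ((A k k).re - (A l l).re)]

namespace IsTracePos

theorem add (hA : IsTracePos A) (hB : IsTracePos B) : IsTracePos (A + B) :=
  ⟨hA.1.add hB.1, by simpa using hA.2.add hB.2⟩

theorem rtr_nonneg (hA : IsTracePos A) : 0 ≤ rtr A := tsum_nonneg fun k => hA.1.diag_re_nonneg k

theorem sqSum_diag (hA : IsTracePos A) : SqSum fun k => ((√(A k k).re : ℝ) : ℂ) := by
  refine hA.2.congr fun k => ?_
  rw [Complex.norm_real, Real.norm_of_nonneg (Real.sqrt_nonneg _),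
    Real.sq_sqrt (hA.1.diag_re_nonneg k)]

theorem nsq_diag (hA : IsTracePos A) : nsq (fun k => ((√(A k k).re : ℝ) : ℂ)) = rtr A := by
  refine tsum_congr fun k => ?_
  rw [Complex.norm_real, Real.norm_of_nonneg (Real.sqrt_nonneg _),
    Real.sq_sqrt (hA.1.diag_re_nonneg k)]

/-- The entry bound √A_{kk} √A_{ll} splits the double sum into a product of two single sums, each
controlled by Cauchy–Schwarz and the trace. Absolute summability makes the order of summation in
`qform` immaterial. -/
theorem summable_norm_bform (hA : IsTracePos A) {u v : ℕ → ℂ} (hu : SqSum u) (hv : SqSum v) :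
    (Summable fun p : ℕ × ℕ => ‖u p.1 * A p.1 p.2 * conj (v p.2)‖) ∧
      ∑' p : ℕ × ℕ, ‖u p.1 * A p.1 p.2 * conj (v p.2)‖ ≤ rtr A * (√(nsq u) * √(nsq v)) := by
  set a : ℕ → ℂ := fun k => ((√(A k k).re : ℝ) : ℂ) with ha
  have h1 := hu.summable_norm_mul hA.sqSum_diag
  have h2 := hv.summable_norm_mul hA.sqSum_diag
  have h3 := h1.mul_of_nonneg h2 (fun _ => norm_nonneg _) (fun _ => norm_nonneg _)
  have h4 : ∀ p : ℕ × ℕ, ‖u p.1 * A p.1 p.2 * conj (v p.2)‖ ≤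
      ‖u p.1 * a p.1‖ * ‖v p.2 * a p.2‖ := fun p => by
    have := hA.1.norm_le p.1 p.2
    simp only [norm_mul, RCLike.norm_conj, ha, Complex.norm_real,
      Real.norm_of_nonneg (Real.sqrt_nonneg _)]
    calc _ ≤ ‖u p.1‖ * (√(A p.1 p.1).re * √(A p.2 p.2).re) * ‖v p.2‖ := by gcongr
      _ = _ := by ring
  have h5 := h3.of_nonneg_of_le (fun _ => norm_nonneg _) h4
  refine ⟨h5, (h5.tsum_le_tsum h4 h3).trans ?_⟩
  rw [← h1.tsum_mul_tsum h2 h3]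
  have e1 := tsum_norm_mul_le hu hA.sqSum_diag
  have e2 := tsum_norm_mul_le hv hA.sqSum_diag
  rw [hA.nsq_diag] at e1 e2
  calc _ ≤ (√(nsq u) * √(rtr A)) * (√(nsq v) * √(rtr A)) := by gcongr
    _ = (√(rtr A) * √(rtr A)) * (√(nsq u) * √(nsq v)) := by ring
    _ = _ := by rw [Real.mul_self_sqrt hA.rtr_nonneg]

theorem summable_bform (hA : IsTracePos A) {u v : ℕ → ℂ} (hu : SqSum u) (hv : SqSum v) :
    Summable fun p : ℕ × ℕ => u p.1 * A p.1 p.2 * conj (v p.2) :=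
  (hA.summable_norm_bform hu hv).1.of_norm

theorem norm_bform_le (hA : IsTracePos A) {u v : ℕ → ℂ} (hu : SqSum u) (hv : SqSum v) :
    ‖bform A u v‖ ≤ rtr A * (√(nsq u) * √(nsq v)) :=
  (norm_tsum_le_tsum_norm (hA.summable_norm_bform hu hv).1).trans (hA.summable_norm_bform hu hv).2

theorem bform_eq (hA : IsTracePos A) {u v : ℕ → ℂ} (hu : SqSum u) (hv : SqSum v) :
    bform A u v = ∑' k, ∑' l, u k * A k l * conj (v l) :=
  (hA.summable_bform hu hv).tsum_prod

theorem qform_eq (hA : IsTracePos A) {v : ℕ → ℂ} (hv : SqSum v) : qform A v = (bform A v v).re := by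
  rw [hA.bform_eq hv hv]; rfl

theorem bform_add_left (hA : IsTracePos A) {u u' v : ℕ → ℂ} (hu : SqSum u) (hu' : SqSum u')
    (hv : SqSum v) : bform A (fun k => u k + u' k) v = bform A u v + bform A u' v := by
  unfold bform
  rw [← (hA.summable_bform hu hv).tsum_add (hA.summable_bform hu' hv)]
  exact tsum_congr fun p => by ring

theorem bform_add_right (hA : IsTracePos A) {u v v' : ℕ → ℂ} (hu : SqSum u) (hv : SqSum v)
    (hv' : SqSum v') : bform A u (fun k => v k + v' k) = bform A u v + bform A u v' := by
  unfold bform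
  rw [← (hA.summable_bform hu hv).tsum_add (hA.summable_bform hu hv')]
  exact tsum_congr fun p => by simp; ring

theorem bform_const_left (A : Mat) (c : ℂ) (u v : ℕ → ℂ) :
    bform A (fun k => c * u k) v = c * bform A u v := by
  simp only [bform, mul_assoc, tsum_mul_left]

theorem bform_const_right (A : Mat) (c : ℂ) (u v : ℕ → ℂ) :
    bform A u (fun k => c * v k) = conj c * bform A u v := by
  simp only [bform, ← tsum_mul_left]; exact tsum_congr fun p => by simp; ring

theorem bform_sub_left (hA : IsTracePos A) {u u' v : ℕ → ℂ} (hu : SqSum u) (hu' : SqSum u')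
    (hv : SqSum v) : bform A (fun k => u k - u' k) v = bform A u v - bform A u' v := by
  have := hA.bform_add_left hu (hu'.const_mul (-1)) hv
  rw [bform_const_left] at this
  rw [sub_eq_add_neg, ← neg_one_mul (bform A u' v), ← this]
  congr 1; ext k; ring

theorem bform_sub_right (hA : IsTracePos A) {u v v' : ℕ → ℂ} (hu : SqSum u) (hv : SqSum v)
    (hv' : SqSum v') : bform A u (fun k => v k - v' k) = bform A u v - bform A u v' := by
  have := hA.bform_add_right hu hv (hv'.const_mul (-1))
  rw [bform_const_right] at this
  have e : bform A u v - bform A u v' = bform A u v + conj (-1 : ℂ) * bform A u v' := by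
    simp [sub_eq_add_neg]
  rw [e, ← this]
  congr 1; ext k; ring

theorem bform_add_mat (hA : IsTracePos A) (hB : IsTracePos B) {u v : ℕ → ℂ} (hu : SqSum u)
    (hv : SqSum v) : bform (A + B) u v = bform A u v + bform B u v := by
  unfold bform
  rw [← (hA.summable_bform hu hv).tsum_add (hB.summable_bform hu hv)]
  exact tsum_congr fun p => by simp; ring

theorem conj_bform (hA : IsTracePos A) (u v : ℕ → ℂ) : conj (bform A u v) = bform A v u := by
  unfold bform
  rw [Complex.conj_tsum, ← (Equiv.prodComm ℕ ℕ).tsum_eq]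
  refine tsum_congr fun p => ?_
  simp [hA.1.conj_entry]; ring

theorem bform_self_nonneg (hA : IsTracePos A) {v : ℕ → ℂ} (hv : SqSum v) :
    0 ≤ (bform A v v).re := by
  have h := (hA.summable_bform hv hv).hasSum
  have h2 : Tendsto (fun s : Finset ℕ => s ×ˢ s) atTop (atTop : Filter (Finset (ℕ × ℕ))) := by
    refine tendsto_atTop_finset_of_monotone (fun s t h => Finset.product_subset_product h h) ?_
    intro p
    exact ⟨{p.1, p.2}, by simp⟩
  have h3 := (Complex.continuous_re.tendsto _).comp (h.comp h2)
  exact ge_of_tendsto h3 (Eventually.of_forall fun s =>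
    (Complex.nonneg_iff.1 (hA.1.sum_nonneg s v)).1)

theorem qform_nonneg (hA : IsTracePos A) {v : ℕ → ℂ} (hv : SqSum v) : 0 ≤ qform A v := by
  rw [hA.qform_eq hv]; exact hA.bform_self_nonneg hv

theorem qform_const_mul (hA : IsTracePos A) {v : ℕ → ℂ} (hv : SqSum v) (c : ℂ) :
    qform A (fun k => c * v k) = ‖c‖ ^ 2 * qform A v := by
  rw [hA.qform_eq (hv.const_mul c), hA.qform_eq hv, bform_const_left, bform_const_right,
    ← mul_assoc, Complex.mul_conj', ← Complex.ofReal_pow, Complex.re_ofReal_mul]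

theorem qform_add (hA : IsTracePos A) {u v : ℕ → ℂ} (hu : SqSum u) (hv : SqSum v) :
    qform A (fun k => u k + v k) = qform A u + qform A v + 2 * (bform A u v).re := by
  rw [hA.qform_eq (hu.add hv), hA.qform_eq hu, hA.qform_eq hv,
    hA.bform_add_left hu hv (hu.add hv), hA.bform_add_right hu hu hv, hA.bform_add_right hv hu hv,
    ← hA.conj_bform u v]
  simp; ring

theorem qform_sub (hA : IsTracePos A) {u v : ℕ → ℂ} (hu : SqSum u) (hv : SqSum v) :
    qform A (fun k => u k - v k) = qform A u + qform A v - 2 * (bform A u v).re := by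
  have := hA.qform_add hu (hv.const_mul (-1))
  rw [bform_const_right, hA.qform_const_mul hv] at this
  simp only [neg_one_mul, ← sub_eq_add_neg] at this
  rw [this]; simp; ring

theorem qform_add_mat (hA : IsTracePos A) (hB : IsTracePos B) {v : ℕ → ℂ} (hv : SqSum v) :
    qform (A + B) v = qform A v + qform B v := by
  rw [(hA.add hB).qform_eq hv, hA.qform_eq hv, hB.qform_eq hv, hA.bform_add_mat hB hv hv]; simp

/-- Nonnegativity of the form at δu - v, divided by δ, bounds the cross term. A leading factor
arbitrarily close to 1 lets errors of approximating estimates be compared without integrating the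
cross term. -/
theorem qform_add_le (hA : IsTracePos A) {u v : ℕ → ℂ} (hu : SqSum u) (hv : SqSum v) {δ : ℝ}
    (hδ : 0 < δ) :
    qform A (fun k => u k + v k) ≤ (1 + δ) * qform A u + (1 + 1 / δ) * qform A v := by
  rw [hA.qform_add hu hv]
  have h := hA.qform_nonneg ((hu.const_mul (δ : ℂ)).sub hv)
  rw [hA.qform_sub (hu.const_mul (δ : ℂ)) hv, hA.qform_const_mul hu, bform_const_left,
    Complex.re_ofReal_mul, Complex.norm_real, Real.norm_of_nonneg hδ.le] at h
  have h2 : 0 ≤ (δ ^ 2 * qform A u + qform A v - 2 * (δ * (bform A u v).re)) / δ := by positivity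
  have h3 : (δ ^ 2 * qform A u + qform A v - 2 * (δ * (bform A u v).re)) / δ =
    δ * qform A u + 1 / δ * qform A v - 2 * (bform A u v).re := by field_simp
  rw [h3] at h2
  linarith

theorem tendsto_bform (hA : IsTracePos A) {β : Type*} {l : Filter β} {u v : β → ℕ → ℂ}
    {u₀ v₀ : ℕ → ℂ} (hu : ∀ n, SqSum (u n)) (hv : ∀ n, SqSum (v n)) (hu₀ : SqSum u₀)
    (hv₀ : SqSum v₀)
    (hul : Tendsto (fun n => nsq fun k => u n k - u₀ k) l (𝓝 0))
    (hvl : Tendsto (fun n => nsq fun k => v n k - v₀ k) l (𝓝 0)) :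
    Tendsto (fun n => bform A (u n) (v n)) l (𝓝 (bform A u₀ v₀)) := by
  have e : ∀ n, bform A (u n) (v n) = bform A u₀ v₀ + (bform A (fun k => u n k - u₀ k) v₀ +
      (bform A u₀ (fun k => v n k - v₀ k) +
        bform A (fun k => u n k - u₀ k) (fun k => v n k - v₀ k))) := fun n => by
    rw [hA.bform_sub_left (hu n) hu₀ hv₀, hA.bform_sub_right hu₀ (hv n) hv₀,
      hA.bform_sub_left (hu n) hu₀ ((hv n).sub hv₀), hA.bform_sub_right (hu n) (hv n) hv₀,
      hA.bform_sub_right hu₀ (hv n) hv₀]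
    ring
  simp only [e]
  have hsu : Tendsto (fun n => √(nsq fun k => u n k - u₀ k)) l (𝓝 0) := by
    have := hul.sqrt; rwa [Real.sqrt_zero] at this
  have hsv : Tendsto (fun n => √(nsq fun k => v n k - v₀ k)) l (𝓝 0) := by
    have := hvl.sqrt; rwa [Real.sqrt_zero] at this
  have t1 : Tendsto (fun n => bform A (fun k => u n k - u₀ k) v₀) l (𝓝 0) := by
    refine squeeze_zero_norm (fun n => hA.norm_bform_le ((hu n).sub hu₀) hv₀) ?_
    simpa using (hsu.mul_const (√(nsq v₀))).const_mul (rtr A)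
  have t2 : Tendsto (fun n => bform A u₀ (fun k => v n k - v₀ k)) l (𝓝 0) := by
    refine squeeze_zero_norm (fun n => hA.norm_bform_le hu₀ ((hv n).sub hv₀)) ?_
    simpa using (hsv.const_mul (√(nsq u₀))).const_mul (rtr A)
  have t3 : Tendsto (fun n => bform A (fun k => u n k - u₀ k) (fun k => v n k - v₀ k)) l
      (𝓝 0) := by
    refine squeeze_zero_norm (fun n => hA.norm_bform_le ((hu n).sub hu₀) ((hv n).sub hv₀)) ?_
    simpa using (hsu.mul hsv).const_mul (rtr A)
  simpa using (t1.add (t2.add t3)).const_add (bform A u₀ v₀)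

end IsTracePos

end Forms

/-! ## Fourier coefficients and square integrable families -/

section Fourier

instance : IsFiniteMeasure freqMeasure := by unfold freqMeasure; infer_instance

theorem freqMeasure_univ : freqMeasure Set.univ = ENNReal.ofReal (2 * Real.pi) := by
  rw [freqMeasure, Measure.restrict_apply_univ, Real.volume_Ioc]; congr 1; ring

theorem norm_exp_I_int (n : ℤ) (x : ℝ) : ‖Complex.exp (Complex.I * n * x)‖ = 1 := by
  have : Complex.I * n * x = ((n * x : ℝ) : ℂ) * Complex.I := by push_cast; ring
  rw [this, Complex.norm_exp_ofReal_mul_I]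

theorem norm_exp_neg_I_nat (n : ℕ) (x : ℝ) : ‖Complex.exp (-(Complex.I * x * n))‖ = 1 := by
  have : -(Complex.I * x * n) = ((-(n * x) : ℝ) : ℂ) * Complex.I := by push_cast; ring
  rw [this, Complex.norm_exp_ofReal_mul_I]

theorem integrable_mul_exp {F : ℝ → ℂ} (hF : Integrable F freqMeasure) (n : ℤ) :
    Integrable (fun lam : ℝ => F lam * Complex.exp (Complex.I * n * lam)) freqMeasure := by
  refine hF.norm.mono' (hF.1.mul (by fun_prop)) (Eventually.of_forall fun x => ?_)
  rw [norm_mul, norm_exp_I_int, mul_one]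

theorem coef_congr {F G : ℝ → ℂ} (h : ∀ᵐ lam ∂freqMeasure, F lam = G lam) (n : ℤ) :
    coef F n = coef G n := by
  unfold coef; congr 1
  exact integral_congr_ae (h.mono fun x hx => by simp only [hx])

theorem coef_sub {F G : ℝ → ℂ} (hF : Integrable F freqMeasure) (hG : Integrable G freqMeasure)
    (n : ℤ) : coef (fun lam => F lam - G lam) n = coef F n - coef G n := by
  simp only [coef, sub_mul]
  rw [integral_sub (integrable_mul_exp hF n) (integrable_mul_exp hG n), mul_sub]

theorem coef_const_mul (c : ℂ) (F : ℝ → ℂ) (n : ℤ) :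
    coef (fun lam => c * F lam) n = c * coef F n := by
  simp only [coef, mul_assoc, integral_const_mul]; ring

theorem coef_finset_sum {ι : Type*} (s : Finset ι) {F : ι → ℝ → ℂ}
    (hF : ∀ i ∈ s, Integrable (F i) freqMeasure) (n : ℤ) :
    coef (fun lam => ∑ i ∈ s, F i lam) n = ∑ i ∈ s, coef (F i) n := by
  simp only [coef, Finset.sum_mul]
  rw [integral_finsetSum _ fun i hi => integrable_mul_exp (hF i hi) n, Finset.mul_sum]

theorem coef_mul_exp (F : ℝ → ℂ) (j n : ℤ) :
    coef (fun lam => F lam * Complex.exp (Complex.I * j * lam)) n = coef F (n + j) := by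
  unfold coef; congr 2; ext x
  rw [mul_assoc, ← Complex.exp_add]; congr 2; push_cast; ring

theorem coef_mul_exp_neg (F : ℝ → ℂ) (j : ℕ) (n : ℤ) :
    coef (fun lam => F lam * Complex.exp (-(Complex.I * lam * j))) n = coef F (n - j) := by
  rw [sub_eq_add_neg, ← coef_mul_exp]; unfold coef; congr 2; ext x; congr 3; push_cast; ring_nf

theorem norm_coef_le {F : ℝ → ℂ} (n : ℤ) :
    ‖coef F n‖ ≤ 1 / (2 * Real.pi) * ∫ lam, ‖F lam‖ ∂freqMeasure := by
  unfold coef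
  rw [norm_mul]
  have h1 : ‖(1 / (2 * Real.pi) : ℂ)‖ = 1 / (2 * Real.pi) := by
    rw [← Complex.ofReal_ofNat, ← Complex.ofReal_mul, ← Complex.ofReal_one, ← Complex.ofReal_div,
      Complex.norm_real, Real.norm_of_nonneg (by positivity)]
  rw [h1]
  gcongr
  refine (norm_integral_le_integral_norm _).trans_eq ?_
  simp only [norm_mul, norm_exp_I_int, mul_one]

/-- Parseval's identity. -/
theorem hasSum_coef_mul_conj {F G : ℝ → ℂ} (hF : MemLp F 2 freqMeasure)
    (hG : MemLp G 2 freqMeasure) :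
    HasSum (fun n : ℤ => coef F n * conj (coef G n)) (coef (fun lam => F lam * conj (G lam)) 0) := by
  have : Fact (0 < 2 * Real.pi) := ⟨Real.two_pi_pos⟩
  have hI : Set.Ioc (-Real.pi) Real.pi = Set.Ioc (-Real.pi) (-Real.pi + 2 * Real.pi) := by
    congr 1; ring
  unfold freqMeasure at hF hG
  rw [hI] at hF hG
  have lF := hF.memLp_liftIoc.haarAddCircle
  have lG := hG.memLp_liftIoc.haarAddCircle
  -- `coef` reads the coefficient of e^{-inλ}, so the index changes sign relative to the usual
  -- Fourier coefficient.
  have hc : ∀ H : ℝ → ℂ, ∀ n : ℤ,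
      coef H n = fourierCoeff (AddCircle.liftIoc (2 * Real.pi) (-Real.pi) H) (-n) := fun H n => by
    rw [fourierCoeff_liftIoc_eq, fourierCoeffOn_eq_integral]
    unfold coef freqMeasure
    rw [intervalIntegral.integral_of_le (by linarith [Real.pi_pos]), hI]
    simp only [add_sub_cancel_left, fourier_coe_apply, neg_neg, smul_eq_mul, Complex.real_smul]
    congr 1
    · push_cast; rfl
    · refine integral_congr_ae (Eventually.of_forall fun x => ?_)
      dsimp only
      rw [mul_comm]; congr 2
      have := Real.pi_ne_zero
      push_cast; field_simp
  have h := (fourierBasis (T := 2 * Real.pi)).hasSum_inner_mul_inner lG.toLp lF.toLp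
  have h2 := (Equiv.neg ℤ).hasSum_iff.2 h
  have e1 : (fun n : ℤ => coef F n * conj (coef G n)) = (fun i =>
      inner ℂ lG.toLp (fourierBasis i) * inner ℂ (fourierBasis i) lF.toLp) ∘ Equiv.neg ℤ := by
    ext n
    simp only [Function.comp, Equiv.neg_apply]
    rw [← inner_conj_symm lG.toLp _, ← HilbertBasis.repr_apply_apply,
      ← HilbertBasis.repr_apply_apply, fourierBasis_repr, fourierBasis_repr,
      fourierCoeff_congr_ae lG.coeFn_toLp, fourierCoeff_congr_ae lF.coeFn_toLp, hc, hc, mul_comm]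
  have e2 : coef (fun lam => F lam * conj (G lam)) 0 = inner ℂ lG.toLp lF.toLp := by
    rw [hc, L2.inner_def]
    simp only [fourierCoeff, neg_zero, fourier_zero, one_smul]
    refine integral_congr_ae ?_
    filter_upwards [lF.coeFn_toLp, lG.coeFn_toLp] with x h1 h2
    rw [h1, h2]
    simp [AddCircle.liftIoc]
  rw [e1, e2]
  exact h2

theorem MemLp.integrable_mul_conj {F G : ℝ → ℂ} (hF : MemLp F 2 freqMeasure)
    (hG : MemLp G 2 freqMeasure) : Integrable (fun lam => F lam * conj (G lam)) freqMeasure :=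
  hF.integrable_mul hG.star

theorem memLp_mul_exp {F : ℝ → ℂ} (hF : MemLp F 2 freqMeasure) (n : ℤ) :
    MemLp (fun lam : ℝ => F lam * Complex.exp (Complex.I * n * lam)) 2 freqMeasure :=
  hF.of_le (hF.1.mul (by fun_prop)) (Eventually.of_forall fun x => by
    rw [norm_mul, norm_exp_I_int, mul_one])

theorem hasSum_coef_shift {F G : ℝ → ℂ} (hF : MemLp F 2 freqMeasure)
    (hG : MemLp G 2 freqMeasure) (m : ℤ) :
    HasSum (fun n : ℤ => coef F (n + m) * conj (coef G n))
      (coef (fun lam => F lam * conj (G lam)) m) := by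
  have h := hasSum_coef_mul_conj (memLp_mul_exp hF m) hG
  simp only [coef_mul_exp] at h
  convert h using 1
  rw [← zero_add m, ← coef_mul_exp, zero_add]
  congr 1; ext x; ring

theorem hasSum_norm_coef_sq {F : ℝ → ℂ} (hF : MemLp F 2 freqMeasure) :
    HasSum (fun n : ℤ => ‖coef F n‖ ^ 2) (1 / (2 * Real.pi) * ∫ lam, ‖F lam‖ ^ 2 ∂freqMeasure) := by
  have h := Complex.hasSum_re (hasSum_coef_mul_conj hF hF)
  convert h using 1
  · ext n; rw [Complex.mul_conj', ← Complex.ofReal_pow, Complex.ofReal_re]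
  · simp only [coef, Complex.mul_conj', ← Complex.ofReal_pow]
    simp only [Int.cast_zero, mul_zero, zero_mul, Complex.exp_zero, mul_one]
    rw [integral_complex_ofReal]
    have : (1 / (2 * Real.pi) : ℂ) = ((1 / (2 * Real.pi) : ℝ) : ℂ) := by push_cast; rfl
    rw [this, ← Complex.ofReal_mul, Complex.ofReal_re]

/-! ### Square integrable ℓ²-valued functions and their Fourier coefficients. -/

/-- Square integrable functions with values in `ℓ²`, as families of scalar functions. -/
structure L2Fam {κ : Type*} (F : κ → ℝ → ℂ) : Prop where
  aesm : ∀ k, AEStronglyMeasurable (F k) freqMeasure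
  finite : ∑' k, ∫⁻ lam, ‖F k lam‖ₑ ^ 2 ∂freqMeasure < ∞

namespace L2Fam

variable {κ : Type*} {F G : κ → ℝ → ℂ}

theorem memLp (h : L2Fam F) (k : κ) : MemLp (F k) 2 freqMeasure := by
  refine ⟨h.aesm k, ?_⟩
  rw [eLpNorm_lt_top_iff_lintegral_rpow_enorm_lt_top (by norm_num) (by norm_num)]
  have := (ENNReal.le_tsum k).trans_lt h.finite
  simpa using this

theorem lintegral_eq (h : L2Fam F) (k : κ) :
    ∫⁻ lam, ‖F k lam‖ₑ ^ 2 ∂freqMeasure = ENNReal.ofReal (∫ lam, ‖F k lam‖ ^ 2 ∂freqMeasure) := by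
  rw [ofReal_integral_eq_lintegral_ofReal (h.memLp k).norm.integrable_sq
    (Eventually.of_forall fun _ => by positivity)]
  refine lintegral_congr fun x => ?_
  rw [ENNReal.ofReal_pow (norm_nonneg _), ofReal_norm]

theorem summable_integral (h : L2Fam F) : Summable fun k => ∫ lam, ‖F k lam‖ ^ 2 ∂freqMeasure := by
  have h1 := h.finite
  simp only [h.lintegral_eq] at h1
  have h2 := ENNReal.summable_toReal h1.ne
  refine h2.congr fun k => ?_
  rw [ENNReal.toReal_ofReal (integral_nonneg fun _ => by positivity)]

theorem ae_sqSum [Countable κ] (h : L2Fam F) : ∀ᵐ lam ∂freqMeasure, SqSum fun k => F k lam := by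
  have h1 := h.finite
  rw [← lintegral_tsum fun k => ((h.aesm k).enorm.pow_const 2)] at h1
  have h2 := ae_lt_top' (AEMeasurable.tsum fun k => ((h.aesm k).enorm.pow_const 2)) h1.ne
  filter_upwards [h2] with x hx
  refine (ENNReal.summable_toReal hx.ne).congr fun k => ?_
  simp

theorem integrable_nsq [Countable κ] (h : L2Fam F) :
    Integrable (fun lam => nsq fun k => F k lam) freqMeasure := by
  have h1 := h.finite
  rw [← lintegral_tsum fun k => ((h.aesm k).enorm.pow_const 2)] at h1
  have h2 := integrable_toReal_of_lintegral_ne_top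
    (AEMeasurable.tsum fun k => ((h.aesm k).enorm.pow_const 2)) h1.ne
  refine h2.congr (Eventually.of_forall fun x => ?_)
  simp only [nsq]
  rw [ENNReal.tsum_toReal_eq fun k => by simp]
  simp

theorem integral_nsq [Countable κ] (h : L2Fam F) :
    ∫ lam, nsq (fun k => F k lam) ∂freqMeasure = ∑' k, ∫ lam, ‖F k lam‖ ^ 2 ∂freqMeasure := by
  unfold nsq
  rw [integral_tsum_of_summable_integral_norm]
  · exact fun k => (h.memLp k).norm.integrable_sq
  · refine h.summable_integral.congr fun k => ?_
    simp

theorem of_integrable_bound [Countable κ] (hm : ∀ k, AEStronglyMeasurable (F k) freqMeasure)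
    {b : ℝ → ℝ} (hb : Integrable b freqMeasure)
    (h : ∀ᵐ lam ∂freqMeasure, (SqSum fun k => F k lam) ∧ nsq (fun k => F k lam) ≤ b lam) :
    L2Fam F := by
  refine ⟨hm, ?_⟩
  rw [← lintegral_tsum fun k => ((hm k).enorm.pow_const 2)]
  refine lt_of_le_of_lt (lintegral_mono_ae ?_) hb.lintegral_lt_top
  filter_upwards [h] with x hx
  have e : ∀ k, ‖F k x‖ₑ ^ 2 = ENNReal.ofReal (‖F k x‖ ^ 2) := fun k => by
    rw [ENNReal.ofReal_pow (norm_nonneg _), ofReal_norm]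
  simp only [e]
  rw [← ENNReal.ofReal_tsum_of_nonneg (fun _ => by positivity) hx.1]
  exact ENNReal.ofReal_le_ofReal hx.2

theorem of_bounded [Countable κ] (hm : ∀ k, AEStronglyMeasurable (F k) freqMeasure) {C : ℝ}
    (h : ∀ᵐ lam ∂freqMeasure, (SqSum fun k => F k lam) ∧ nsq (fun k => F k lam) ≤ C) :
    L2Fam F := of_integrable_bound hm (integrable_const C) h

theorem sub [Countable κ] (hF : L2Fam F) (hG : L2Fam G) :
    L2Fam fun k lam => F k lam - G k lam := by
  refine of_integrable_bound (fun k => (hF.aesm k).sub (hG.aesm k))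
    ((hF.integrable_nsq.const_mul 2).add (hG.integrable_nsq.const_mul 2)) ?_
  filter_upwards [hF.ae_sqSum, hG.ae_sqSum] with x h1 h2
  exact ⟨h1.sub h2, nsq_sub_le h1 h2⟩

theorem sqSum_coef (h : L2Fam F) : SqSum fun p : κ × ℤ => coef (F p.1) p.2 := by
  refine (summable_prod_of_nonneg fun _ => by positivity).2
    ⟨fun k => (hasSum_norm_coef_sq (h.memLp k)).summable, ?_⟩
  simp only [fun k => (hasSum_norm_coef_sq (h.memLp k)).tsum_eq]
  exact h.summable_integral.mul_left _

theorem nsq_coef (h : L2Fam F) [Countable κ] : nsq (fun p : κ × ℤ => coef (F p.1) p.2) =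
    1 / (2 * Real.pi) * ∫ lam, nsq (fun k => F k lam) ∂freqMeasure := by
  have h1 : Summable fun p : κ × ℤ => ‖coef (F p.1) p.2‖ ^ 2 := h.sqSum_coef
  unfold nsq
  rw [h1.tsum_prod]
  simp only [fun k => (hasSum_norm_coef_sq (h.memLp k)).tsum_eq]
  rw [tsum_mul_left]; congr 1
  exact h.integral_nsq.symm

theorem integrable_tsum [Countable κ] (hF : L2Fam F) (hG : L2Fam G) :
    Integrable (fun lam => ∑' k, F k lam * conj (G k lam)) freqMeasure := by
  have hs : ∀ᵐ lam ∂freqMeasure, HasSum (fun k => F k lam * conj (G k lam))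
      (∑' k, F k lam * conj (G k lam)) := by
    filter_upwards [hF.ae_sqSum, hG.ae_sqSum] with x h1 h2
    exact (h1.summable_mul h2.conj).hasSum
  have hm : AEStronglyMeasurable (fun lam => ∑' k, F k lam * conj (G k lam)) freqMeasure :=
    aestronglyMeasurable_of_tendsto_ae atTop (f := fun s : Finset κ => fun lam =>
      ∑ k ∈ s, F k lam * conj (G k lam))
      (fun s => Finset.aestronglyMeasurable_fun_sum s fun k _ => (hF.aesm k).mul (hG.aesm k).star) hs
  refine (hF.integrable_nsq.add hG.integrable_nsq).mono' hm ?_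
  filter_upwards [hF.ae_sqSum, hG.ae_sqSum] with x h1 h2
  refine (norm_tsum_le_tsum_norm (h1.summable_norm_mul h2.conj)).trans ?_
  have h3 := tsum_norm_mul_le h1 h2.conj
  rw [nsq_conj] at h3
  refine h3.trans ?_
  have e1 := Real.sq_sqrt (nsq_nonneg fun k => F k x)
  have e2 := Real.sq_sqrt (nsq_nonneg fun k => G k x)
  simp only [Pi.add_apply]
  nlinarith [sq_nonneg (√(nsq fun k => F k x) - √(nsq fun k => G k x)),
    nsq_nonneg fun k => F k x, nsq_nonneg fun k => G k x]

/-- Scalar Parseval in each component. The coefficients are square summable over component and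
frequency jointly, so the result is a single unconditional sum that may later be rearranged freely.
-/
theorem hasSum_coef [Countable κ] (hF : L2Fam F) (hG : L2Fam G) (m : ℤ) :
    HasSum (fun p : κ × ℤ => coef (F p.1) (p.2 + m) * conj (coef (G p.1) p.2))
      (coef (fun lam => ∑' k, F k lam * conj (G k lam)) m) := by
  have h1 : SqSum fun p : κ × ℤ => coef (F p.1) (p.2 + m) :=
    ((Equiv.refl κ).prodCongr (Equiv.addRight m)).summable_iff
      (f := fun p : κ × ℤ => ‖coef (F p.1) p.2‖ ^ 2) |>.2 hF.sqSum_coef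
  have hs := h1.summable_mul hG.sqSum_coef.conj
  have key : coef (fun lam => ∑' k, F k lam * conj (G k lam)) m =
      ∑' k, coef (fun lam => F k lam * conj (G k lam)) m := by
    simp only [coef, ← tsum_mul_right]
    rw [tsum_mul_left]
    congr 1
    have hi : ∀ k, Integrable (fun lam => F k lam * conj (G k lam)) freqMeasure := fun k =>
      MemLp.integrable_mul_conj (hF.memLp k) (hG.memLp k)
    refine (integral_tsum_of_summable_integral_norm
      (fun k => integrable_mul_exp (hi k) m) ?_).symm
    refine (hF.summable_integral.add hG.summable_integral).of_nonneg_of_le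
      (fun _ => integral_nonneg fun _ => norm_nonneg _) fun k => ?_
    rw [← integral_add (hF.memLp k).norm.integrable_sq (hG.memLp k).norm.integrable_sq]
    refine integral_mono (integrable_mul_exp (hi k) m).norm
      ((hF.memLp k).norm.integrable_sq.add (hG.memLp k).norm.integrable_sq) fun x => ?_
    simp only [norm_mul, norm_exp_I_int, mul_one, RCLike.norm_conj]
    nlinarith [sq_nonneg (‖F k x‖ - ‖G k x‖), sq_nonneg ‖F k x‖, sq_nonneg ‖G k x‖]
  rw [key]
  have e : ∀ k, coef (fun lam => F k lam * conj (G k lam)) m =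
      ∑' n : ℤ, coef (F k) (n + m) * conj (coef (G k) n) := fun k =>
    (hasSum_coef_shift (hF.memLp k) (hG.memLp k) m).tsum_eq.symm
  simp only [e]
  rw [← hs.tsum_prod]
  exact hs.hasSum

/-- The pairing of a family with a causal family. -/
theorem hasSum_coef_causal [Countable κ] (hF : L2Fam F) (hG : L2Fam G)
    (hc : ∀ k, ∀ n : ℤ, n < 0 → coef (G k) n = 0) (m : ℤ) :
    HasSum (fun p : κ × ℕ => coef (F p.1) (p.2 + m) * conj (coef (G p.1) p.2))
      (coef (fun lam => ∑' k, F k lam * conj (G k lam)) m) := by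
  have h := hasSum_coef hF hG m
  have hi : Function.Injective (fun p : κ × ℕ => ((p.1, (p.2 : ℤ)) : κ × ℤ)) := fun p q h => by
    simp only [Prod.mk.injEq, Nat.cast_inj] at h; exact Prod.ext h.1 h.2
  refine (hi.hasSum_iff ?_).2 h
  intro p hp
  have : p.2 < 0 := by
    by_contra h0
    exact hp ⟨(p.1, p.2.toNat), Prod.ext rfl (Int.toNat_of_nonneg (not_lt.1 h0))⟩
  rw [hc p.1 p.2 this, map_zero, mul_zero]

theorem star [Countable κ] (hF : L2Fam F) : L2Fam fun k lam => conj (F k lam) :=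
  ⟨fun k => AEStronglyMeasurable.star (hF.aesm k), by simpa using hF.finite⟩

end L2Fam

theorem coef_conj (F : ℝ → ℂ) (n : ℤ) : coef (fun lam => conj (F lam)) n = conj (coef F (-n)) := by
  unfold coef
  rw [map_mul, ← integral_conj]
  congr 1
  · simp [Complex.conj_ofNat]
  · refine integral_congr_ae (Eventually.of_forall fun x => ?_)
    simp [← Complex.exp_conj]

/-- The sum of products of causal functions is causal. -/
theorem L2Fam.hasSum_coef_mul {κ : Type*} [Countable κ] {F G : κ → ℝ → ℂ} (hF : L2Fam F)
    (hG : L2Fam G) (m : ℤ) :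
    HasSum (fun p : κ × ℤ => coef (F p.1) (m - p.2) * coef (G p.1) p.2)
      (coef (fun lam => ∑' k, F k lam * G k lam) m) := by
  have h := hF.hasSum_coef hG.star m
  simp only [Complex.conj_conj, coef_conj] at h
  have e := ((Equiv.refl κ).prodCongr (Equiv.neg ℤ)).hasSum_iff.2 h
  convert e using 1
  ext p
  simp [sub_eq_neg_add]

/-- In the convolution the two indices add up to m < 0, so one of them is negative and every term
vanishes. -/
theorem L2Fam.coef_mul_neg {κ : Type*} [Countable κ] {F G : κ → ℝ → ℂ} (hF : L2Fam F)
    (hG : L2Fam G) (cF : ∀ k, ∀ n : ℤ, n < 0 → coef (F k) n = 0)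
    (cG : ∀ k, ∀ n : ℤ, n < 0 → coef (G k) n = 0) {m : ℤ} (hm : m < 0) :
    coef (fun lam => ∑' k, F k lam * G k lam) m = 0 := by
  rw [← (hF.hasSum_coef_mul hG m).tsum_eq]
  refine (tsum_congr fun p => ?_).trans tsum_zero
  rcases lt_or_ge p.2 0 with h | h
  · rw [cG _ _ h, mul_zero]
  · rw [cF _ _ (by omega), zero_mul]

end Fourier

/-! ## Approximation of bounded causal functions by polynomials -/

section Fejer

/-- The vector polynomial with the coefficients `x`. -/
def polyVec (x : (ℕ × ℕ) →₀ ℂ) (lam : ℝ) (k : ℕ) : ℂ :=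
  x.sum fun i c => if i.1 = k then c * Complex.exp (-(Complex.I * lam * i.2)) else 0

theorem polyChar_eq (d τ : ℕ) (x : (ℕ × ℕ) →₀ ℂ) (lam : ℝ) (k : ℕ) :
    polyChar d τ x lam k = incFactor d τ lam * polyVec x lam k := rfl

/-- The restriction of `c` to the indices below `N`. -/
def rect (N : ℕ) (c : ℕ × ℕ → ℂ) : (ℕ × ℕ) →₀ ℂ :=
  Finsupp.onFinset (Finset.range N ×ˢ Finset.range N)
    (fun p => if p ∈ Finset.range N ×ˢ Finset.range N then c p else 0) (by simp_all)

theorem rect_sum {E : Type*} [AddCommMonoid E] (N : ℕ) (c : ℕ × ℕ → ℂ) (φ : ℕ × ℕ → ℂ → E)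
    (h : ∀ p, φ p 0 = 0) :
    (rect N c).sum φ = ∑ p ∈ Finset.range N ×ˢ Finset.range N, φ p (c p) := by
  unfold rect
  rw [Finsupp.sum_of_support_subset (s := Finset.range N ×ˢ Finset.range N) _
    Finsupp.support_onFinset_subset _ fun i _ => h i]
  exact Finset.sum_congr rfl fun p hp => by rw [Finsupp.onFinset_apply, if_pos hp]

theorem polyVec_rect (N : ℕ) (c : ℕ × ℕ → ℂ) (lam : ℝ) (k : ℕ) :
    polyVec (rect N c) lam k = if k < N then
      ∑ j ∈ Finset.range N, c (k, j) * Complex.exp (-(Complex.I * lam * j)) else 0 := by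
  unfold polyVec
  rw [rect_sum _ _ _ (by simp), Finset.sum_product]
  split_ifs with h
  · rw [Finset.sum_eq_single k (fun i _ hi => by simp [hi]) (fun hk => by simp_all)]
    simp
  · refine Finset.sum_eq_zero fun i hi => Finset.sum_eq_zero fun j _ => ?_
    have : i < N := Finset.mem_range.1 hi
    rw [if_neg (by omega)]

theorem sqSum_polyVec (x : (ℕ × ℕ) →₀ ℂ) (lam : ℝ) : SqSum (polyVec x lam) := by
  classical
  refine summable_of_ne_finset_zero (s := x.support.image Prod.fst) fun k hk => ?_
  have : polyVec x lam k = 0 := Finset.sum_eq_zero fun p hp => by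
    dsimp only; rw [if_neg]; rintro rfl; exact hk (Finset.mem_image_of_mem _ hp)
  simp [this]

theorem continuous_polyVec (x : (ℕ × ℕ) →₀ ℂ) (k : ℕ) : Continuous fun lam => polyVec x lam k := by
  unfold polyVec Finsupp.sum
  refine continuous_finsetSum _ fun i _ => ?_
  dsimp only; split_ifs <;> fun_prop

theorem coef_one (n : ℤ) : coef (fun _ => 1) n = if n = 0 then 1 else 0 := by
  unfold coef freqMeasure
  rw [← intervalIntegral.integral_of_le (by linarith [Real.pi_pos])]
  have hpi : (Real.pi : ℂ) ≠ 0 := by exact_mod_cast Real.pi_ne_zero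
  split_ifs with h
  · subst h
    simp; field_simp; norm_num
  · have h1 : Complex.I * n ≠ 0 := mul_ne_zero Complex.I_ne_zero (by exact_mod_cast h)
    simp only [one_mul]
    rw [integral_exp_mul_complex h1]
    have : Complex.exp (Complex.I * n * (Real.pi : ℝ)) =
        Complex.exp (Complex.I * n * ((-Real.pi : ℝ) : ℂ)) := by
      rw [Complex.exp_eq_exp_iff_exists_int]
      exact ⟨n, by push_cast; ring⟩
    rw [this]; simp

/-- Exactly N - j pairs have difference j, and pairs with negative difference contribute nothing. -/
theorem sum_range_sub_eq {φ : ℤ → ℂ} (hφ : ∀ n : ℤ, n < 0 → φ n = 0) (N : ℕ) :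
    ∑ n ∈ Finset.range N, ∑ m ∈ Finset.range N, φ ((n : ℤ) - m) =
      ∑ j ∈ Finset.range N, ((N : ℂ) - j) * φ j := by
  induction N with
  | zero => simp
  | succ N ih =>
    have e1 : ∑ n ∈ Finset.range N, φ ((n : ℤ) - N) = 0 :=
      Finset.sum_eq_zero fun n hn => hφ _ (by have := Finset.mem_range.1 hn; omega)
    have e2 : ∑ m ∈ Finset.range (N + 1), φ ((N : ℤ) - m) = ∑ j ∈ Finset.range (N + 1), φ j := by
      rw [← Finset.sum_range_reflect]
      refine Finset.sum_congr rfl fun j hj => ?_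
      have := Finset.mem_range.1 hj
      congr 1
      omega
    have e3 : ∑ n ∈ Finset.range (N + 1), ∑ m ∈ Finset.range (N + 1), φ ((n : ℤ) - m) =
        (∑ n ∈ Finset.range N, ∑ m ∈ Finset.range N, φ ((n : ℤ) - m)) +
          ∑ n ∈ Finset.range N, φ ((n : ℤ) - N) +
          ∑ m ∈ Finset.range (N + 1), φ ((N : ℤ) - m) := by
      rw [Finset.sum_range_succ]
      simp only [Finset.sum_range_succ _ N, Finset.sum_add_distrib]
    rw [e3, ih, e1, e2, add_zero, Finset.sum_range_succ (fun j : ℕ => φ j),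
      Finset.sum_range_succ _ N, ← add_assoc, ← Finset.sum_add_distrib]
    congr 1
    · exact Finset.sum_congr rfl fun j _ => by push_cast; ring
    · push_cast; ring

/-- Fejér means of a causal function. -/
def fejer (N : ℕ) (g : ℝ → ℂ) (lam : ℝ) : ℂ :=
  ∑ j ∈ Finset.range N, (1 - (j : ℂ) / N) * coef g j * Complex.exp (-(Complex.I * lam * j))

/-- The Fejér kernel. -/
def fejerKer (N : ℕ) (lam t : ℝ) : ℝ :=
  ‖∑ n ∈ Finset.range N, Complex.exp (Complex.I * n * (t - lam))‖ ^ 2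

/-- Expanding the squared modulus in the kernel produces the coefficients of g at all differences n
- m. Causality removes the negative ones, so the convolution with the symmetric kernel is already a
polynomial in e^{-iλ}. -/
theorem fejer_eq {N : ℕ} (hN : 0 < N) {g : ℝ → ℂ} (hg : Integrable g freqMeasure)
    (hc : ∀ n : ℤ, n < 0 → coef g n = 0) (lam : ℝ) :
    fejer N g lam = (1 / N : ℂ) * coef (fun t => g t * fejerKer N lam t) 0 := by
  have hN' : (N : ℂ) ≠ 0 := by exact_mod_cast hN.ne'
  have e1 : (fun t => g t * (fejerKer N lam t : ℂ)) = fun t =>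
      ∑ n ∈ Finset.range N, ∑ m ∈ Finset.range N,
        Complex.exp (-(Complex.I * ((n : ℤ) - (m : ℤ) : ℤ) * lam)) *
          (g t * Complex.exp (Complex.I * ((n : ℤ) - (m : ℤ) : ℤ) * t)) := by
    ext t
    rw [fejerKer, Complex.ofReal_pow, ← Complex.mul_conj', map_sum, Finset.sum_mul_sum,
      Finset.mul_sum]
    refine Finset.sum_congr rfl fun n _ => ?_
    rw [Finset.mul_sum]
    refine Finset.sum_congr rfl fun m _ => ?_
    rw [← Complex.exp_conj, ← Complex.exp_add, mul_left_comm, ← Complex.exp_add]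
    congr 2
    simp; ring
  have hi : ∀ n m : ℕ, Integrable (fun t => Complex.exp (-(Complex.I * ((n : ℤ) - (m : ℤ) : ℤ) * lam)) *
          (g t * Complex.exp (Complex.I * ((n : ℤ) - (m : ℤ) : ℤ) * t))) freqMeasure := fun n m =>
    (integrable_mul_exp hg _).const_mul _
  rw [e1, coef_finset_sum _ fun n _ => integrable_finsetSum _ fun m _ => hi n m]
  simp only [coef_finset_sum _ fun m _ => hi _ m, coef_const_mul, coef_mul_exp, zero_add]
  have e2 := sum_range_sub_eq (φ := fun n => Complex.exp (-(Complex.I * n * lam)) * coef g n)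
    (fun n hn => by simp only [hc n hn, mul_zero]) N
  rw [e2, Finset.mul_sum]
  unfold fejer
  refine Finset.sum_congr rfl fun j _ => ?_
  have : -(Complex.I * lam * j) = -(Complex.I * ((j : ℤ) : ℂ) * lam) := by push_cast; ring
  rw [this]
  field_simp

theorem continuous_fejerKer (N : ℕ) (lam : ℝ) : Continuous (fejerKer N lam) := by
  unfold fejerKer; fun_prop

/-- The kernel is nonnegative with mean N, so the Fejér mean is an average of g. The mean of the
kernel is found by applying `fejer_eq` to the constant 1. -/
theorem norm_fejer_le (N : ℕ) {g : ℝ → ℂ} (hm : AEStronglyMeasurable g freqMeasure) {C : ℝ}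
    (hC : ∀ᵐ t ∂freqMeasure, ‖g t‖ ≤ C) (hc : ∀ n : ℤ, n < 0 → coef g n = 0) (lam : ℝ) :
    ‖fejer N g lam‖ ≤ C := by
  have hC0 : 0 ≤ C := by
    have : (freqMeasure) ≠ 0 := by
      intro h; have := freqMeasure_univ; rw [h] at this
      simp at this; linarith [Real.pi_pos]
    have : (ae freqMeasure).NeBot := ae_neBot.2 this
    obtain ⟨t, ht⟩ := hC.exists
    exact (norm_nonneg _).trans ht
  rcases N.eq_zero_or_pos with rfl | hN
  · simpa [fejer] using hC0
  have hK : Integrable (fun t => fejerKer N lam t) freqMeasure := by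
    refine (Integrable.of_bound (C := (N : ℝ) ^ 2)
      (continuous_fejerKer N lam).aestronglyMeasurable (Eventually.of_forall fun t => ?_))
    rw [Real.norm_of_nonneg (by unfold fejerKer; positivity)]
    unfold fejerKer
    gcongr
    refine (norm_sum_le _ _).trans ?_
    refine (Finset.sum_le_sum fun n _ => ?_).trans_eq (b := ∑ n ∈ Finset.range N, (1 : ℝ)) (by simp)
    have : Complex.I * n * (t - lam) = ((n * (t - lam) : ℝ) : ℂ) * Complex.I := by push_cast; ring
    rw [this, Complex.norm_exp_ofReal_mul_I]
  have h1 : (1 / N : ℂ) * coef (fun t => (fejerKer N lam t : ℂ)) 0 = 1 := by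
    have := fejer_eq hN (g := fun _ => 1) (integrable_const _)
      (fun n hn => by rw [coef_one, if_neg hn.ne]) lam
    simp only [one_mul] at this
    rw [← this]
    unfold fejer
    rw [Finset.sum_eq_single 0 (fun j _ hj => by simp [coef_one, hj]) (fun h => by simp_all)]
    simp [coef_one]
  have h2 : (1 / N : ℝ) * (1 / (2 * Real.pi) * ∫ t, fejerKer N lam t ∂freqMeasure) = 1 := by
    unfold coef at h1
    simp only [Int.cast_zero, mul_zero, zero_mul, Complex.exp_zero, mul_one] at h1
    rw [integral_complex_ofReal] at h1
    apply Complex.ofReal_injective; push_cast; exact h1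
  rw [fejer_eq hN (Integrable.of_bound hm C hC) hc, norm_mul]
  have h3 : ‖(1 / N : ℂ)‖ = (1 / N : ℝ) := by simp
  rw [h3]
  calc _ ≤ (1 / N : ℝ) * (1 / (2 * Real.pi) * ∫ t, ‖g t * fejerKer N lam t‖ ∂freqMeasure) := by
        gcongr; exact norm_coef_le 0
    _ ≤ (1 / N : ℝ) * (1 / (2 * Real.pi) * ∫ t, C * fejerKer N lam t ∂freqMeasure) := by
        refine mul_le_mul_of_nonneg_left (mul_le_mul_of_nonneg_left ?_ (by positivity))
          (by positivity)
        refine integral_mono_of_nonneg (Eventually.of_forall fun _ => norm_nonneg _)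
          (hK.const_mul C) (hC.mono fun t ht => ?_)
        have : 0 ≤ fejerKer N lam t := by unfold fejerKer; positivity
        simp only [norm_mul, Complex.norm_real, Real.norm_of_nonneg this]
        gcongr
    _ = C * ((1 / N : ℝ) * (1 / (2 * Real.pi) * ∫ t, fejerKer N lam t ∂freqMeasure)) := by
        rw [integral_const_mul]; ring
    _ = C := by rw [h2, mul_one]

/-- Bounded causal functions with values in `ℓ²`. -/
structure IsBddCausal (C : ℝ) (s : ℝ → ℕ → ℂ) : Prop where
  aesm : ∀ k, AEStronglyMeasurable (fun lam => s lam k) freqMeasure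
  bound : ∀ᵐ lam ∂freqMeasure, SqSum (s lam) ∧ nsq (s lam) ≤ C
  coef_neg : ∀ k, ∀ n : ℤ, n < 0 → coef (fun lam => s lam k) n = 0

namespace IsBddCausal

variable {C : ℝ} {s : ℝ → ℕ → ℂ}

theorem l2Fam (h : IsBddCausal C s) : L2Fam fun k lam => s lam k := L2Fam.of_bounded h.aesm h.bound

theorem nonneg (h : IsBddCausal C s) : 0 ≤ C := by
  have : (freqMeasure) ≠ 0 := by
    intro h; have := freqMeasure_univ; rw [h] at this
    simp at this; linarith [Real.pi_pos]
  have : (ae freqMeasure).NeBot := ae_neBot.2 this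
  obtain ⟨t, ht⟩ := h.bound.exists
  exact (nsq_nonneg _).trans ht.2

/-- Fejér means as vector polynomials. -/
def fejerPoly (s : ℝ → ℕ → ℂ) (N : ℕ) : (ℕ × ℕ) →₀ ℂ :=
  rect N fun p => (1 - (p.2 : ℂ) / N) * coef (fun lam => s lam p.1) p.2

theorem polyVec_fejerPoly (s : ℝ → ℕ → ℂ) (N : ℕ) (lam : ℝ) (k : ℕ) :
    polyVec (fejerPoly s N) lam k = if k < N then fejer N (fun lam => s lam k) lam else 0 := by
  rw [fejerPoly, polyVec_rect]; rfl

/-- Duality reduces the vector bound to the scalar one: a finite combination of components with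
coefficients a is causal and bounded by √(C Σ|a_k|²), and Fejér means commute with such
combinations. -/
theorem nsq_fejerPoly_le (h : IsBddCausal C s) (N : ℕ) (lam : ℝ) :
    nsq (polyVec (fejerPoly s N) lam) ≤ C := by
  have key : SqSum (fun k => fejer N (fun lam => s lam k) lam) ∧
      nsq (fun k => fejer N (fun lam => s lam k) lam) ≤ C := by
    refine SqSum.of_dual h.nonneg fun S a => ?_
    have hi : ∀ k, Integrable (fun lam => s lam k) freqMeasure := fun k =>
      (h.l2Fam.memLp k).integrable (by norm_num)
    have hcoef : ∀ n, coef (fun lam => ∑ k ∈ S, a k * s lam k) n =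
        ∑ k ∈ S, a k * coef (fun lam => s lam k) n := fun n => by
      rw [coef_finset_sum _ fun k _ => (hi k).const_mul _]
      simp only [coef_const_mul]
    have e : ∑ k ∈ S, a k * fejer N (fun lam => s lam k) lam =
        fejer N (fun lam => ∑ k ∈ S, a k * s lam k) lam := by
      unfold fejer
      simp only [hcoef, Finset.mul_sum, Finset.sum_mul]
      rw [Finset.sum_comm]
      exact Finset.sum_congr rfl fun j _ => Finset.sum_congr rfl fun k _ => by ring
    have hS : 0 ≤ ∑ k ∈ S, ‖a k‖ ^ 2 := Finset.sum_nonneg fun _ _ => by positivity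
    rw [e, ← Real.sq_sqrt (mul_nonneg h.nonneg hS)]
    gcongr
    refine norm_fejer_le N (Finset.aestronglyMeasurable_fun_sum _ fun k _ => (h.aesm k).const_mul _)
      ?_ (fun n hn => ?_) lam
    · filter_upwards [h.bound] with t ht
      refine Real.le_sqrt_of_sq_le ?_
      have := norm_tsum_mul_sq_le (SqSum.trunc S a) ht.1
      rw [tsum_trunc_mul, nsq_trunc] at this
      rw [mul_comm]
      exact this.trans (by gcongr; exact ht.2)
    · rw [hcoef]
      exact Finset.sum_eq_zero fun k _ => by rw [h.coef_neg k n hn, mul_zero]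
  refine (nsq_mono key.1 fun k => ?_).trans key.2
  rw [polyVec_fejerPoly]; split_ifs <;> simp

theorem l2Fam_polyVec (x : (ℕ × ℕ) →₀ ℂ) : L2Fam fun k lam => polyVec x lam k := by
  refine ⟨fun k => (continuous_polyVec x k).aestronglyMeasurable, ?_⟩
  classical
  rw [tsum_eq_sum (s := x.support.image Prod.fst) fun k hk => ?_]
  · refine ENNReal.sum_lt_top.2 fun k _ => ?_
    have : MemLp (fun lam => polyVec x lam k) 2 freqMeasure := by
      refine MemLp.of_bound (continuous_polyVec x k).aestronglyMeasurable (∑ p ∈ x.support, ‖x p‖)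
        (Eventually.of_forall fun lam => ?_)
      refine (norm_sum_le _ _).trans (Finset.sum_le_sum fun p _ => ?_)
      dsimp only; split_ifs
      · rw [norm_mul, norm_exp_neg_I_nat, mul_one]
      · simp
    have h2 := this.2
    rw [eLpNorm_lt_top_iff_lintegral_rpow_enorm_lt_top (by norm_num) (by norm_num)] at h2
    simpa using h2
  · have : ∀ lam, polyVec x lam k = 0 := fun lam => Finset.sum_eq_zero fun p hp => by
      dsimp only; rw [if_neg]; rintro rfl; exact hk (Finset.mem_image_of_mem _ hp)
    simp [this]

theorem coef_fejer (N : ℕ) (g : ℝ → ℂ) (n : ℤ) :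
    coef (fejer N g) n =
      if 0 ≤ n ∧ n < N then (1 - (n : ℂ) / N) * coef g n else 0 := by
  unfold fejer
  rw [coef_finset_sum _ fun j _ => ?_]
  · have e : ∀ j : ℕ, coef (fun lam : ℝ => (1 - (j : ℂ) / N) * coef g j *
        Complex.exp (-(Complex.I * lam * j))) n =
        if n = j then (1 - (j : ℂ) / N) * coef g j else 0 := fun j => by
      rw [coef_const_mul]
      have := coef_mul_exp_neg (fun _ => 1) j n
      simp only [one_mul] at this
      rw [this, coef_one]
      simp only [sub_eq_zero]
      split_ifs <;> simp
    simp only [e]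
    split_ifs with h
    · obtain ⟨m, rfl⟩ := Int.eq_ofNat_of_zero_le h.1
      rw [Finset.sum_eq_single m (fun j _ hj => by rw [if_neg]; exact_mod_cast hj.symm)
        (fun hm => absurd (Finset.mem_range.2 (by exact_mod_cast h.2)) hm)]
      simp
    · refine Finset.sum_eq_zero fun j hj => ?_
      rw [if_neg]
      rintro rfl
      exact h ⟨by omega, by exact_mod_cast Finset.mem_range.1 hj⟩
  · exact (Integrable.of_bound (C := ‖(1 - (j : ℂ) / N) * coef g j‖)
      (by fun_prop) (Eventually.of_forall fun lam => by
        rw [norm_mul, norm_exp_neg_I_nat, mul_one]))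

/-- By Parseval the integral is a sum over coefficients. The error multiplies the coefficient at (k,
n) by a factor of modulus at most 1 that tends to 0, so dominated convergence applies to the series.
-/
theorem tendsto_integral_fejerPoly (h : IsBddCausal C s) :
    Tendsto (fun N => ∫ lam, nsq (fun k => polyVec (fejerPoly s N) lam k - s lam k) ∂freqMeasure)
      atTop (𝓝 0) := by
  have hf : ∀ N, L2Fam fun k lam => polyVec (fejerPoly s N) lam k - s lam k := fun N =>
    (l2Fam_polyVec _).sub h.l2Fam
  have e1 : ∀ N, ∫ lam, nsq (fun k => polyVec (fejerPoly s N) lam k - s lam k) ∂freqMeasure =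
      (2 * Real.pi) * nsq (fun p : ℕ × ℤ =>
        coef (fun lam => polyVec (fejerPoly s N) lam p.1 - s lam p.1) p.2) := fun N => by
    rw [(hf N).nsq_coef]
    have := Real.pi_pos
    field_simp
  have e2 : ∀ N k n, coef (fun lam => polyVec (fejerPoly s N) lam k - s lam k) n =
      (if k < N ∧ 0 ≤ n ∧ n < N then (1 - (n : ℂ) / N) else 0) * coef (fun lam => s lam k) n -
        coef (fun lam => s lam k) n := fun N k n => by
    rw [coef_sub (((l2Fam_polyVec _).memLp k).integrable (by norm_num))
      ((h.l2Fam.memLp k).integrable (by norm_num))]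
    congr 1
    simp only [polyVec_fejerPoly]
    by_cases hk : k < N
    · simp only [hk, if_true, true_and]
      have := coef_fejer N (fun lam => s lam k) n
      rw [show (fun lam => fejer N (fun lam => s lam k) lam) = fejer N (fun lam => s lam k) from rfl,
        this]
      split_ifs <;> simp
    · simp only [hk, if_false, false_and, zero_mul]
      have := coef_const_mul 0 (fun _ => 0) n
      simpa using this
  simp only [e1]
  rw [← mul_zero (2 * Real.pi)]
  refine Tendsto.const_mul _ ?_
  have e3 : (0 : ℝ) = ∑' _ : ℕ × ℤ, (0 : ℝ) := by simp
  rw [e3]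
  unfold nsq
  refine tendsto_tsum_of_dominated_convergence
    (bound := fun p : ℕ × ℤ => ‖coef (fun lam => s lam p.1) p.2‖ ^ 2) h.l2Fam.sqSum_coef
    (fun p => ?_) (Eventually.of_forall fun N p => ?_)
  · obtain ⟨k, n⟩ := p
    simp only [e2]
    rcases lt_or_ge n 0 with hn | hn
    · simp [h.coef_neg k n hn]
    have h1 : Tendsto (fun N : ℕ => (1 - (n : ℂ) / N) * coef (fun lam => s lam k) n -
        coef (fun lam => s lam k) n) atTop (𝓝 0) := by
      have h2 : Tendsto (fun N : ℕ => (n : ℂ) / N) atTop (𝓝 0) :=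
        tendsto_const_div_atTop_nhds_zero_nat (n : ℂ)
      simpa using ((h2.const_sub 1).mul_const (coef (fun lam => s lam k) n)).sub_const
        (coef (fun lam => s lam k) n)
    have h3 := (h1.norm.pow 2)
    simp only [norm_zero, ne_eq, OfNat.ofNat_ne_zero, not_false_eq_true, zero_pow] at h3
    refine h3.congr' ?_
    filter_upwards [eventually_gt_atTop k, eventually_gt_atTop n.toNat] with N h4 h5
    rw [if_pos ⟨h4, hn, by omega⟩]
  · obtain ⟨k, n⟩ := p
    simp only [e2]
    rw [Real.norm_of_nonneg (by positivity)]
    gcongr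
    split_ifs with h1
    · have : (1 - (n : ℂ) / N) * coef (fun lam => s lam k) n - coef (fun lam => s lam k) n =
          -(((n / N : ℝ) : ℂ) * coef (fun lam => s lam k) n) := by push_cast; ring
      rw [this, norm_neg, norm_mul, Complex.norm_real]
      refine mul_le_of_le_one_left (norm_nonneg _) ?_
      have hN : (0 : ℝ) < N := by exact_mod_cast (by omega : 0 < N)
      have hn0 : (0 : ℝ) ≤ n := by exact_mod_cast h1.2.1
      rw [Real.norm_of_nonneg (by positivity), div_le_one hN]
      exact_mod_cast h1.2.2.le
    · simp

/-- A bounded causal function is the limit of uniformly bounded polynomials. -/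
theorem exists_poly (h : IsBddCausal C s) :
    ∃ x : ℕ → ((ℕ × ℕ) →₀ ℂ), (∀ n lam, nsq (polyVec (x n) lam) ≤ C) ∧
      ∀ᵐ lam ∂freqMeasure,
        Tendsto (fun n => nsq fun k => polyVec (x n) lam k - s lam k) atTop (𝓝 0) := by
  have h1 := h.tendsto_integral_fejerPoly
  have hf : ∀ N, Integrable (fun lam => nsq fun k => polyVec (fejerPoly s N) lam k - s lam k)
      freqMeasure := fun N => ((l2Fam_polyVec _).sub h.l2Fam).integrable_nsq
  have h2 : TendstoInMeasure freqMeasure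
      (fun N lam => nsq fun k => polyVec (fejerPoly s N) lam k - s lam k) atTop (fun _ => 0) := by
    refine tendstoInMeasure_of_tendsto_eLpNorm (p := 1) (by norm_num) (fun N => (hf N).1)
      aestronglyMeasurable_const ?_
    have e : ∀ N, eLpNorm ((fun lam => nsq fun k => polyVec (fejerPoly s N) lam k - s lam k) -
        fun _ => (0 : ℝ)) 1 freqMeasure = ENNReal.ofReal
          (∫ lam, nsq (fun k => polyVec (fejerPoly s N) lam k - s lam k) ∂freqMeasure) := fun N => by
      rw [eLpNorm_one_eq_lintegral_enorm, ofReal_integral_eq_lintegral_ofReal (hf N)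
        (Eventually.of_forall fun _ => nsq_nonneg _)]
      refine lintegral_congr fun x => ?_
      simp only [Pi.sub_apply, sub_zero]
      rw [← ofReal_norm, Real.norm_of_nonneg (nsq_nonneg _)]
    simp only [e]
    simpa using ENNReal.tendsto_ofReal h1
  -- Mean convergence gives almost everywhere convergence only along a subsequence, which is enough:
  -- the uniform bound holds for every Fejér mean.
  obtain ⟨ns, -, hns⟩ := h2.exists_seq_tendsto_ae
  exact ⟨fun n => fejerPoly s (ns n), fun n lam => h.nsq_fejerPoly_le _ _, hns⟩

end IsBddCausal

end Fejer

/-! ## Infinite matrices with a two-sided inverse -/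

section PointwiseMatrices

variable {ι κ : Type*}

theorem SqSum.summable_norm_mul_mul {Φ : Matrix κ ι ℂ} (hΦ : IsHS Φ) {y : κ → ℂ} {x : ι → ℂ}
    (hy : SqSum y) (hx : SqSum x) : Summable fun p : κ × ι => ‖y p.1 * x p.2 * Φ p.1 p.2‖ := by
  have h : SqSum fun p : κ × ι => y p.1 * x p.2 := by
    have := Summable.mul_of_nonneg hy hx (fun _ => by positivity) (fun _ => by positivity)
    refine this.congr fun p => ?_
    rw [norm_mul, mul_pow]
  exact h.summable_norm_mul hΦ

/-- `Σ_i x_i (Φ^⊤ y)_i = Σ_k y_k (Φ x)_k`. -/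
theorem tsum_mul_tmul {Φ : Matrix κ ι ℂ} (hΦ : IsHS Φ) {y : κ → ℂ} {x : ι → ℂ}
    (hy : SqSum y) (hx : SqSum x) :
    ∑' i, x i * tmul Φ y i = ∑' k, y k * ∑' i, Φ k i * x i := by
  have h := (SqSum.summable_norm_mul_mul hΦ hy hx).of_norm
  have h2 : Summable (Function.uncurry fun k i => y k * x i * Φ k i) := h
  have := h2.tsum_comm
  simp only [tmul, ← tsum_mul_left]
  rw [show (∑' (i : ι) (k : κ), x i * (y k * Φ k i)) = ∑' (i : ι) (k : κ), y k * x i * Φ k i from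
    tsum_congr fun i => tsum_congr fun k => by ring, this]
  exact tsum_congr fun k => tsum_congr fun i => by ring

/-- Two interchanges of summation, one for each index of A = ΦΦ*, both legitimate because Φ is
Hilbert–Schmidt. -/
theorem bform_of_factor {A : Mat} {Φ : Matrix ℕ ι ℂ} (hA : IsTracePos A) (hΦ : IsHS Φ)
    (hf : ∀ k l, HasSum (fun i => Φ k i * conj (Φ l i)) (A k l)) {u v : ℕ → ℂ}
    (hu : SqSum u) (hv : SqSum v) :
    bform A u v = ∑' i, tmul Φ u i * conj (tmul Φ v i) := by
  have hv' := hv.conj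
  have e1 : ∀ k, ∑' l, A k l * conj (v l) = ∑' i, Φ k i * conj (tmul Φ v i) := fun k => by
    have hΦ' : IsHS fun l i => conj (Φ l i) := SqSum.conj hΦ
    have h := tsum_mul_tmul hΦ' hv' (hΦ.row k)
    have e : ∀ l, ∑' i, conj (Φ l i) * Φ k i = A k l := fun l => by
      rw [← (hf k l).tsum_eq]; exact tsum_congr fun i => mul_comm _ _
    simp only [e] at h
    rw [show (∑' l, A k l * conj (v l)) = ∑' l, conj (v l) * A k l from
      tsum_congr fun l => mul_comm _ _, ← h]
    refine tsum_congr fun i => ?_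
    simp only [tmul, Complex.conj_tsum, map_mul]
  rw [hA.bform_eq hu hv]
  simp only [mul_assoc, tsum_mul_left, e1]
  have h2 := tsum_mul_tmul hΦ hu (hΦ.tmul hv).1.conj
  rw [← h2]
  exact tsum_congr fun i => mul_comm _ _

theorem qform_of_factor {A : Mat} {Φ : Matrix ℕ ι ℂ} (hA : IsTracePos A) (hΦ : IsHS Φ)
    (hf : ∀ k l, HasSum (fun i => Φ k i * conj (Φ l i)) (A k l)) {v : ℕ → ℂ} (hv : SqSum v) :
    qform A v = nsq (tmul Φ v) := by
  rw [hA.qform_eq hv, bform_of_factor hA hΦ hf hv hv, Complex.re_tsum]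
  · refine tsum_congr fun i => ?_
    rw [Complex.mul_conj', ← Complex.ofReal_pow, Complex.ofReal_re]
  · exact (hΦ.tmul hv).1.summable_mul (hΦ.tmul hv).1.conj

open Classical in
/-- The matrix `Ψ` with square summable rows and columns is inverse to the Hilbert–Schmidt
matrix `Θ`. -/
structure IsInversePair (Θ : Matrix κ ι ℂ) (Ψ : Matrix ι κ ℂ) : Prop where
  hs : IsHS Θ
  row : ∀ i, SqSum fun k => Ψ i k
  col : ∀ k, SqSum fun i => Ψ i k
  left : ∀ i n, ∑' k, Ψ i k * Θ k n = if i = n then 1 else 0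
  right : ∀ k l, ∑' m, Θ k m * Ψ m l = if k = l then 1 else 0

namespace IsInversePair

variable {Θ : Matrix κ ι ℂ} {Ψ : Matrix ι κ ℂ}

/-- This is Ψ^⊤ Θ^⊤ = 1 on ℓ². The associativity is not formal for infinite matrices and rests on
the square summable columns of Ψ. -/
theorem tsum_mul_tmul_eq (h : IsInversePair Θ Ψ) {y : κ → ℂ} (hy : SqSum y) (k : κ) :
    ∑' i, Ψ i k * tmul Θ y i = y k := by
  rw [tsum_mul_tmul h.hs hy (h.col k)]
  simp only [h.right]
  rw [tsum_eq_single k fun p hp => by simp [hp]]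
  simp

theorem eq_zero_of_tmul (h : IsInversePair Θ Ψ) {y : κ → ℂ} (hy : SqSum y)
    (h0 : ∀ i, tmul Θ y i = 0) (k : κ) : y k = 0 := by
  rw [← h.tsum_mul_tmul_eq hy k]; simp [h0]

open Classical in
theorem tmul_row (h : IsInversePair Θ Ψ) (i n : ι) :
    tmul Θ (fun k => Ψ i k) n = if i = n then 1 else 0 := h.left i n

theorem smul (h : IsInversePair Θ Ψ) {c : ℂ} (hc : c ≠ 0) : IsInversePair (c • Θ) (c⁻¹ • Ψ) where
  hs := SqSum.const_mul h.hs c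
  row i := (h.row i).const_mul _
  col k := (h.col k).const_mul _
  left i n := by
    rw [← h.left]; refine tsum_congr fun k => ?_
    simp only [Matrix.smul_apply, smul_eq_mul]; field_simp
  right k l := by
    rw [← h.right]; refine tsum_congr fun k => ?_
    simp only [Matrix.smul_apply, smul_eq_mul]; field_simp

/-- A matrix `Φ` with `ΦΦ* ≤ ΘΘ*` gives the contraction `R = ΨΦ`. -/
theorem contraction {ν : Type*} {Φ : Matrix κ ν ℂ} (h : IsInversePair Θ Ψ) (hΦ : IsHS Φ)
    (hdom : ∀ v, SqSum v → nsq (tmul Φ v) ≤ nsq (tmul Θ v)) {z : ν → ℂ} (hz : SqSum z) :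
    (∀ i, SqSum (tmul Φ fun k => Ψ i k) ∧ nsq (tmul Φ fun k => Ψ i k) ≤ 1) ∧
    (SqSum (fun i => ∑' p, z p * conj (tmul Φ (fun k => Ψ i k) p)) ∧
      nsq (fun i => ∑' p, z p * conj (tmul Φ (fun k => Ψ i k) p)) ≤ nsq z) ∧
    ∀ k, ∑' i, (∑' p, z p * conj (tmul Φ (fun k => Ψ i k) p)) * conj (Θ k i) =
      ∑' p, z p * conj (Φ k p) := by
  classical
  -- Ψ need not be bounded, so estimates are made on finite combinations of its rows. Θ^⊤ sends such
  -- a combination to its coefficient vector, and `hdom` transfers the norm bound to Φ^⊤.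
  have hΘ : ∀ (s : Finset ι) (a : ι → ℂ), tmul Θ (fun k => ∑ i ∈ s, a i * Ψ i k) = trunc s a := by
    intro s a; ext n
    rw [(tmul_sum (h.hs.col n) s a h.row).2]
    simp only [h.tmul_row, mul_ite, mul_one, mul_zero, Finset.sum_ite_eq', trunc]
    
  have hsq : ∀ (s : Finset ι) (a : ι → ℂ), SqSum fun k => ∑ i ∈ s, a i * Ψ i k := fun s a => by
    refine Finset.induction_on s (by simpa using SqSum.zero) fun i s hi ih => ?_
    simp only [Finset.sum_insert hi]
    exact ((h.row i).const_mul _).add ih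
  have hR : ∀ i, SqSum (tmul Φ fun k => Ψ i k) := fun i => (hΦ.tmul (h.row i)).1
  have hR1 : ∀ i, nsq (tmul Φ fun k => Ψ i k) ≤ 1 := fun i => by
    refine (hdom _ (h.row i)).trans ?_
    have := hΘ {i} (fun _ => 1)
    simp only [Finset.sum_singleton, one_mul] at this
    rw [this, nsq_trunc]; simp
  have hE : ∀ (s : Finset ι) (a : ι → ℂ),
      ∑ i ∈ s, conj (a i) * ∑' p, z p * conj (tmul Φ (fun k => Ψ i k) p) =
        ∑' p, z p * conj (tmul Φ (fun k => ∑ i ∈ s, a i * Ψ i k) p) := by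
    intro s a
    have : ∀ p, tmul Φ (fun k => ∑ i ∈ s, a i * Ψ i k) p =
        ∑ i ∈ s, a i * tmul Φ (fun k => Ψ i k) p := fun p => (tmul_sum (hΦ.col p) s a h.row).2
    simp only [this, map_sum, map_mul, Finset.mul_sum]
    rw [Summable.tsum_finsetSum fun i _ => ?_]
    · refine Finset.sum_congr rfl fun i _ => ?_
      rw [← tsum_mul_left]; exact tsum_congr fun p => by ring
    · refine ((hz.summable_mul (hR i).conj).mul_left (conj (a i))).congr fun p => by ring
  have hEs : SqSum (fun i => ∑' p, z p * conj (tmul Φ (fun k => Ψ i k) p)) ∧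
      nsq (fun i => ∑' p, z p * conj (tmul Φ (fun k => Ψ i k) p)) ≤ nsq z := by
    refine SqSum.of_dual (nsq_nonneg z) fun s a => ?_
    have h1 := hE s (fun i => conj (a i))
    simp only [Complex.conj_conj] at h1
    rw [h1]
    refine (norm_tsum_mul_sq_le hz (hΦ.tmul (hsq s _)).1.conj).trans ?_
    rw [nsq_conj]
    gcongr
    · exact nsq_nonneg z
    · refine (hdom _ (hsq s _)).trans ?_
      rw [hΘ, nsq_trunc]; simp
  refine ⟨fun i => ⟨hR i, hR1 i⟩, hEs, fun k => ?_⟩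
  have hs1 : HasSum (fun i => (∑' p, z p * conj (tmul Φ (fun k => Ψ i k) p)) * conj (Θ k i))
      (∑' i, (∑' p, z p * conj (tmul Φ (fun k => Ψ i k) p)) * conj (Θ k i)) :=
    (hEs.1.summable_mul (h.hs.row k).conj).hasSum
  refine tendsto_nhds_unique hs1 ?_
  have e1 : ∀ s : Finset ι,
      ∑ i ∈ s, (∑' p, z p * conj (tmul Φ (fun k => Ψ i k) p)) * conj (Θ k i) =
        ∑' p, z p * conj (tmul Φ (fun l => ∑ i ∈ s, Θ k i * Ψ i l) p) := fun s => by
    rw [← hE]; exact Finset.sum_congr rfl fun i _ => mul_comm _ _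
  simp only [e1]
  set δ : κ → ℂ := trunc {k} (fun _ => 1) with hδ
  have hδs : SqSum δ := SqSum.trunc _ _
  have hδΦ : ∀ {μ : Type _} (X : Matrix κ μ ℂ) (p : μ), tmul X δ p = X k p := fun X p => by
    rw [tmul, hδ, tsum_trunc_mul]; simp
  -- The combinations Σ_{i∈s} Θ_{ki} Ψ_i may diverge in ℓ². Their images under Θ^⊤ are truncations
  -- of row k of Θ and converge, and domination carries this over to Φ^⊤, where the limit is row k
  -- of Φ.
  have hb : Tendsto (fun s : Finset ι => nsq fun p =>
      tmul Φ (fun l => ∑ i ∈ s, Θ k i * Ψ i l) p - Φ k p) atTop (𝓝 0) := by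
    refine squeeze_zero (fun _ => nsq_nonneg _) (fun s => ?_)
      (tendsto_nsq_trunc_sub (h.hs.row k))
    have e2 : (fun p => tmul Φ (fun l => ∑ i ∈ s, Θ k i * Ψ i l) p - Φ k p) =
        tmul Φ (fun l => (∑ i ∈ s, Θ k i * Ψ i l) - δ l) := by
      ext p; rw [tmul_sub (hΦ.col p) (hsq s _) hδs, hδΦ]
    have e3 : (fun i => trunc s (fun i => Θ k i) i - Θ k i) =
        tmul Θ (fun l => (∑ i ∈ s, Θ k i * Ψ i l) - δ l) := by
      ext p; rw [tmul_sub (h.hs.col p) (hsq s _) hδs, hΘ, tmul, hδ, tsum_trunc_mul]; simp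
    rw [e2, e3]
    exact hdom _ ((hsq s _).sub hδs)
  rw [tendsto_iff_norm_sub_tendsto_zero]
  have hb2 : Tendsto (fun s : Finset ι => √(nsq z) * √(nsq fun p =>
      tmul Φ (fun l => ∑ i ∈ s, Θ k i * Ψ i l) p - Φ k p)) atTop (𝓝 0) := by
    have := hb.sqrt.const_mul (√(nsq z)); rwa [Real.sqrt_zero, mul_zero] at this
  refine squeeze_zero (fun _ => norm_nonneg _) (fun s => ?_) hb2
  have hs2 := (hΦ.tmul (hsq s (fun i => Θ k i))).1
  rw [← (hz.summable_mul hs2.conj).tsum_sub (hz.summable_mul (hΦ.row k).conj)]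
  have hs3 := (hs2.sub (hΦ.row k))
  have h4 := (norm_tsum_le_tsum_norm (hz.summable_norm_mul hs3.conj)).trans
    (tsum_norm_mul_le hz hs3.conj)
  rw [nsq_conj] at h4
  refine (le_of_eq ?_).trans h4
  congr 1
  exact tsum_congr fun p => by simp; ring

end IsInversePair

/-! ### Bounded matrices -/

/-- The bound of the bilinear form of a matrix. -/
def BoundedBy (A : Mat) (C : ℝ) : Prop :=
  0 ≤ C ∧ ∀ (s t : Finset ℕ) (x y : ℕ → ℂ), ‖∑ k ∈ s, ∑ l ∈ t, x k * A k l * y l‖ ^ 2 ≤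
    C * (∑ k ∈ s, ‖x k‖ ^ 2) * ∑ l ∈ t, ‖y l‖ ^ 2

theorem IsBoundedMat.boundedBy {A : Mat} (h : IsBoundedMat A) : ∃ C, BoundedBy A C := by
  obtain ⟨C, hC⟩ := h
  refine ⟨max C 0, le_max_right _ _, fun s t x y => ?_⟩
  have h1 := hC (Finsupp.onFinset s (fun i => if i ∈ s then x i else 0) (by simp_all))
    (Finsupp.onFinset t (fun i => if i ∈ t then y i else 0) (by simp_all))
  rw [Finsupp.sum_of_support_subset (s := s) _ Finsupp.support_onFinset_subset _ (by simp),
    Finsupp.sum_of_support_subset (s := s) _ Finsupp.support_onFinset_subset _ (by simp),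
    Finsupp.sum_of_support_subset (s := t) _ Finsupp.support_onFinset_subset _ (by simp)] at h1
  have e1 : ∑ k ∈ s, ∑ l ∈ t, x k * A k l * y l = ∑ k ∈ s, ∑ l ∈ t, x k * A k l * y l := rfl
  calc _ = _ := by
        congr 2
        refine Finset.sum_congr rfl fun k hk => ?_
        rw [Finsupp.sum_of_support_subset (s := t) _ Finsupp.support_onFinset_subset _ (by simp)]
        exact Finset.sum_congr rfl fun l hl => by
          rw [Finsupp.onFinset_apply, Finsupp.onFinset_apply, if_pos hk, if_pos hl]
    _ ≤ _ := h1
    _ ≤ max C 0 * (∑ k ∈ s, ‖(Finsupp.onFinset s (fun i => if i ∈ s then x i else 0)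
          (by simp_all)) k‖ ^ 2) * (∑ k ∈ t, ‖(Finsupp.onFinset t
          (fun i => if i ∈ t then y i else 0) (by simp_all)) k‖ ^ 2) := by
        gcongr; exact le_max_left _ _
    _ = _ := by
        congr 1
        · congr 1
          exact Finset.sum_congr rfl fun l hl => by rw [Finsupp.onFinset_apply, if_pos hl]
        · exact Finset.sum_congr rfl fun l hl => by rw [Finsupp.onFinset_apply, if_pos hl]

namespace BoundedBy

variable {A : Mat} {C : ℝ}

theorem row (h : BoundedBy A C) (k : ℕ) : SqSum fun l => A k l := by
  refine (SqSum.of_dual h.1 fun s a => ?_).1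
  have := h.2 {k} s (fun _ => 1) a
  simp only [Finset.sum_singleton, one_mul, norm_one, one_pow, mul_one] at this
  simpa only [mul_comm (a _)] using this

theorem mulVec (h : BoundedBy A C) {z : ℕ → ℂ} (hz : SqSum z) :
    SqSum fun k => ∑' l, A k l * z l := by
  refine (SqSum.of_dual (C := C * nsq z) (mul_nonneg h.1 (nsq_nonneg z)) fun s a => ?_).1
  have h1 : HasSum (fun l => ∑ k ∈ s, a k * (A k l * z l)) (∑ k ∈ s, a k * ∑' l, A k l * z l) :=
    hasSum_sum fun k _ => ((h.row k).summable_mul hz).hasSum.mul_left _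
  refine le_of_tendsto (h1.norm.pow 2) (Eventually.of_forall fun t => ?_)
  have := h.2 s t a z
  rw [Finset.sum_comm]
  simp only [← mul_assoc]
  refine this.trans ?_
  have h2 := hz.sum_le_tsum t fun _ _ => by positivity
  have h0 : 0 ≤ ∑ k ∈ s, ‖a k‖ ^ 2 := Finset.sum_nonneg fun _ _ => by positivity
  rw [mul_right_comm]
  have := h.1
  gcongr
  exact h2

/-- Testing the form of A = u u* on conj u and u over a finite set gives S⁴ ≤ C S², where S is the
partial sum of squares. -/
theorem nsq_le_of_outer (h : BoundedBy A C) {u : ℕ → ℂ} (hu : ∀ k l, u k * conj (u l) = A k l) :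
    SqSum u ∧ nsq u ^ 2 ≤ C := by
  have key : ∀ s : Finset ℕ, (∑ k ∈ s, ‖u k‖ ^ 2) ^ 2 ≤ C := fun s => by
    have h1 := h.2 s s (fun k => conj (u k)) u
    have e : ∑ k ∈ s, ∑ l ∈ s, conj (u k) * A k l * u l = (((∑ k ∈ s, ‖u k‖ ^ 2) ^ 2 : ℝ) : ℂ) := by
      rw [sq, Finset.sum_mul_sum]; push_cast
      refine Finset.sum_congr rfl fun k _ => Finset.sum_congr rfl fun l _ => ?_
      rw [← hu, ← Complex.mul_conj', ← Complex.mul_conj']; ring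
    rw [e, Complex.norm_real, Real.norm_of_nonneg (by positivity)] at h1
    simp only [RCLike.norm_conj] at h1
    set S := ∑ k ∈ s, ‖u k‖ ^ 2
    have hS : 0 ≤ S := Finset.sum_nonneg fun _ _ => by positivity
    rcases hS.eq_or_lt with h0 | h0
    · rw [← h0]; simpa using h.1
    · have h2 : 0 < S ^ 2 := by positivity
      nlinarith
  have h1 := SqSum.of_sum_le (v := u) (C := √C) fun s => Real.le_sqrt_of_sq_le (key s)
  refine ⟨h1.1, ?_⟩
  calc nsq u ^ 2 ≤ √C ^ 2 := by gcongr; exacts [nsq_nonneg _, h1.2]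
    _ = C := Real.sq_sqrt h.1

end BoundedBy

/-- The solution of `h h* = Θ^⊤ A conj(Θ)`. -/
theorem sandwich_factor {N : ℕ∞} {Θ : Matrix ℕ (Idx N) ℂ} {Ψ : Matrix (Idx N) ℕ ℂ} {A : Mat}
    {h : Idx N → ℂ} (hI : IsInversePair Θ Ψ) {C : ℝ} (hA : BoundedBy A C)
    (heq : ∀ m n, h m * conj (h n) = sandwich Θ A m n) :
    (∀ k l, (∑' i, Ψ i k * h i) * conj (∑' i, Ψ i l * h i) = A k l) ∧
    SqSum (fun k => ∑' i, Ψ i k * h i) ∧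
    ∀ n, h n = tmul Θ (fun k => ∑' i, Ψ i k * h i) n := by
  set u : ℕ → ℂ := fun k => ∑' i, Ψ i k * h i with hu
  -- The equation is multiplied by Ψ^⊤ on the left. No summability of `h` is needed: pulling a
  -- constant factor out of a `tsum` is unconditional in a field, and the other side is controlled
  -- by A and Θ.
  have e1 : ∀ k n, u k * conj (h n) = ∑' l, A k l * conj (Θ l n) := fun k n => by
    have hs := hA.mulVec (hI.hs.col n).conj
    have := hI.tsum_mul_tmul_eq hs k
    rw [← this, hu]
    simp only [← tsum_mul_right]
    refine tsum_congr fun i => ?_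
    rw [mul_assoc, heq, sandwich, tmul]
    congr 1
    exact tsum_congr fun k => mul_comm _ _
  -- Multiplying by conj Ψ on the right removes the second Θ.
  have e2 : ∀ k l, u k * conj (u l) = A k l := fun k l => by
    have := hI.tsum_mul_tmul_eq (hA.row k).conj l
    have h2 := congrArg conj this
    rw [Complex.conj_conj, Complex.conj_tsum] at h2
    rw [← h2]
    simp only [hu]
    rw [Complex.conj_tsum, ← tsum_mul_left]
    refine tsum_congr fun n => ?_
    have h3 := e1 k n
    simp only [hu] at h3
    rw [map_mul, mul_left_comm, h3, map_mul, tmul, Complex.conj_tsum]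
    simp only [map_mul, Complex.conj_conj]
  refine ⟨e2, (hA.nsq_le_of_outer e2).1, fun n => ?_⟩
  -- A nonzero entry of u cancels from `e1` and leaves h = Θ^⊤ u. If u = 0 then A = 0, and the
  -- diagonal of the original equation forces h = 0.
  by_cases h0 : ∃ k, u k ≠ 0
  · obtain ⟨k, hk⟩ := h0
    have h1 := e1 k n
    simp only [← e2, mul_assoc, tsum_mul_left] at h1
    have h2 := congrArg conj (mul_left_cancel₀ hk h1)
    rw [Complex.conj_conj, Complex.conj_tsum] at h2
    rw [h2]
    exact tsum_congr fun l => by simp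
  · push Not at h0
    have hA0 : ∀ k l, A k l = 0 := fun k l => by rw [← e2, h0 k, zero_mul]
    have h1 := heq n n
    simp only [sandwich, hA0, zero_mul, tsum_zero, mul_zero] at h1
    have h2 : h n = 0 := by
      rcases mul_eq_zero.1 h1 with h | h
      · exact h
      · simpa using h
    simp only [tmul, h0, zero_mul, tsum_zero, h2]

end PointwiseMatrices

/-! ## The weight of the increments -/

section Weight

variable {d τ : ℕ} {w : ℝ → ℂ}

theorem measurable_incFactor (d τ : ℕ) : Measurable (incFactor d τ) := by
  unfold incFactor; fun_prop

theorem norm_exp_sub_one (τ : ℕ) (x : ℝ) :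
    ‖1 - Complex.exp (Complex.I * x * τ)‖ = 2 * |Real.sin (x * τ / 2)| := by
  have : Complex.I * x * τ = Complex.I * ((x * τ : ℝ) : ℂ) := by push_cast; ring
  rw [this, norm_sub_rev, Complex.norm_exp_I_mul_ofReal_sub_one]
  simp

theorem norm_incFactor_sq (d τ : ℕ) (x : ℝ) : ‖incFactor d τ x‖ ^ 2 = incWeight d τ x := by
  have h1 : ‖1 - Complex.exp (-(Complex.I * x * τ))‖ = ‖1 - Complex.exp (Complex.I * x * τ)‖ := by
    rw [← RCLike.norm_conj]; congr 1
    simp [← Complex.exp_conj]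
  rw [incFactor, incWeight, norm_div, norm_pow, norm_pow, h1, div_pow, ← pow_mul, ← pow_mul,
    mul_comm d 2, norm_mul, Complex.norm_I, one_mul, Complex.norm_real]
  congr 1
  rw [pow_mul, pow_mul, Real.norm_eq_abs, sq_abs]

theorem incWeight_le (d τ : ℕ) (x : ℝ) : incWeight d τ x ≤ (τ : ℝ) ^ (2 * d) := by
  unfold incWeight
  rw [norm_exp_sub_one]
  -- At x = 0 the quotient has the value 0 for d > 0, by the convention for division by zero, and 1
  -- for d = 0. The bound holds in both cases.
  rcases eq_or_ne x 0 with rfl | hx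
  · rcases d.eq_zero_or_pos with rfl | hd
    · simp
    · simp [hd.ne']
  have h0 : 0 < |x| := abs_pos.2 hx
  rw [← Even.pow_abs (even_two_mul d) x, div_le_iff₀ (by positivity), ← mul_pow]
  refine pow_le_pow_left₀ (by positivity) ?_ _
  have := Real.abs_sin_le_abs (x := x * τ / 2)
  rw [abs_div, abs_mul, Nat.abs_cast, abs_two] at this
  linarith

theorem ae_incWeight_ne_zero (hτ : 0 < τ) (d : ℕ) :
    ∀ᵐ x ∂freqMeasure, incWeight d τ x ≠ 0 := by
  have hc : (Set.range fun n : ℤ => (2 * Real.pi * n / τ : ℝ)).Countable := Set.countable_range _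
  have h1 : ∀ᵐ x ∂freqMeasure, x ∉ Set.range fun n : ℤ => (2 * Real.pi * n / τ : ℝ) :=
    ae_restrict_of_ae ((hc.measure_zero volume : _) |> fun h => measure_eq_zero_iff_ae_notMem.1 h)
  filter_upwards [h1] with x hx h
  have hτ' : (τ : ℝ) ≠ 0 := by exact_mod_cast hτ.ne'
  unfold incWeight at h
  rcases div_eq_zero_iff.1 h with h | h
  · have h3 : ‖1 - Complex.exp (Complex.I * x * τ)‖ = 0 :=
      eq_zero_of_pow_eq_zero h
    rw [norm_eq_zero, sub_eq_zero, eq_comm, Complex.exp_eq_one_iff] at h3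
    obtain ⟨n, hn⟩ := h3
    refine hx ⟨n, ?_⟩
    have h4 : (x * τ : ℂ) = (2 * Real.pi * n : ℂ) := by
      have := mul_left_cancel₀ Complex.I_ne_zero
        (show Complex.I * (x * τ) = Complex.I * (2 * Real.pi * n) by rw [← mul_assoc, hn]; ring)
      exact this
    have h5 : x * τ = 2 * Real.pi * n := by exact_mod_cast h4
    simp only [← h5]; field_simp
  · have : x = 0 := eq_zero_of_pow_eq_zero h
    exact hx ⟨0, by simp [this]⟩

theorem IsWeightFactor.aesm (hw : IsWeightFactor d τ w) : AEStronglyMeasurable w freqMeasure :=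
  hw.causal.memLp.1

theorem IsWeightFactor.ae_ne_zero (hτ : 0 < τ) (hw : IsWeightFactor d τ w) :
    ∀ᵐ x ∂freqMeasure, w x ≠ 0 := by
  filter_upwards [ae_incWeight_ne_zero hτ d, hw.factor] with x h1 h2 h3
  rw [h3] at h2; simp at h2; exact h1 h2.symm

theorem L2Fam.comp_injective {ι κ : Type*} {F : κ → ℝ → ℂ} (hF : L2Fam F) {g : ι → κ}
    (hg : Function.Injective g) : L2Fam fun i => F (g i) :=
  ⟨fun i => hF.aesm (g i), (ENNReal.tsum_comp_le_tsum_of_injective hg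
    fun k => ∫⁻ lam, ‖F k lam‖ₑ ^ 2 ∂freqMeasure).trans_lt hF.finite⟩

theorem L2Fam.ae_isHS {ι κ : Type*} [Countable ι] [Countable κ] {Φ : ℝ → Matrix κ ι ℂ}
    (h : L2Fam fun p : κ × ι => fun lam => Φ lam p.1 p.2) : ∀ᵐ lam ∂freqMeasure, IsHS (Φ lam) :=
  h.ae_sqSum

theorem L2Fam.mul_bounded {κ : Type*} [Countable κ] {F : κ → ℝ → ℂ} (hF : L2Fam F) {v : ℝ → ℂ}
    (hv : AEStronglyMeasurable v freqMeasure) {C : ℝ} (hC : ∀ᵐ x ∂freqMeasure, ‖v x‖ ^ 2 ≤ C) :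
    L2Fam fun k lam => v lam * F k lam := by
  refine L2Fam.of_integrable_bound (fun k => hv.mul (hF.aesm k)) (hF.integrable_nsq.const_mul C) ?_
  filter_upwards [hF.ae_sqSum, hC] with x h1 h2
  refine ⟨h1.const_mul _, ?_⟩
  rw [nsq_const_mul]
  gcongr
  exact nsq_nonneg _

/-! ### Integrability of the factors and boundedness of the weight. -/

section Factors

variable {M : ℕ∞} {F G : ℝ → Mat} {Θ : ℝ → Matrix ℕ (Idx M) ℂ} {Ψ : ℝ → Matrix (Idx M) ℕ ℂ}

theorem IsCanonicalFactorization.l2Fam (h : IsCanonicalFactorization F Θ) :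
    L2Fam fun p : ℕ × Idx M => fun lam => Θ lam p.1 p.2 := by
  have hm : ∀ k i, AEStronglyMeasurable (fun lam => Θ lam k i) freqMeasure := fun k i =>
    (h.causal k i).memLp.1
  refine ⟨fun p => hm p.1 p.2, ?_⟩
  refine lt_of_eq_of_lt ?_ h.sq_integrable
  rw [lintegral_tsum fun k => AEMeasurable.tsum fun i => ((hm k i).enorm.pow_const 2),
    ENNReal.tsum_prod']
  refine tsum_congr fun k => ?_
  rw [lintegral_tsum fun i => ((hm k i).enorm.pow_const 2)]

theorem IsInverseFactorization.l2Fam_row (h : IsInverseFactorization w Θ Ψ G) (i : Idx M) :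
    L2Fam fun k lam => tauInv w Ψ lam i k := by
  have hm : ∀ k, AEStronglyMeasurable (fun lam => tauInv w Ψ lam i k) freqMeasure := fun k =>
    (h.causal_tau i k).memLp.1
  refine ⟨hm, ?_⟩
  rw [← lintegral_tsum fun k => ((hm k).enorm.pow_const 2)]
  exact h.rows i

/-- The k-th diagonal entry of ρ⁻¹ G is the squared norm of column k of Ψ_τ. Minimality is exactly
the integrability of this majorant. -/
theorem IsInverseFactorization.l2Fam_col (hw : IsWeightFactor d τ w)
    (h : IsInverseFactorization w Θ Ψ G) (hmin : MinimalityCondition d τ G) (k : ℕ) :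
    L2Fam fun i lam => tauInv w Ψ lam i k := by
  have hm : ∀ i, AEStronglyMeasurable (fun lam => tauInv w Ψ lam i k) freqMeasure := fun i =>
    (h.causal_tau i k).memLp.1
  refine L2Fam.of_integrable_bound hm (hmin k k).re ?_
  filter_upwards [h.factor, hw.factor] with x h1 h2
  have h3 := Complex.hasSum_re (h1 k k)
  have h4 : HasSum (fun m => ‖Ψ x m k‖ ^ 2) (G x k k).re := by
    convert h3 using 1
    ext m; rw [mul_comm, Complex.mul_conj', ← Complex.ofReal_pow, Complex.ofReal_re]
  have h5 : HasSum (fun m => ‖tauInv w Ψ x m k‖ ^ 2) ((incWeight d τ x)⁻¹ * (G x k k).re) := by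
    have := h4.mul_left (incWeight d τ x)⁻¹
    have e : (fun m => ‖tauInv w Ψ x m k‖ ^ 2) =
        fun m => (incWeight d τ x)⁻¹ * ‖Ψ x m k‖ ^ 2 := funext fun m => by
      simp only [tauInv, Matrix.smul_apply, smul_eq_mul, norm_mul, mul_pow, norm_inv, inv_pow, h2]
    rw [e]; exact this
  refine ⟨h5.summable, h5.tsum_eq.le.trans_eq ?_⟩
  simp

/-- Rows of Ψ are square summable because those of Ψ_τ are and w is finite and nonzero almost
everywhere. Columns are square summable because their squared norms are the diagonal entries of G.
-/
theorem IsInverseFactorization.ae_isInversePair (hτ : 0 < τ) (hw : IsWeightFactor d τ w)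
    (hΘ : IsCanonicalFactorization F Θ) (h : IsInverseFactorization w Θ Ψ G) :
    ∀ᵐ x ∂freqMeasure, IsInversePair (Θ x) (Ψ x) := by
  have hr : ∀ᵐ x ∂freqMeasure, ∀ i, SqSum fun k => tauInv w Ψ x i k :=
    ae_all_iff.2 fun i => (h.l2Fam_row i).ae_sqSum
  filter_upwards [hΘ.l2Fam.ae_isHS, hr, h.factor, h.left_inv, h.right_inv, hw.ae_ne_zero hτ] with
    x h1 h2 h3 h4 h5 h6
  refine ⟨h1, fun i => ?_, fun k => ?_, fun i n => ?_, fun k l => ?_⟩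
  · have := (h2 i).const_mul (w x)
    simpa only [tauInv, Matrix.smul_apply, smul_eq_mul, mul_inv_cancel_left₀ h6] using this
  · have h7 := (Complex.hasSum_re (h3 k k)).summable
    refine h7.congr fun m => ?_
    rw [mul_comm, Complex.mul_conj', ← Complex.ofReal_pow, Complex.ofReal_re]
  · rw [(h4 i n).tsum_eq]; congr 1
  · rw [(h5 k l).tsum_eq]; congr 1

theorem ae_freqMeasure_neBot : (ae freqMeasure).NeBot := by
  refine ae_neBot.2 fun h => ?_
  have h2 := freqMeasure_univ
  rw [h] at h2
  simp at h2; linarith [Real.pi_pos]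

/-- The reciprocal of the weight factor is integrable. -/
theorem IsInverseFactorization.integrable_inv_weight (hτ : 0 < τ) (hw : IsWeightFactor d τ w)
    (hΘ : IsCanonicalFactorization F Θ) (h : IsInverseFactorization w Θ Ψ G) :
    Integrable (fun x => (w x)⁻¹) freqMeasure := by
  have := ae_freqMeasure_neBot
  have hI := h.ae_isInversePair hτ hw hΘ
  have hne : Nonempty (Idx M) := by
    obtain ⟨x, hx⟩ := hI.exists
    by_contra hE
    have : IsEmpty (Idx M) := not_nonempty_iff.1 hE
    have := hx.right 0 0
    simp at this
  obtain ⟨i⟩ := hne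
  -- The diagonal entry (i, i) of Ψ_τ Θ = w⁻¹ E pairs a square integrable row with a square
  -- integrable column, so it is integrable.
  have h1 := (h.l2Fam_row i).integrable_tsum
    (hΘ.l2Fam.comp_injective (g := fun k => (k, i)) (fun _ _ h => by simpa using h)).star
  refine h1.congr ?_
  filter_upwards [hI] with x hx
  have h2 := hx.left i i
  simp only [if_true] at h2
  simp only [Complex.conj_conj, tauInv, Matrix.smul_apply, smul_eq_mul, mul_assoc, tsum_mul_left,
    h2, mul_one]

/-- If d ≥ 1 and τ ≥ 2, the weight has a zero at 2π/τ in (0, π] that the denominator does not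
cancel. There |w| vanishes at least linearly, so |w|⁻¹ dominates a multiple of |x - 2π/τ|⁻¹, which
is not integrable. -/
theorem order_zero_or_step_one (hτ : 0 < τ) (hw : IsWeightFactor d τ w)
    (hi : Integrable (fun x => (w x)⁻¹) freqMeasure) : d = 0 ∨ τ = 1 := by
  by_contra hcon
  push Not at hcon
  obtain ⟨hd, hτ1⟩ := hcon
  have hτ2 : 2 ≤ τ := by omega
  have hτr : (2 : ℝ) ≤ τ := by exact_mod_cast hτ2
  have hpi := Real.pi_pos
  set c : ℝ := 2 * Real.pi / τ with hc
  have hc0 : 0 < c := by positivity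
  have hcpi : c ≤ Real.pi := by rw [hc, div_le_iff₀ (by positivity)]; nlinarith
  -- At x = a the ratio τ(c - x)/x equals 1. To the right of a it is at most 1, so its d-th power is
  -- bounded by the ratio itself.
  set a : ℝ := τ * c / (1 + τ) with ha
  have ha0 : 0 < a := by positivity
  have hac : a < c := by rw [ha, div_lt_iff₀ (by positivity)]; nlinarith
  have hsub : Set.Ioc a c ⊆ Set.Ioc (-Real.pi) Real.pi := fun x hx =>
    ⟨by have := hx.1; linarith, hx.2.trans hcpi⟩
  have hle : volume.restrict (Set.Ioc a c) ≤ freqMeasure := Measure.restrict_mono hsub le_rfl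
  have hi2 : IntervalIntegrable (fun x => (x - c)⁻¹) volume a c := by
    rw [intervalIntegrable_iff_integrableOn_Ioc_of_le hac.le]
    have h1 : Integrable (fun x => (τ / a) * ‖(w x)⁻¹‖) (volume.restrict (Set.Ioc a c)) :=
      (hi.norm.mono_measure hle).const_mul _
    refine h1.mono' (by fun_prop) ?_
    have h2 := ae_mono hle hw.factor
    filter_upwards [h2, ae_restrict_mem measurableSet_Ioc] with x hx hxm
    rcases eq_or_lt_of_le hxm.2 with rfl | hxc
    · simp; positivity
    have hx0 : 0 < x := ha0.trans hxm.1
    have hcx : 0 < c - x := by linarith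
    have hs : ‖1 - Complex.exp (Complex.I * x * τ)‖ ≤ τ * (c - x) := by
      rw [norm_exp_sub_one]
      have e : x * τ / 2 = Real.pi - (c - x) * τ / 2 := by rw [hc]; field_simp; ring
      rw [e, Real.sin_pi_sub]
      have := Real.abs_sin_le_abs (x := (c - x) * τ / 2)
      rw [abs_of_pos (by positivity : 0 < (c - x) * τ / 2)] at this
      linarith
    have hw2 : ‖w x‖ = (‖1 - Complex.exp (Complex.I * x * τ)‖ / x) ^ d := by
      refine (pow_left_inj₀ (norm_nonneg _) (by positivity) two_ne_zero).1 ?_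
      rw [hx, incWeight, ← pow_mul, div_pow, mul_comm d 2]
    have hq : τ * (c - x) / x ≤ 1 := by
      rw [div_le_one hx0]
      have := hxm.1
      rw [ha, div_lt_iff₀ (by positivity)] at this
      linarith
    have hw3 : ‖w x‖ ≤ τ * (c - x) / a := by
      rw [hw2]
      calc _ ≤ (τ * (c - x) / x) ^ d := by gcongr
        _ ≤ τ * (c - x) / x := pow_le_of_le_one (by positivity) hq hd
        _ ≤ _ := by have := hxm.1; gcongr
    rw [norm_inv, norm_inv, Real.norm_eq_abs, abs_of_neg (by linarith)]
    by_cases hw0 : ‖w x‖ = 0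
    · exfalso
      rw [hw2] at hw0
      have h5 := eq_zero_of_pow_eq_zero hw0
      rw [div_eq_zero_iff, norm_exp_sub_one] at h5
      rcases h5 with h5 | h5
      · have h6 : 0 < Real.sin (x * τ / 2) := by
          refine Real.sin_pos_of_pos_of_lt_pi (by positivity) ?_
          have : x * τ < c * τ := by gcongr
          rw [hc] at this
          field_simp at this
          linarith
        have := abs_pos.2 h6.ne'
        linarith
      · linarith
    have hw4 : 0 < ‖w x‖ := lt_of_le_of_ne (norm_nonneg _) (Ne.symm hw0)
    rw [neg_sub, inv_le_comm₀ hcx (by positivity), mul_inv, inv_inv, inv_div]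
    calc _ ≤ a / τ * (τ * (c - x) / a) := by gcongr
      _ = _ := by field_simp
  rw [intervalIntegrable_sub_inv_iff] at hi2
  rcases hi2 with h | h
  · exact hac.ne h
  · exact h (Set.right_mem_uIcc)

/-- For τ = 1 the only zero of 1 - e^{iλ} on the interval is λ = 0, which the denominator cancels.
Jordan's inequality |sin(λ/2)| ≥ |λ|/π gives the constant. -/
theorem incWeight_lower (h : d = 0 ∨ τ = 1) :
    ∃ c > 0, ∀ᵐ x ∂freqMeasure, c ≤ incWeight d τ x := by
  rcases h with rfl | rfl
  · exact ⟨1, one_pos, Eventually.of_forall fun x => by simp [incWeight]⟩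
  · refine ⟨(2 / Real.pi) ^ (2 * d), by have := Real.pi_pos; positivity, ?_⟩
    have h0 : ∀ᵐ x ∂freqMeasure, x ≠ 0 := ae_restrict_of_ae (by simp [ae_iff])
    filter_upwards [h0, ae_restrict_mem measurableSet_Ioc] with x hx hxm
    unfold incWeight
    have hxa : 0 < |x| := abs_pos.2 hx
    rw [norm_exp_sub_one, ← Even.pow_abs (even_two_mul d) x, le_div_iff₀ (by positivity), ← mul_pow]
    have hpi := Real.pi_pos
    refine pow_le_pow_left₀ (by positivity) ?_ _
    have h1 : |x / 2| ≤ Real.pi / 2 := by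
      rw [abs_div, abs_two]; gcongr; exact abs_le.2 ⟨hxm.1.le, hxm.2⟩
    have := Real.mul_abs_le_abs_sin h1
    rw [abs_div, abs_two] at this
    simp only [Nat.cast_one, mul_one]
    linarith

/-- The weight is bounded from above and from below. -/
theorem IsInverseFactorization.weight_bounds (hτ : 0 < τ) (hw : IsWeightFactor d τ w)
    (hΘ : IsCanonicalFactorization F Θ) (h : IsInverseFactorization w Θ Ψ G) :
    ∃ K > 0, ∀ᵐ x ∂freqMeasure, ‖w x‖ ^ 2 ≤ K ∧ ‖(w x)⁻¹‖ ^ 2 ≤ K ∧ w x ≠ 0 ∧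
      ‖incFactor d τ x‖ ^ 2 ≤ K ∧ ‖incFactor d τ x‖ = ‖w x‖ := by
  obtain ⟨c, hc, hcb⟩ := incWeight_lower (order_zero_or_step_one hτ hw
    (h.integrable_inv_weight hτ hw hΘ))
  refine ⟨max ((τ : ℝ) ^ (2 * d)) c⁻¹, lt_max_of_lt_left (by positivity), ?_⟩
  filter_upwards [hcb, hw.factor, hw.ae_ne_zero hτ] with x h1 h2 h3
  have h4 := incWeight_le d τ x
  refine ⟨?_, ?_, h3, ?_, ?_⟩
  · rw [h2]; exact h4.trans (le_max_left _ _)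
  · rw [norm_inv, inv_pow, h2]
    exact (inv_anti₀ hc h1).trans (le_max_right _ _)
  · rw [norm_incFactor_sq]; exact h4.trans (le_max_left _ _)
  · refine (pow_left_inj₀ (norm_nonneg _) (norm_nonneg _) two_ne_zero).1 ?_
    rw [norm_incFactor_sq, h2]

end Factors

end Weight

/-! ## The symbol of the functional -/

section Symbol

variable {b : ℕ → ℕ → ℂ}

theorem CoeffCondition.sqSum (hb : CoeffCondition b) (j : ℕ) : SqSum (b j) :=
  memℓp_two_iff.1 (hb.mem j)

theorem l2norm_eq (v : ℕ → ℂ) : l2norm v = √(nsq v) := rfl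

theorem norm_le_l2norm {v : ℕ → ℂ} (hv : SqSum v) (k : ℕ) : ‖v k‖ ≤ l2norm v :=
  Real.le_sqrt_of_sq_le (hv.le_tsum k fun _ _ => by positivity)

theorem CoeffCondition.summable_norm (hb : CoeffCondition b) (k : ℕ) :
    Summable fun j => ‖b j k‖ :=
  hb.summable.of_nonneg_of_le (fun _ => norm_nonneg _) fun j => norm_le_l2norm (hb.sqSum j) k

theorem CoeffCondition.summable_symbolB (hb : CoeffCondition b) (lam : ℝ) (k : ℕ) :
    Summable fun j : ℕ => b j k * Complex.exp (-(Complex.I * lam * j)) := by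
  refine Summable.of_norm ((hb.summable_norm k).congr fun j => ?_)
  rw [norm_mul, norm_exp_neg_I_nat, mul_one]

/-- The bound of the symbol. -/
def symbolBound (b : ℕ → ℕ → ℂ) : ℝ := (∑' j, l2norm (b j)) ^ 2

/-- Minkowski's inequality for the sum over j, obtained by duality. The entries Σ_j |b_{jk}| form a
majorant of the symbol and of its partial sums that does not depend on the frequency. -/
theorem CoeffCondition.bound (hb : CoeffCondition b) :
    SqSum (fun k => ((∑' j, ‖b j k‖ : ℝ) : ℂ)) ∧
      nsq (fun k => ((∑' j, ‖b j k‖ : ℝ) : ℂ)) ≤ symbolBound b := by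
  refine SqSum.of_dual (sq_nonneg _) fun s a => ?_
  have h0 : 0 ≤ ∑' j, l2norm (b j) := tsum_nonneg fun j => Real.sqrt_nonneg _
  have h1 : ‖∑ k ∈ s, a k * ((∑' j, ‖b j k‖ : ℝ) : ℂ)‖ ≤
      (∑' j, l2norm (b j)) * √(∑ k ∈ s, ‖a k‖ ^ 2) := by
    calc _ ≤ ∑ k ∈ s, ‖a k‖ * ∑' j, ‖b j k‖ := by
          refine (norm_sum_le _ _).trans_eq (Finset.sum_congr rfl fun k _ => ?_)
          rw [norm_mul, Complex.norm_real, Real.norm_of_nonneg (tsum_nonneg fun _ => norm_nonneg _)]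
      _ = ∑' j, ∑ k ∈ s, ‖a k‖ * ‖b j k‖ := by
          rw [Summable.tsum_finsetSum fun k _ => (hb.summable_norm k).mul_left _]
          simp only [tsum_mul_left]
      _ ≤ ∑' j, l2norm (b j) * √(∑ k ∈ s, ‖a k‖ ^ 2) := by
          refine Summable.tsum_le_tsum (fun j => ?_)
            (summable_sum fun k _ => (hb.summable_norm k).mul_left _)
            (hb.summable.mul_right _)
          have h2 := Real.sum_mul_le_sqrt_mul_sqrt s (fun k => ‖a k‖) (fun k => ‖b j k‖)
          refine h2.trans ?_
          rw [mul_comm, l2norm_eq]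
          gcongr
          exact (hb.sqSum j).sum_le_tsum s fun _ _ => by positivity
      _ = _ := tsum_mul_right
  calc _ ≤ ((∑' j, l2norm (b j)) * √(∑ k ∈ s, ‖a k‖ ^ 2)) ^ 2 := by gcongr
    _ = _ := by
      rw [mul_pow, Real.sq_sqrt (Finset.sum_nonneg fun _ _ => by positivity), symbolBound]

theorem CoeffCondition.sqSum_symbolB (hb : CoeffCondition b) (lam : ℝ) :
    SqSum (symbolB b lam) ∧ nsq (symbolB b lam) ≤ symbolBound b := by
  have h : ∀ k, ‖symbolB b lam k‖ ≤ ‖((∑' j, ‖b j k‖ : ℝ) : ℂ)‖ := fun k => by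
    rw [Complex.norm_real, Real.norm_of_nonneg (tsum_nonneg fun _ => norm_nonneg _)]
    refine (norm_tsum_le_tsum_norm (hb.summable_symbolB lam k).norm).trans_eq ?_
    exact tsum_congr fun j => by rw [norm_mul, norm_exp_neg_I_nat, mul_one]
  exact ⟨hb.bound.1.mono h, (nsq_mono hb.bound.1 h).trans hb.bound.2⟩

theorem CoeffCondition.continuous_symbolB (hb : CoeffCondition b) (k : ℕ) :
    Continuous fun lam => symbolB b lam k := by
  refine continuous_tsum (fun j => by fun_prop) (hb.summable_norm k) fun j lam => ?_
  rw [norm_mul, norm_exp_neg_I_nat, mul_one]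

theorem CoeffCondition.coef_symbolB (hb : CoeffCondition b) (k : ℕ) (n : ℤ) :
    coef (fun lam => symbolB b lam k) n = if 0 ≤ n then b n.toNat k else 0 := by
  have h1 : HasSum (fun j : ℕ => coef (fun lam : ℝ => b j k * Complex.exp (-(Complex.I * lam * j))) n)
      (coef (fun lam => symbolB b lam k) n) := by
    unfold coef symbolB
    refine HasSum.mul_left _ ?_
    simp only [← tsum_mul_right]
    have hi : ∀ j : ℕ, Integrable (fun lam : ℝ => b j k * Complex.exp (-(Complex.I * lam * j)))
        freqMeasure := fun j => Integrable.of_bound (C := ‖b j k‖) (by fun_prop)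
          (Eventually.of_forall fun lam => by rw [norm_mul, norm_exp_neg_I_nat, mul_one])
    refine hasSum_integral_of_summable_integral_norm (fun j => integrable_mul_exp (hi j) n) ?_
    simp only [norm_mul, norm_exp_I_int, norm_exp_neg_I_nat, mul_one, integral_const, smul_eq_mul]
    exact (hb.summable_norm k).mul_left _
  rw [← h1.tsum_eq]
  have e : ∀ j : ℕ, coef (fun lam : ℝ => b j k * Complex.exp (-(Complex.I * lam * j))) n =
      if n = j then b j k else 0 := fun j => by
    rw [coef_const_mul]
    have := coef_mul_exp_neg (fun _ => 1) j n
    simp only [one_mul] at this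
    rw [this, coef_one]
    simp only [sub_eq_zero]
    split_ifs <;> simp
  simp only [e]
  split_ifs with h
  · obtain ⟨m, rfl⟩ := Int.eq_ofNat_of_zero_le h
    rw [tsum_eq_single m fun j hj => by rw [if_neg]; exact_mod_cast hj.symm]
    simp
  · refine (tsum_congr fun j => ?_).trans tsum_zero
    rw [if_neg]; rintro rfl; exact h (by omega)

theorem CoeffCondition.isBddCausal (hb : CoeffCondition b) :
    IsBddCausal (symbolBound b) (symbolB b) where
  aesm k := (hb.continuous_symbolB k).aestronglyMeasurable
  bound := Eventually.of_forall hb.sqSum_symbolB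
  coef_neg k n hn := by rw [hb.coef_symbolB, if_neg (not_le.2 hn)]

end Symbol

/-! ## The coefficients of the operators -/

section Operators

theorem coef_polyVec (x : (ℕ × ℕ) →₀ ℂ) (k : ℕ) (n : ℤ) :
    coef (fun lam => polyVec x lam k) n = if 0 ≤ n then x (k, n.toNat) else 0 := by
  have e : ∀ p : ℕ × ℕ, coef (fun lam : ℝ => if p.1 = k then
      x p * Complex.exp (-(Complex.I * lam * p.2)) else 0) n =
      if p.1 = k ∧ n = p.2 then x p else 0 := fun p => by
    by_cases hp : p.1 = k
    · simp only [hp, if_true, true_and]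
      rw [coef_const_mul]
      have := coef_mul_exp_neg (fun _ => 1) p.2 n
      simp only [one_mul] at this
      rw [this, coef_one]
      simp only [sub_eq_zero]
      split_ifs <;> simp
    · simp only [hp, if_false, false_and]
      have := coef_const_mul 0 (fun _ => 0) n
      simpa using this
  unfold polyVec Finsupp.sum
  rw [coef_finset_sum]
  · simp only [e]
    split_ifs with h
    · obtain ⟨m, rfl⟩ := Int.eq_ofNat_of_zero_le h
      simp only [Nat.cast_inj, Int.toNat_natCast]
      rw [Finset.sum_eq_single (k, m)]
      · simp
      · rintro ⟨a, c⟩ _ hp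
        rw [if_neg]
        rintro ⟨rfl, rfl⟩
        exact hp rfl
      · intro h; simpa using h
    · refine Finset.sum_eq_zero fun p _ => ?_
      rw [if_neg]
      rintro ⟨-, rfl⟩
      exact h (by omega)
  · intro p _
    refine Integrable.of_bound (C := ‖x p‖) ?_ (Eventually.of_forall fun lam => ?_)
    · dsimp only; split_ifs <;> fun_prop
    · dsimp only; split_ifs
      · rw [norm_mul, norm_exp_neg_I_nat, mul_one]
      · simp

variable {M N : ℕ∞} {Φ : ℝ → Matrix ℕ (Idx M) ℂ}

/-- `Φ̃ x` consists of the coefficients of `Φ^⊤ X`. -/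
theorem tildeOp_eq_coef (hΦ : L2Fam fun p : ℕ × Idx M => fun lam => Φ lam p.1 p.2)
    (cΦ : IsCausal Φ) {X : ℕ → ℝ → ℂ} (hX : L2Fam X)
    (cX : ∀ k, ∀ n : ℤ, n < 0 → coef (X k) n = 0) {x : ℕ → ℕ → ℂ}
    (hx : ∀ j k : ℕ, x j k = coef (X k) j) (l : ℕ) (i : Idx M) :
    tildeOp (matCoef Φ) x l i = coef (fun lam => tmul (Φ lam) (fun k => X k lam) i) l := by
  have hc : L2Fam fun k lam => Φ lam k i :=
    hΦ.comp_injective (g := fun k => (k, i)) (fun _ _ h => by simpa using h)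
  have h := hc.hasSum_coef_mul hX l
  have e1 : (fun lam => ∑' k, Φ lam k i * X k lam) =
      fun lam => tmul (Φ lam) (fun k => X k lam) i :=
    funext fun lam => tsum_congr fun k => mul_comm _ _
  rw [e1] at h
  rw [← h.tsum_eq]
  have h2 := h.summable.prod_symm
  have h3 : Summable (Function.uncurry fun (k : ℕ) (n : ℤ) =>
    coef (fun lam => Φ lam k i) (l - n) * coef (X k) n) := h.summable
  rw [show (∑' p : ℕ × ℤ, coef (fun lam => Φ lam p.1 i) (l - p.2) * coef (X p.1) p.2) =
      ∑' (k : ℕ) (n : ℤ), coef (fun lam => Φ lam k i) (l - n) * coef (X k) n from h3.tsum_prod,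
    ← h3.tsum_comm]
  have hinj : Function.Injective (fun j : ℕ => (j : ℤ)) := Nat.cast_injective
  -- Causality of X removes n < 0 and causality of Φ removes n > l, which leaves the finite
  -- convolution defining `tildeOp`.
  rw [tsum_eq_sum (s := (Finset.range (l + 1)).map ⟨_, hinj⟩), Finset.sum_map]
  · refine Finset.sum_congr rfl fun j hj => tsum_congr fun k => ?_
    have : j ≤ l := Nat.lt_succ_iff.1 (Finset.mem_range.1 hj)
    rw [hx, matCoef]
    simp [Nat.cast_sub this]
  · intro n hn
    refine (tsum_congr fun k => ?_).trans tsum_zero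
    rcases lt_or_ge n 0 with h0 | h0
    · rw [cX _ _ h0, mul_zero]
    · rw [(cΦ k i).coef_neg _ ?_, zero_mul]
      by_contra hcon
      refine hn (Finset.mem_map.2 ⟨n.toNat, Finset.mem_range.2 (by omega), ?_⟩)
      simpa using h0

theorem L2Fam.tmul_of_bdd {ι : Type*} [Countable ι] {Φ : ℝ → Matrix ℕ ι ℂ}
    (hΦ : L2Fam fun p : ℕ × ι => fun lam => Φ lam p.1 p.2) {C : ℝ} {s : ℝ → ℕ → ℂ}
    (hm : ∀ k, AEStronglyMeasurable (fun lam => s lam k) freqMeasure)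
    (hs : ∀ᵐ lam ∂freqMeasure, SqSum (s lam) ∧ nsq (s lam) ≤ C) :
    L2Fam fun i lam => tmul (Φ lam) (s lam) i := by
  have hm2 : ∀ i, AEStronglyMeasurable (fun lam => tmul (Φ lam) (s lam) i) freqMeasure := fun i => by
    refine aestronglyMeasurable_of_tendsto_ae atTop (f := fun S : Finset ℕ => fun lam =>
      ∑ k ∈ S, s lam k * Φ lam k i)
      (fun S => Finset.aestronglyMeasurable_fun_sum S fun k _ => (hm k).mul (hΦ.aesm (k, i))) ?_
    filter_upwards [hΦ.ae_isHS, hs] with x h1 h2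
    exact (h2.1.summable_mul (h1.col i)).hasSum
  refine L2Fam.of_integrable_bound hm2 (hΦ.integrable_nsq.mul_const C) ?_
  filter_upwards [hΦ.ae_isHS, hs] with x h1 h2
  refine ⟨(h1.tmul h2.1).1, (h1.tmul h2.1).2.trans ?_⟩
  unfold hsq
  gcongr
  · exact nsq_nonneg _
  · exact h2.2

theorem tmul_polyVec {κ : Type*} (Φ : Matrix ℕ κ ℂ) (x : (ℕ × ℕ) →₀ ℂ) (lam : ℝ) (i : κ) :
    tmul Φ (polyVec x lam) i =
      x.sum fun p c => c * Complex.exp (-(Complex.I * lam * p.2)) * Φ p.1 i := by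
  classical
  unfold tmul polyVec Finsupp.sum
  simp only [Finset.sum_mul]
  rw [Summable.tsum_finsetSum fun p _ => ?_]
  · refine Finset.sum_congr rfl fun p _ => ?_
    rw [tsum_eq_single p.1 fun k hk => by rw [if_neg hk.symm, zero_mul]]
    simp
  · refine summable_of_ne_finset_zero (s := {p.1}) fun k hk => ?_
    rw [if_neg, zero_mul]
    rintro rfl; simp at hk

theorem exists_nsq_polyVec_le (x : (ℕ × ℕ) →₀ ℂ) : ∃ C, ∀ lam, nsq (polyVec x lam) ≤ C := by
  classical
  set K : ℝ := ∑ p ∈ x.support, ‖x p‖ with hK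
  have hbd : ∀ lam k, ‖polyVec x lam k‖ ≤ K := fun lam k => by
    refine (norm_sum_le _ _).trans (Finset.sum_le_sum fun p _ => ?_)
    dsimp only
    split_ifs
    · rw [norm_mul, norm_exp_neg_I_nat, mul_one]
    · simp
  refine ⟨(x.support.image Prod.fst).card * K ^ 2, fun lam => ?_⟩
  · unfold nsq
    rw [tsum_eq_sum (s := x.support.image Prod.fst) fun k hk => ?_]
    · refine (Finset.sum_le_sum fun k _ => pow_le_pow_left₀ (norm_nonneg _) (hbd lam k) 2).trans_eq ?_
      simp
    · have : polyVec x lam k = 0 := Finset.sum_eq_zero fun p hp => by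
        dsimp only; rw [if_neg]; rintro rfl; exact hk (Finset.mem_image_of_mem _ hp)
      simp [this]

/-- The relation between `Φ̃` and its adjoint, on finite vectors. -/
theorem sum_conj_mul_coef (hΦ : L2Fam fun p : ℕ × Idx M => fun lam => Φ lam p.1 p.2)
    (cΦ : IsCausal Φ) {z : Idx M → ℝ → ℂ} (hz : L2Fam z) (x : (ℕ × ℕ) →₀ ℂ) (m : ℕ) :
    HasSum (fun p : Idx M × ℕ => coef (z p.1) (p.2 + m) *
        conj (tildeOp (matCoef Φ) (fun j k => x (k, j)) p.2 p.1))
      (x.sum fun p c => conj c * coef (fun lam => ∑' i, z i lam * conj (Φ lam p.1 i))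
        (p.2 + m : ℕ)) := by
  classical
  -- Both sides are the coefficient of index m of Σ_i z_i conj((Φ^⊤ X)_i), where X is the polynomial
  -- with coefficients x. Parseval gives one side and expansion of the polynomial gives the other.
  have hX := IsBddCausal.l2Fam_polyVec x
  have cX : ∀ k, ∀ n : ℤ, n < 0 → coef (fun lam => polyVec x lam k) n = 0 := fun k n hn => by
    rw [coef_polyVec, if_neg (not_le.2 hn)]
  obtain ⟨K, hbd2⟩ := exists_nsq_polyVec_le x
  have hT : L2Fam fun i lam => tmul (Φ lam) (polyVec x lam) i :=
    L2Fam.tmul_of_bdd hΦ hX.aesm (Eventually.of_forall fun lam => ⟨sqSum_polyVec x lam, hbd2 lam⟩)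
  have hcT : ∀ (i : Idx M) (n : ℤ), n < 0 →
      coef (fun lam => tmul (Φ lam) (polyVec x lam) i) n = 0 := fun i n hn => by
    have hc : L2Fam fun k lam => Φ lam k i :=
      hΦ.comp_injective (g := fun k => (k, i)) (fun _ _ h => by simpa using h)
    exact hX.coef_mul_neg hc cX (fun k n hn => (cΦ k i).coef_neg n hn) hn
  have h := hz.hasSum_coef_causal hT hcT m
  have e1 : ∀ p : Idx M × ℕ, coef (fun lam => tmul (Φ lam) (polyVec x lam) p.1) p.2 =
      tildeOp (matCoef Φ) (fun j k => x (k, j)) p.2 p.1 := fun p =>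
    (tildeOp_eq_coef hΦ cΦ hX cX (fun j k => by simp [coef_polyVec]) p.2 p.1).symm
  simp only [e1] at h
  have hr : ∀ k, L2Fam fun i lam => Φ lam k i := fun k =>
    hΦ.comp_injective (g := fun i => (k, i)) (fun _ _ h => by simpa using h)
  have e2 : ∀ᵐ lam ∂freqMeasure, ∑' i, z i lam * conj (tmul (Φ lam) (polyVec x lam) i) =
      ∑ p ∈ x.support, conj (x p) * ((∑' i, z i lam * conj (Φ lam p.1 i)) *
        Complex.exp (Complex.I * (p.2 : ℤ) * lam)) := by
    filter_upwards [hz.ae_sqSum, hΦ.ae_isHS] with lam h1 h2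
    simp only [tmul_polyVec, Finsupp.sum, map_sum, Finset.mul_sum]
    rw [Summable.tsum_finsetSum fun p _ => ?_]
    · refine Finset.sum_congr rfl fun p _ => ?_
      rw [← tsum_mul_right, ← tsum_mul_left]
      refine tsum_congr fun i => ?_
      simp [← Complex.exp_conj]
      ring_nf
    · refine ((h1.summable_mul (h2.row p.1).conj).mul_left
        (conj (x p * Complex.exp (-(Complex.I * lam * p.2))))).congr fun i => ?_
      simp; ring
  have e3 : coef (fun lam => ∑' i, z i lam * conj (tmul (Φ lam) (polyVec x lam) i)) m =
      x.sum fun p c => conj c * coef (fun lam => ∑' i, z i lam * conj (Φ lam p.1 i))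
        (p.2 + m : ℕ) := by
   rw [coef_congr e2, coef_finset_sum _ fun p _ =>
    (integrable_mul_exp (hz.integrable_tsum (hr p.1)) _).const_mul _]
   refine Finset.sum_congr rfl fun p _ => ?_
   rw [coef_const_mul, coef_mul_exp]
   congr 2
   push_cast; ring
  rw [← e3]
  exact h

end Operators

/-! ## The causal part of the optimality equation -/

section CausalPart

variable {M N : ℕ∞} {Φ : ℝ → Matrix ℕ (Idx M) ℂ}

theorem IsL2Operator.bound {φ : ℕ → Matrix ℕ (Idx M) ℂ} (h : IsL2Operator φ) :
    ∃ C : ℝ, 0 ≤ C ∧ ∀ x : (ℕ × ℕ) →₀ ℂ,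
      (SqSum fun p : Idx M × ℕ => tildeOp φ (fun j k => x (k, j)) p.2 p.1) ∧
      nsq (fun p : Idx M × ℕ => tildeOp φ (fun j k => x (k, j)) p.2 p.1) ≤
        C * ∑ p ∈ x.support, ‖x p‖ ^ 2 := by
  obtain ⟨C, hC⟩ := h
  refine ⟨C, C.2, fun x => ?_⟩
  -- `IsL2Operator` indexes finite vectors by (j, k), while polynomials are indexed by (k, j).
  set x' : (ℕ × ℕ) →₀ ℂ := x.equivMapDomain (Equiv.prodComm ℕ ℕ) with hx'
  have e0 : ∀ j k, x' (j, k) = x (k, j) := fun j k => rfl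
  have h1 := hC x'
  simp only [e0] at h1
  have e1 : (x'.sum fun _ c => ‖c‖ₑ ^ 2) = ENNReal.ofReal (∑ p ∈ x.support, ‖x p‖ ^ 2) := by
    rw [hx', Finsupp.sum_equivMapDomain, ENNReal.ofReal_sum_of_nonneg fun _ _ => by positivity]
    refine Finset.sum_congr rfl fun p _ => ?_
    rw [ENNReal.ofReal_pow (norm_nonneg _), ofReal_norm]
  rw [e1, ENNReal.tsum_comm, ← ENNReal.tsum_prod (f := fun (i : Idx M) (l : ℕ) =>
    ‖tildeOp φ (fun j k => x (k, j)) l i‖ₑ ^ 2)] at h1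
  have e2 : ∀ p : Idx M × ℕ, ‖tildeOp φ (fun j k => x (k, j)) p.2 p.1‖ₑ ^ 2 =
      ENNReal.ofReal (‖tildeOp φ (fun j k => x (k, j)) p.2 p.1‖ ^ 2) := fun p => by
    rw [ENNReal.ofReal_pow (norm_nonneg _), ofReal_norm]
  simp only [e2] at h1
  have h2 : (C : ℝ≥0∞) * ENNReal.ofReal (∑ p ∈ x.support, ‖x p‖ ^ 2) =
      ENNReal.ofReal (C * ∑ p ∈ x.support, ‖x p‖ ^ 2) := by
    rw [ENNReal.ofReal_mul (NNReal.coe_nonneg C), ENNReal.ofReal_coe_nnreal]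
  rw [h2] at h1
  refine SqSum.of_sum_le fun s => ?_
  have h3 := (ENNReal.sum_le_tsum s).trans h1
  rw [← ENNReal.ofReal_sum_of_nonneg fun _ _ => by positivity] at h3
  refine (ENNReal.ofReal_le_ofReal_iff ?_).1 h3
  exact mul_nonneg C.2 (Finset.sum_nonneg fun _ _ => by positivity)

/-- The restriction of a family to a finite set, with finite support. -/
def finPart (S : Finset (ℕ × ℕ)) (c : ℕ × ℕ → ℂ) : (ℕ × ℕ) →₀ ℂ :=
  Finsupp.onFinset S (fun p => if p ∈ S then c p else 0) (by simp_all)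

theorem finPart_apply (S : Finset (ℕ × ℕ)) (c : ℕ × ℕ → ℂ) (p : ℕ × ℕ) :
    finPart S c p = trunc S c p := by
  rw [finPart, Finsupp.onFinset_apply, trunc]; congr

theorem finPart_sum {E : Type*} [AddCommMonoid E] (S : Finset (ℕ × ℕ)) (c : ℕ × ℕ → ℂ)
    (φ : ℕ × ℕ → ℂ → E) (h : ∀ p, φ p 0 = 0) :
    (finPart S c).sum φ = ∑ p ∈ S, φ p (c p) := by
  unfold finPart
  rw [Finsupp.sum_of_support_subset (s := S) _ Finsupp.support_onFinset_subset _ fun i _ => h i]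
  exact Finset.sum_congr rfl fun p hp => by rw [Finsupp.onFinset_apply, if_pos hp]

theorem sum_support_finPart (S : Finset (ℕ × ℕ)) (c : ℕ × ℕ → ℂ) :
    ∑ p ∈ (finPart S c).support, ‖finPart S c p‖ ^ 2 = ∑ p ∈ S, ‖c p‖ ^ 2 :=
  finPart_sum S c (fun _ c => ‖c‖ ^ 2) (by simp)

theorem sqSum_shift {z : Idx M → ℝ → ℂ} (hz : L2Fam z) (m : ℕ) :
    SqSum fun p : Idx M × ℕ => coef (z p.1) (p.2 + m) :=
  Summable.comp_injective (f := fun p : Idx M × ℤ => ‖coef (z p.1) p.2‖ ^ 2) hz.sqSum_coef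
    (i := fun p : Idx M × ℕ => (p.1, (p.2 + m : ℤ))) fun p q h => by
      simp only [Prod.mk.injEq] at h; exact Prod.ext h.1 (by omega)

/-- The coefficients of `conj(Φ) z` are square summable, and `psiC` pairs them with those of a
row of `Ψ`. -/
theorem tsum_conj_mul_coef (hΦ : L2Fam fun p : ℕ × Idx M => fun lam => Φ lam p.1 p.2)
    (cΦ : IsCausal Φ) (hop : IsL2Operator (matCoef Φ)) {z : Idx M → ℝ → ℂ} (hz : L2Fam z) (m : ℕ)
    {X : ℕ → ℝ → ℂ} (hX : L2Fam X) (cX : ∀ k, ∀ n : ℤ, n < 0 → coef (X k) n = 0)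
    (hR : L2Fam fun i lam => tmul (Φ lam) (fun k => X k lam) i) :
    ∑' j : ℕ, ∑' k, conj (coef (X k) j) *
        coef (fun lam => ∑' i, z i lam * conj (Φ lam k i)) (j + m : ℕ) =
      coef (fun lam => ∑' i, z i lam * conj (tmul (Φ lam) (fun k => X k lam) i)) m := by
  obtain ⟨C, hC0, hC⟩ := hop.bound
  set c : ℕ × ℕ → ℂ := fun p =>
    coef (fun lam => ∑' i, z i lam * conj (Φ lam p.1 i)) (p.2 + m : ℕ) with hc
  set y : Idx M × ℕ → ℂ := fun p => coef (z p.1) (p.2 + m) with hy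
  have hys : SqSum y := sqSum_shift hz m
  have key : ∀ x : (ℕ × ℕ) →₀ ℂ, (x.sum fun p a => conj a * c p) =
      ∑' p, y p * conj (tildeOp (matCoef Φ) (fun j k => x (k, j)) p.2 p.1) := fun x =>
    (sum_conj_mul_coef hΦ cΦ hz x m).tsum_eq.symm
  -- By `key`, `c` is the adjoint of the bounded operator applied to `y`. Testing on finite vectors
  -- gives its norm bound without first making sense of the adjoint series.
  have hcs : SqSum c := by
    refine (SqSum.of_dual (C := nsq y * C) (mul_nonneg (nsq_nonneg y) hC0) fun S a => ?_).1
    have h1 := key (finPart S fun p => conj (a p))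
    rw [finPart_sum _ _ _ (by simp)] at h1
    simp only [Complex.conj_conj] at h1
    rw [h1]
    refine (norm_tsum_mul_sq_le hys (hC _).1.conj).trans ?_
    rw [nsq_conj, mul_assoc]
    refine mul_le_mul_of_nonneg_left ((hC _).2.trans_eq ?_) (nsq_nonneg y)
    rw [sum_support_finPart]
    simp
  set ψ : ℕ × ℕ → ℂ := fun p => coef (X p.1) p.2 with hψ
  have hψs : SqSum ψ :=
    Summable.comp_injective (f := fun p : ℕ × ℤ => ‖coef (X p.1) p.2‖ ^ 2) hX.sqSum_coef
      (i := fun p : ℕ × ℕ => (p.1, (p.2 : ℤ))) fun p q h => by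
        simp only [Prod.mk.injEq, Nat.cast_inj] at h; exact Prod.ext h.1 h.2
  have hr : ∀ p : Idx M × ℕ, tildeOp (matCoef Φ) (fun j k => ψ (k, j)) p.2 p.1 =
      coef (fun lam => tmul (Φ lam) (fun k => X k lam) p.1) p.2 := fun p =>
    tildeOp_eq_coef hΦ cΦ hX cX (fun j k => rfl) p.2 p.1
  have hrs : SqSum fun p : Idx M × ℕ => tildeOp (matCoef Φ) (fun j k => ψ (k, j)) p.2 p.1 := by
    simp only [hr]
    exact Summable.comp_injective (f := fun p : Idx M × ℤ =>
      ‖coef (fun lam => tmul (Φ lam) (fun k => X k lam) p.1) p.2‖ ^ 2) hR.sqSum_coef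
      (i := fun p : Idx M × ℕ => (p.1, (p.2 : ℤ))) fun p q h => by
        simp only [Prod.mk.injEq, Nat.cast_inj] at h; exact Prod.ext h.1 h.2
  -- weak convergence along the truncations of `ψ`
  have hq : ∀ S : Finset (ℕ × ℕ),
      (SqSum fun p : Idx M × ℕ =>
        conj (tildeOp (matCoef Φ) (fun j k => finPart S ψ (k, j)) p.2 p.1)) ∧
      nsq (fun p : Idx M × ℕ =>
        conj (tildeOp (matCoef Φ) (fun j k => finPart S ψ (k, j)) p.2 p.1)) ≤ C * nsq ψ :=
    fun S => by
      refine ⟨(hC _).1.conj, ?_⟩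
      rw [nsq_conj]
      refine (hC _).2.trans (mul_le_mul_of_nonneg_left ?_ hC0)
      rw [sum_support_finPart]
      exact hψs.sum_le_tsum S fun _ _ => by positivity
  have hφ : ∀ (n : ℕ) (i : Idx M), SqSum fun k => matCoef Φ n k i := fun n i => by
    have h1 : L2Fam fun k lam => Φ lam k i :=
      hΦ.comp_injective (g := fun k => (k, i)) (fun _ _ h => by simpa using h)
    exact Summable.comp_injective (f := fun p : ℕ × ℤ => ‖coef (fun lam => Φ lam p.1 i) p.2‖ ^ 2)
      h1.sqSum_coef (i := fun k : ℕ => (k, (n : ℤ))) fun p q h => by simpa using h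
  have hψj : ∀ j, SqSum fun k => ψ (k, j) := fun j =>
    Summable.comp_injective (f := fun p : ℕ × ℕ => ‖ψ p‖ ^ 2) hψs (i := fun k => (k, j))
      fun p q h => by simpa using h
  have hlim : ∀ p : Idx M × ℕ, Tendsto (fun S : Finset (ℕ × ℕ) =>
      conj (tildeOp (matCoef Φ) (fun j k => finPart S ψ (k, j)) p.2 p.1)) atTop
      (𝓝 (conj (tildeOp (matCoef Φ) (fun j k => ψ (k, j)) p.2 p.1))) := fun p => by
    refine (Complex.continuous_conj.tendsto _).comp ?_
    unfold tildeOp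
    refine tendsto_finsetSum _ fun j _ => ?_
    refine tendsto_tsum_of_dominated_convergence
      (bound := fun k => ‖matCoef Φ (p.2 - j) k p.1 * ψ (k, j)‖)
      ((hφ _ _).summable_norm_mul (hψj j)) (fun k => ?_) (Eventually.of_forall fun S k => ?_)
    · refine tendsto_const_nhds.congr' ?_
      filter_upwards [eventually_ge_atTop {(k, j)}] with S hS
      have : (k, j) ∈ S := hS (Finset.mem_singleton_self _)
      rw [finPart_apply, trunc, if_pos this]
    · change ‖matCoef Φ (p.2 - j) k p.1 * finPart S ψ (k, j)‖ ≤ _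
      rw [norm_mul, norm_mul, finPart_apply]
      gcongr
      exact norm_trunc_le S ψ (k, j)
  have hw := tendsto_tsum_mul_of_bounded hq hrs.conj hys hlim
  have e1 : ∀ S : Finset (ℕ × ℕ), ∑' p : Idx M × ℕ,
      conj (tildeOp (matCoef Φ) (fun j k => finPart S ψ (k, j)) p.2 p.1) * y p =
        ∑ p ∈ S, conj (ψ p) * c p := fun S => by
    have := key (finPart S ψ)
    rw [finPart_sum _ _ _ (by simp)] at this
    rw [this]
    exact tsum_congr fun p => mul_comm _ _
  simp only [e1] at hw
  have hsum : Summable fun p => conj (ψ p) * c p := hψs.conj.summable_mul hcs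
  have e2 := tendsto_nhds_unique hw hsum.hasSum
  have hcR : ∀ (i : Idx M) (n : ℤ), n < 0 →
      coef (fun lam => tmul (Φ lam) (fun k => X k lam) i) n = 0 := fun i n hn =>
    hX.coef_mul_neg (hΦ.comp_injective (g := fun k => (k, i)) (fun _ _ h => by simpa using h))
      cX (fun k n hn => (cΦ k i).coef_neg n hn) hn
  have h3 := (hz.hasSum_coef_causal hR hcR m).tsum_eq
  rw [← h3]
  have h4 : Summable (Function.uncurry fun k j => conj (ψ (k, j)) * c (k, j)) := hsum
  rw [show (∑' j : ℕ, ∑' k, conj (coef (X k) j) *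
        coef (fun lam => ∑' i, z i lam * conj (Φ lam k i)) (j + m : ℕ)) =
      ∑' (j : ℕ) (k : ℕ), conj (ψ (k, j)) * c (k, j) from rfl, h4.tsum_comm,
    show (∑' (k : ℕ) (j : ℕ), conj (ψ (k, j)) * c (k, j)) = ∑' p : ℕ × ℕ, conj (ψ p) * c p from
      (hsum.tsum_prod).symm, ← e2]
  refine tsum_congr fun p => ?_
  rw [hr, mul_comm]

/-- Φ̃b lists the coefficients of Φ^⊤B, and the sum over l is Parseval against a causal row of Φ.
Thus the algebraic vectors c(m) become coefficients of the function conj(Φ) Φ^⊤ B. -/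
theorem cVec_eq_coef {b : ℕ → ℕ → ℂ} (hb : CoeffCondition b)
    (hΦ : L2Fam fun p : ℕ × Idx M => fun lam => Φ lam p.1 p.2) (cΦ : IsCausal Φ) (m k : ℕ) :
    cVec (matCoef Φ) b m k =
      coef (fun lam => ∑' i, tmul (Φ lam) (symbolB b lam) i * conj (Φ lam k i)) m := by
  have hB := hb.isBddCausal
  have hz : L2Fam fun i lam => tmul (Φ lam) (symbolB b lam) i :=
    L2Fam.tmul_of_bdd hΦ hB.aesm hB.bound
  have hr : L2Fam fun i lam => Φ lam k i :=
    hΦ.comp_injective (g := fun i => (k, i)) (fun _ _ h => by simpa using h)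
  have h := hz.hasSum_coef_causal hr (fun i n hn => (cΦ k i).coef_neg n hn) m
  rw [← h.tsum_eq]
  have h2 : Summable (Function.uncurry fun (i : Idx M) (l : ℕ) =>
      coef (fun lam => tmul (Φ lam) (symbolB b lam) i) (l + m) *
        conj (coef (fun lam => Φ lam k i) l)) := h.summable
  rw [show (∑' p : Idx M × ℕ, coef (fun lam => tmul (Φ lam) (symbolB b lam) p.1) (p.2 + m) *
        conj (coef (fun lam => Φ lam k p.1) p.2)) = ∑' (i : Idx M) (l : ℕ),
      coef (fun lam => tmul (Φ lam) (symbolB b lam) i) (l + m) *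
        conj (coef (fun lam => Φ lam k i) l) from h.summable.tsum_prod, ← h2.tsum_comm]
  refine tsum_congr fun l => tsum_congr fun i => ?_
  rw [mul_comm, tildeOp_eq_coef hΦ cΦ hB.l2Fam hB.coef_neg
    (fun j k => by simp [hb.coef_symbolB]) (l + m) i]
  push_cast
  rfl

/-- Parseval in each component. It transfers square integrability of a whole family to its causal
projection, for which only componentwise integrability is given. -/
theorem L2Fam.of_coef_le {κ : Type*} [Countable κ] {F G : κ → ℝ → ℂ}
    (hF : ∀ k, MemLp (F k) 2 freqMeasure) (hG : L2Fam G)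
    (h : ∀ k n, ‖coef (F k) n‖ ≤ ‖coef (G k) n‖) : L2Fam F := by
  refine ⟨fun k => (hF k).1, ?_⟩
  refine lt_of_le_of_lt (ENNReal.tsum_le_tsum fun k => ?_) hG.finite
  rw [hG.lintegral_eq k]
  have e : ∫⁻ lam, ‖F k lam‖ₑ ^ 2 ∂freqMeasure =
      ENNReal.ofReal (∫ lam, ‖F k lam‖ ^ 2 ∂freqMeasure) := by
    rw [ofReal_integral_eq_lintegral_ofReal (hF k).norm.integrable_sq
      (Eventually.of_forall fun _ => by positivity)]
    refine lintegral_congr fun x => ?_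
    rw [ENNReal.ofReal_pow (norm_nonneg _), ofReal_norm]
  rw [e]
  refine ENNReal.ofReal_le_ofReal ?_
  have h1 := hasSum_norm_coef_sq (hF k)
  have h2 := hasSum_norm_coef_sq (hG.memLp k)
  have h3 := hasSum_le (fun n => pow_le_pow_left₀ (norm_nonneg _) (h k n) 2) h1 h2
  have := Real.pi_pos
  exact le_of_mul_le_mul_left h3 (by positivity)

/-- The nonnegative coefficients of `conj(Θ) h` are those of `conj(Φ) Φ^⊤ B`. -/
theorem coef_causal_part_eq {b : ℕ → ℕ → ℂ} (hb : CoeffCondition b)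
    (hΦ : L2Fam fun p : ℕ × Idx M => fun lam => Φ lam p.1 p.2) (cΦ : IsCausal Φ)
    (hop : IsL2Operator (matCoef Φ))
    {Θ : ℝ → Matrix ℕ (Idx N) ℂ} {Ψ : ℝ → Matrix (Idx N) ℕ ℂ}
    (hΘ : L2Fam fun p : ℕ × Idx N => fun lam => Θ lam p.1 p.2) (cΘ : IsCausal Θ)
    (hΨ : ∀ i, L2Fam fun k lam => Ψ lam i k) (cΨ : IsCausal Ψ)
    (hI : ∀ᵐ lam ∂freqMeasure, IsInversePair (Θ lam) (Ψ lam))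
    (hdom : ∀ᵐ lam ∂freqMeasure, ∀ v, SqSum v → nsq (tmul (Φ lam) v) ≤ nsq (tmul (Θ lam) v))
    {h : ℝ → Idx N → ℂ} (hh : IsPsiCSeries (matCoef Ψ) (matCoef Φ) b h) (k n : ℕ) :
    coef (fun lam => ∑' i, h lam i * conj (Θ lam k i)) n =
      coef (fun lam => ∑' p, tmul (Φ lam) (symbolB b lam) p * conj (Φ lam k p)) n := by
  have hB := hb.isBddCausal
  have hz : L2Fam fun i lam => tmul (Φ lam) (symbolB b lam) i :=
    L2Fam.tmul_of_bdd hΦ hB.aesm hB.bound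
  have hcon : ∀ᵐ lam ∂freqMeasure,
      (∀ i, SqSum (tmul (Φ lam) fun k => Ψ lam i k) ∧
        nsq (tmul (Φ lam) fun k => Ψ lam i k) ≤ 1) ∧
      (SqSum (fun i => ∑' p, tmul (Φ lam) (symbolB b lam) p *
          conj (tmul (Φ lam) (fun k => Ψ lam i k) p)) ∧
        nsq (fun i => ∑' p, tmul (Φ lam) (symbolB b lam) p *
          conj (tmul (Φ lam) (fun k => Ψ lam i k) p)) ≤
            nsq fun i => tmul (Φ lam) (symbolB b lam) i) ∧
      ∀ k, ∑' i, (∑' p, tmul (Φ lam) (symbolB b lam) p *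
          conj (tmul (Φ lam) (fun k => Ψ lam i k) p)) * conj (Θ lam k i) =
        ∑' p, tmul (Φ lam) (symbolB b lam) p * conj (Φ lam k p) := by
    filter_upwards [hI, hdom, hΦ.ae_isHS, hz.ae_sqSum] with lam h1 h2 h3 h4
    exact h1.contraction h3 h2 h4
  have hRm : ∀ i p, AEStronglyMeasurable (fun lam => tmul (Φ lam) (fun k => Ψ lam i k) p)
      freqMeasure := fun i p => by
    have hc : L2Fam fun k lam => Φ lam k p :=
      hΦ.comp_injective (g := fun k => (k, p)) (fun _ _ h => by simpa using h)
    have := ((hΨ i).integrable_tsum hc.star).1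
    simp only [Complex.conj_conj] at this
    exact this
  have hR : ∀ i, L2Fam fun p lam => tmul (Φ lam) (fun k => Ψ lam i k) p := fun i =>
    L2Fam.of_bounded (hRm i) (hcon.mono fun lam h => h.1 i)
  -- E = conj(R) Φ^⊤ B with the contraction R = ΨΦ; in general it is not causal.
  set E : Idx N → ℝ → ℂ := fun i lam => ∑' p, tmul (Φ lam) (symbolB b lam) p *
    conj (tmul (Φ lam) (fun k => Ψ lam i k) p) with hE
  have hEf : L2Fam E := L2Fam.of_integrable_bound (fun i => (hz.integrable_tsum (hR i)).1)
    hz.integrable_nsq (hcon.mono fun lam h => h.2.1)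
  -- The doubly infinite sum `psiC` is a nonnegative coefficient of E, hence h is the causal
  -- projection of E. Boundedness of the operator Φ̃ justifies the interchange of sums.
  have hpsi : ∀ i (m : ℕ), coef (fun lam => h lam i) m = coef (E i) m := fun i m => by
    rw [(hh i).coef_nonneg m]
    have := tsum_conj_mul_coef hΦ cΦ hop hz m (hΨ i) (fun k n hn => (cΨ i k).coef_neg n hn) (hR i)
    rw [hE, ← this]
    unfold psiC
    refine tsum_congr fun j => tsum_congr fun k => ?_
    rw [cVec_eq_coef hb hΦ cΦ]
    rfl
  have hhf : L2Fam fun i lam => h lam i :=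
    L2Fam.of_coef_le (fun i => (hh i).memLp) hEf fun i n => by
      rcases lt_or_ge n 0 with hn | hn
      · rw [(hh i).coef_neg n hn]; simp
      · obtain ⟨m, rfl⟩ := Int.eq_ofNat_of_zero_le hn
        rw [hpsi]
  have hr : L2Fam fun i lam => Θ lam k i :=
    hΘ.comp_injective (g := fun i => (k, i)) (fun _ _ h => by simpa using h)
  -- Only coefficients of h - E with nonnegative index meet the causal row of Θ when n ≥ 0, and all
  -- of these vanish.
  have h1 := (hhf.sub hEf).hasSum_coef_causal hr (fun i n hn => (cΘ k i).coef_neg n hn) n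
  have h2 : ∀ p : Idx N × ℕ, coef (fun lam => h lam p.1 - E p.1 lam) (p.2 + n) = 0 := fun p => by
    rw [coef_sub ((hhf.memLp p.1).integrable (by norm_num))
      ((hEf.memLp p.1).integrable (by norm_num))]
    have := hpsi p.1 (p.2 + n)
    push_cast at this
    rw [this, sub_self]
  simp only [h2, zero_mul] at h1
  have h3 := h1.unique hasSum_zero
  -- The last part of `contraction` gives conj(Θ) E = conj(Φ) Φ^⊤ B.
  have e1 : ∀ᵐ lam ∂freqMeasure, ∑' i, (h lam i - E i lam) * conj (Θ lam k i) =
      (∑' i, h lam i * conj (Θ lam k i)) -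
        ∑' p, tmul (Φ lam) (symbolB b lam) p * conj (Φ lam k p) := by
    filter_upwards [hcon, hhf.ae_sqSum, hEf.ae_sqSum, hr.ae_sqSum] with lam g1 g2 g3 g4
    rw [← g1.2.2 k, ← (g2.summable_mul g4.conj).tsum_sub (g3.summable_mul g4.conj)]
    exact tsum_congr fun i => by ring
  rw [coef_congr e1, coef_sub (hhf.integrable_tsum hr)
    (hz.integrable_tsum (hΦ.comp_injective (g := fun i => (k, i)) (fun _ _ h => by simpa using h))),
    sub_eq_zero] at h3
  exact h3

end CausalPart

/-! ## Integrated forms of spectral densities -/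

section Density

variable {f g : ℝ → Mat}

namespace IsSpectralDensity

theorem add (hf : IsSpectralDensity f) (hg : IsSpectralDensity g) :
    IsSpectralDensity fun lam => f lam + g lam where
  measurable k l := (hf.measurable k l).add (hg.measurable k l)
  posSemidef := by
    filter_upwards [hf.posSemidef, hg.posSemidef] with lam h1 h2
    exact h1.add h2
  trace_finite := by
    refine lt_of_le_of_lt (ENNReal.tsum_le_tsum fun k => (lintegral_mono fun lam =>
      enorm_add_le (f lam k k) (g lam k k)).trans_eq
        (lintegral_add_left' (hf.measurable k k).enorm _)) ?_
    rw [ENNReal.tsum_add]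
    exact ENNReal.add_lt_top.2 ⟨hf.trace_finite, hg.trace_finite⟩

theorem lintegral_trace (hf : IsSpectralDensity f) :
    ∫⁻ lam, ∑' k, ‖f lam k k‖ₑ ∂freqMeasure < ∞ := by
  rw [lintegral_tsum fun k => (hf.measurable k k).enorm]
  exact hf.trace_finite

theorem ae_isTracePos (hf : IsSpectralDensity f) : ∀ᵐ lam ∂freqMeasure, IsTracePos (f lam) := by
  have h := ae_lt_top' (AEMeasurable.tsum fun k => (hf.measurable k k).enorm)
    hf.lintegral_trace.ne
  filter_upwards [h, hf.posSemidef] with lam h1 h2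
  refine ⟨h2, ?_⟩
  have h3 : ∑' k, ENNReal.ofReal (f lam k k).re ≠ ∞ := by
    simpa only [h2.enorm_diag] using h1.ne
  have := ENNReal.summable_toReal h3
  exact this.congr fun k => ENNReal.toReal_ofReal (h2.diag_re_nonneg k)

theorem ae_rtr (hf : IsSpectralDensity f) :
    ∀ᵐ lam ∂freqMeasure, ENNReal.ofReal (rtr (f lam)) = ∑' k, ‖f lam k k‖ₑ := by
  filter_upwards [hf.ae_isTracePos] with lam h
  rw [rtr, ENNReal.ofReal_tsum_of_nonneg h.posSemidef.diag_re_nonneg h.summable]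
  exact tsum_congr fun k => (h.posSemidef.enorm_diag k).symm

theorem integrable_rtr (hf : IsSpectralDensity f) :
    Integrable (fun lam => rtr (f lam)) freqMeasure := by
  have hm : AEStronglyMeasurable (fun lam => rtr (f lam)) freqMeasure := by
    refine aestronglyMeasurable_of_tendsto_ae (atTop : Filter (Finset ℕ))
      (f := fun s lam => ∑ k ∈ s, (f lam k k).re) (fun s => ?_) ?_
    · exact Finset.aestronglyMeasurable_fun_sum _ fun k _ =>
        Complex.continuous_re.comp_aestronglyMeasurable (hf.measurable k k)
    · filter_upwards [hf.ae_isTracePos] with lam h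
      exact h.summable.hasSum
  refine ⟨hm, ?_⟩
  rw [hasFiniteIntegral_iff_ofReal (by
    filter_upwards [hf.ae_isTracePos] with lam h using h.rtr_nonneg)]
  rw [lintegral_congr_ae hf.ae_rtr]
  exact hf.lintegral_trace

theorem aesm_bform (hf : IsSpectralDensity f) {u v : ℝ → ℕ → ℂ}
    (hu : ∀ k, AEStronglyMeasurable (fun lam => u lam k) freqMeasure)
    (hv : ∀ k, AEStronglyMeasurable (fun lam => v lam k) freqMeasure)
    (su : ∀ᵐ lam ∂freqMeasure, SqSum (u lam)) (sv : ∀ᵐ lam ∂freqMeasure, SqSum (v lam)) :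
    AEStronglyMeasurable (fun lam => bform (f lam) (u lam) (v lam)) freqMeasure := by
  refine aestronglyMeasurable_of_tendsto_ae (atTop : Filter (Finset (ℕ × ℕ)))
    (f := fun s lam => ∑ p ∈ s, u lam p.1 * f lam p.1 p.2 * conj (v lam p.2)) (fun s => ?_) ?_
  · exact Finset.aestronglyMeasurable_fun_sum _ fun p _ =>
      ((hu p.1).mul (hf.measurable p.1 p.2)).mul
        (Complex.continuous_conj.comp_aestronglyMeasurable (hv p.2))
  · filter_upwards [hf.ae_isTracePos, su, sv] with lam h h1 h2
    exact (h.summable_bform h1 h2).hasSum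

theorem aesm_qform (hf : IsSpectralDensity f) {u : ℝ → ℕ → ℂ}
    (hu : ∀ k, AEStronglyMeasurable (fun lam => u lam k) freqMeasure)
    (su : ∀ᵐ lam ∂freqMeasure, SqSum (u lam)) :
    AEStronglyMeasurable (fun lam => qform (f lam) (u lam)) freqMeasure := by
  refine (Complex.continuous_re.comp_aestronglyMeasurable
    (hf.aesm_bform hu hu su su)).congr ?_
  filter_upwards [hf.ae_isTracePos, su] with lam h h1
  exact (h.qform_eq h1).symm

end IsSpectralDensity

/-- Measurable functions with values in a bounded subset of `ℓ²`. -/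
structure IsBddVec (C : ℝ) (s : ℝ → ℕ → ℂ) : Prop where
  aesm : ∀ k, AEStronglyMeasurable (fun lam => s lam k) freqMeasure
  bound : ∀ᵐ lam ∂freqMeasure, SqSum (s lam) ∧ nsq (s lam) ≤ C

theorem IsBddCausal.toVec {C : ℝ} {s : ℝ → ℕ → ℂ} (h : IsBddCausal C s) : IsBddVec C s :=
  ⟨h.aesm, h.bound⟩

theorem exists_isBddVec_polyVec (x : (ℕ × ℕ) →₀ ℂ) : ∃ C, IsBddVec C (polyVec x) := by
  obtain ⟨C, hC⟩ := exists_nsq_polyVec_le x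
  exact ⟨C, fun k => (continuous_polyVec x k).aestronglyMeasurable,
    Eventually.of_forall fun lam => ⟨sqSum_polyVec x lam, hC lam⟩⟩

namespace IsBddVec

variable {C D : ℝ} {s t : ℝ → ℕ → ℂ}

theorem sqSum (h : IsBddVec C s) : ∀ᵐ lam ∂freqMeasure, SqSum (s lam) :=
  h.bound.mono fun _ h => h.1

theorem sub (hs : IsBddVec C s) (ht : IsBddVec D t) :
    IsBddVec (2 * C + 2 * D) fun lam k => s lam k - t lam k where
  aesm k := (hs.aesm k).sub (ht.aesm k)
  bound := by
    filter_upwards [hs.bound, ht.bound] with lam h1 h2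
    exact ⟨h1.1.sub h2.1, (nsq_sub_le h1.1 h2.1).trans (by linarith [h1.2, h2.2])⟩

theorem mul (hs : IsBddVec C s) {φ : ℝ → ℂ} (hφ : AEStronglyMeasurable φ freqMeasure) {K : ℝ}
    (hK : ∀ᵐ lam ∂freqMeasure, ‖φ lam‖ ^ 2 ≤ K) : IsBddVec (K * C) fun lam k => φ lam * s lam k where
  aesm k := hφ.mul (hs.aesm k)
  bound := by
    filter_upwards [hs.bound, hK] with lam h1 h2
    refine ⟨h1.1.const_mul _, ?_⟩
    rw [nsq_const_mul]
    exact mul_le_mul h2 h1.2 (nsq_nonneg _) ((sq_nonneg _).trans h2)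

theorem inc (hs : IsBddVec C s) (d τ : ℕ) :
    IsBddVec ((τ : ℝ) ^ (2 * d) * C) fun lam k => incFactor d τ lam * s lam k :=
  hs.mul (measurable_incFactor d τ).aestronglyMeasurable
    (Eventually.of_forall fun x => by rw [norm_incFactor_sq]; exact incWeight_le d τ x)

end IsBddVec

/-- The integrated sesquilinear form. -/
def iform (F : ℝ → Mat) (u v : ℝ → ℕ → ℂ) : ℂ := ∫ lam, bform (F lam) (u lam) (v lam) ∂freqMeasure

/-- The integrated quadratic form. -/
def iq (F : ℝ → Mat) (u : ℝ → ℕ → ℂ) : ℝ := ∫ lam, qform (F lam) (u lam) ∂freqMeasure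

namespace IsSpectralDensity

variable {C D : ℝ} {u v : ℝ → ℕ → ℂ}

theorem ae_norm_bform_le (hf : IsSpectralDensity f) (hu : IsBddVec C u) (hv : IsBddVec D v) :
    ∀ᵐ lam ∂freqMeasure, ‖bform (f lam) (u lam) (v lam)‖ ≤ rtr (f lam) * (√C * √D) := by
  filter_upwards [hf.ae_isTracePos, hu.bound, hv.bound] with lam h h1 h2
  refine (h.norm_bform_le h1.1 h2.1).trans (mul_le_mul_of_nonneg_left ?_ h.rtr_nonneg)
  exact mul_le_mul (Real.sqrt_le_sqrt h1.2) (Real.sqrt_le_sqrt h2.2) (Real.sqrt_nonneg _)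
    (Real.sqrt_nonneg _)

theorem integrable_bform (hf : IsSpectralDensity f) (hu : IsBddVec C u) (hv : IsBddVec D v) :
    Integrable (fun lam => bform (f lam) (u lam) (v lam)) freqMeasure :=
  (hf.integrable_rtr.mul_const (√C * √D)).mono'
    (hf.aesm_bform hu.aesm hv.aesm hu.sqSum hv.sqSum) (hf.ae_norm_bform_le hu hv)

theorem ae_qform_eq (hf : IsSpectralDensity f) (hu : IsBddVec C u) :
    ∀ᵐ lam ∂freqMeasure, qform (f lam) (u lam) = (bform (f lam) (u lam) (u lam)).re := by
  filter_upwards [hf.ae_isTracePos, hu.bound] with lam h h1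
  exact h.qform_eq h1.1

theorem ae_qform_nonneg (hf : IsSpectralDensity f) (hu : IsBddVec C u) :
    ∀ᵐ lam ∂freqMeasure, 0 ≤ qform (f lam) (u lam) := by
  filter_upwards [hf.ae_isTracePos, hu.bound] with lam h h1
  exact h.qform_nonneg h1.1

theorem integrable_qform (hf : IsSpectralDensity f) (hu : IsBddVec C u) :
    Integrable (fun lam => qform (f lam) (u lam)) freqMeasure :=
  (hf.integrable_bform hu hu).re.congr ((hf.ae_qform_eq hu).mono fun _ h => h.symm)

theorem iq_nonneg (hf : IsSpectralDensity f) (hu : IsBddVec C u) : 0 ≤ iq f u :=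
  integral_nonneg_of_ae (hf.ae_qform_nonneg hu)

theorem iq_eq (hf : IsSpectralDensity f) (hu : IsBddVec C u) : iq f u = (iform f u u).re := by
  rw [iq, iform, integral_congr_ae (hf.ae_qform_eq hu)]
  exact integral_re (hf.integrable_bform hu hu)

theorem normSqL2_eq (hf : IsSpectralDensity f) (hu : IsBddVec C u) :
    normSqL2 f u = ENNReal.ofReal (iq f u) := by
  rw [iq, ofReal_integral_eq_lintegral_ofReal (hf.integrable_qform hu) (hf.ae_qform_nonneg hu),
    normSqL2]

theorem iform_add_mat (hf : IsSpectralDensity f) (hg : IsSpectralDensity g) (hu : IsBddVec C u)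
    (hv : IsBddVec D v) : iform (fun lam => f lam + g lam) u v = iform f u v + iform g u v := by
  rw [iform, iform, iform, ← integral_add (hf.integrable_bform hu hv) (hg.integrable_bform hu hv)]
  refine integral_congr_ae ?_
  filter_upwards [hf.ae_isTracePos, hg.ae_isTracePos, hu.bound, hv.bound] with lam h h' h1 h2
  exact h.bform_add_mat h' h1.1 h2.1

theorem iq_add_mat (hf : IsSpectralDensity f) (hg : IsSpectralDensity g) (hu : IsBddVec C u) :
    iq (fun lam => f lam + g lam) u = iq f u + iq g u := by
  rw [(hf.add hg).iq_eq hu, hf.iq_eq hu, hg.iq_eq hu, hf.iform_add_mat hg hu hu, Complex.add_re]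

theorem iq_sub (hf : IsSpectralDensity f) (hu : IsBddVec C u) (hv : IsBddVec D v) :
    iq f (fun lam k => u lam k - v lam k) = iq f u + iq f v - 2 * (iform f u v).re := by
  have hi : Integrable (fun lam => (bform (f lam) (u lam) (v lam)).re) freqMeasure :=
    (hf.integrable_bform hu hv).re
  have e : (iform f u v).re = ∫ lam, (bform (f lam) (u lam) (v lam)).re ∂freqMeasure :=
    (integral_re (hf.integrable_bform hu hv)).symm
  have hs : Integrable (fun lam => qform (f lam) (u lam) + qform (f lam) (v lam)) freqMeasure :=
    (hf.integrable_qform hu).add (hf.integrable_qform hv)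
  rw [e, iq, iq, iq, ← integral_const_mul, ← integral_add (hf.integrable_qform hu)
    (hf.integrable_qform hv), ← integral_sub hs (hi.const_mul 2)]
  refine integral_congr_ae ?_
  filter_upwards [hf.ae_isTracePos, hu.bound, hv.bound] with lam h h1 h2
  exact h.qform_sub h1.1 h2.1

/-- The trace is an integrable majorant, so uniform bounds and almost everywhere convergence
suffice. Neither condition mentions the density, hence one approximating sequence serves all
densities. -/
theorem tendsto_iform (hf : IsSpectralDensity f) {U V : ℕ → ℝ → ℕ → ℂ}
    (hU : ∀ n, IsBddVec C (U n)) (hV : ∀ n, IsBddVec D (V n)) (hu : IsBddVec C u)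
    (hv : IsBddVec D v)
    (hUl : ∀ᵐ lam ∂freqMeasure, Tendsto (fun n => nsq fun k => U n lam k - u lam k) atTop (𝓝 0))
    (hVl : ∀ᵐ lam ∂freqMeasure, Tendsto (fun n => nsq fun k => V n lam k - v lam k) atTop (𝓝 0)) :
    Tendsto (fun n => iform f (U n) (V n)) atTop (𝓝 (iform f u v)) := by
  refine tendsto_integral_of_dominated_convergence (fun lam => rtr (f lam) * (√C * √D))
    (fun n => (hf.integrable_bform (hU n) (hV n)).1) (hf.integrable_rtr.mul_const _)
    (fun n => hf.ae_norm_bform_le (hU n) (hV n)) ?_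
  filter_upwards [hf.ae_isTracePos, hu.bound, hv.bound, hUl, hVl,
    ae_all_iff.2 fun n => (hU n).sqSum, ae_all_iff.2 fun n => (hV n).sqSum]
    with lam h h1 h2 h3 h4 h5 h6
  exact h.tendsto_bform h5 h6 h1.1 h2.1 h3 h4

end IsSpectralDensity

end Density

/-! ## Approximation by finite estimates -/

section Approximation

variable {f g : ℝ → Mat} {d τ : ℕ} {C : ℝ} {s : ℝ → ℕ → ℂ}

theorem isBddVec_polyVec_of_le {x : (ℕ × ℕ) →₀ ℂ} (h : ∀ lam, nsq (polyVec x lam) ≤ C) :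
    IsBddVec C (polyVec x) :=
  ⟨fun k => (continuous_polyVec x k).aestronglyMeasurable,
    Eventually.of_forall fun lam => ⟨sqSum_polyVec x lam, h lam⟩⟩

/-- Bounded causal functions are approximated by finite estimates in all forms at once. -/
theorem IsBddCausal.exists_polyChar (hs : IsBddCausal C s) (d τ : ℕ) :
    ∃ x : ℕ → ((ℕ × ℕ) →₀ ℂ), (∀ n, IsBddVec C (polyVec (x n))) ∧
      ∀ᵐ lam ∂freqMeasure, Tendsto (fun n => nsq fun k =>
        polyChar d τ (x n) lam k - incFactor d τ lam * s lam k) atTop (𝓝 0) := by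
  obtain ⟨x, h1, h2⟩ := hs.exists_poly
  refine ⟨x, fun n => isBddVec_polyVec_of_le (h1 n), ?_⟩
  filter_upwards [h2] with lam h
  have e : ∀ n, (nsq fun k => polyChar d τ (x n) lam k - incFactor d τ lam * s lam k) =
      ‖incFactor d τ lam‖ ^ 2 * nsq fun k => polyVec (x n) lam k - s lam k := fun n => by
    rw [← nsq_const_mul]
    congr 1
    funext k
    rw [polyChar_eq]; ring
  simp only [e]
  simpa using h.const_mul (‖incFactor d τ lam‖ ^ 2)

theorem IsSpectralDensity.tendsto_iq_polyChar (hf : IsSpectralDensity f) (hs : IsBddVec C s)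
    {x : ℕ → ((ℕ × ℕ) →₀ ℂ)} (hx : ∀ n, IsBddVec C (polyVec (x n)))
    (hl : ∀ᵐ lam ∂freqMeasure, Tendsto (fun n => nsq fun k =>
        polyChar d τ (x n) lam k - incFactor d τ lam * s lam k) atTop (𝓝 0)) :
    Tendsto (fun n => iq f fun lam k => incFactor d τ lam * s lam k - polyChar d τ (x n) lam k)
      atTop (𝓝 0) := by
  have hS := hs.inc d τ
  have hX := fun n => (hx n).inc d τ
  have h1 := hf.tendsto_iform hX hX hS hS hl hl
  have h2 := hf.tendsto_iform (fun _ => hS) hX hS hS (Eventually.of_forall fun lam => by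
    simp [nsq]) hl
  have h3 : Tendsto (fun n => iq f (fun lam k => incFactor d τ lam * s lam k) +
      iq f (polyChar d τ (x n)) - 2 * (iform f (fun lam k => incFactor d τ lam * s lam k)
        (polyChar d τ (x n))).re) atTop (𝓝 (iq f (fun lam k => incFactor d τ lam * s lam k) +
      iq f (fun lam k => incFactor d τ lam * s lam k) - 2 *
        (iform f (fun lam k => incFactor d τ lam * s lam k)
          (fun lam k => incFactor d τ lam * s lam k)).re)) := by
    refine (tendsto_const_nhds.add ?_).sub (((Complex.continuous_re.tendsto _).comp h2).const_mul 2)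
    rw [hf.iq_eq hS]
    refine ((Complex.continuous_re.tendsto _).comp h1).congr fun n => ?_
    exact (hf.iq_eq (hX n)).symm
  rw [hf.iq_eq hS, show ∀ a : ℝ, a + a - 2 * a = 0 from fun a => by ring, ← hf.iq_eq hS] at h3
  exact h3.congr fun n => (hf.iq_sub hS (hX n)).symm

/-- The density is arbitrary, and this is what places the optimal characteristic in H_D. -/
theorem IsBddCausal.memL20 (hs : IsBddCausal C s) (d τ : ℕ) (hf : IsSpectralDensity f) :
    MemL20 d τ f fun lam k => incFactor d τ lam * s lam k where
  measurable := (hs.toVec.inc d τ).aesm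
  vector := (hs.toVec.inc d τ).sqSum.mono fun _ h => memℓp_two_iff.2 h
  finite := by
    rw [hf.normSqL2_eq (hs.toVec.inc d τ)]
    exact ENNReal.ofReal_lt_top
  approx ε hε := by
    obtain ⟨x, h1, h2⟩ := hs.exists_polyChar d τ
    have h3 := ENNReal.tendsto_ofReal (hf.tendsto_iq_polyChar hs.toVec h1 h2)
    rw [ENNReal.ofReal_zero] at h3
    obtain ⟨n, hn⟩ := (h3.eventually_lt_const hε).exists
    refine ⟨x n, ?_⟩
    exact (hf.normSqL2_eq ((hs.toVec.inc d τ).sub ((h1 n).inc d τ))).trans_lt hn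

/-- A finite estimate close to h in L²(f+g) has error at most (1+δ) times that of h, plus a multiple
of the squared distance that depends on δ. The distance is sent to 0 first, then δ. Infinite error
of h is allowed. -/
theorem optMse_le_of_memL20 {b : ℕ → ℕ → ℂ} (hb : CoeffCondition b) (hf : IsSpectralDensity f)
    (hg : IsSpectralDensity g) {h : ℝ → ℕ → ℂ} (hh : MemL20 d τ (fun lam => f lam + g lam) h) :
    optMse d τ b f g ≤ mse d τ b h f g := by
  have hhs : ∀ᵐ lam ∂freqMeasure, SqSum (h lam) := hh.vector.mono fun _ h => memℓp_two_iff.1 h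
  have hB := hb.isBddCausal.toVec.inc d τ
  set c : ℝ≥0∞ := ENNReal.ofReal (1 / (2 * Real.pi)) with hc
  have key : ∀ δ : ℝ, 0 < δ → ∀ e : ℝ≥0∞, 0 < e → optMse d τ b f g ≤
      ENNReal.ofReal (1 + δ) * mse d τ b h f g + c * (ENNReal.ofReal (1 + 1 / δ) * e) := by
    intro δ hδ e he
    obtain ⟨x, hx⟩ := hh.approx e he
    refine (iInf_le _ x).trans ?_
    obtain ⟨Cx, hCx⟩ := exists_isBddVec_polyVec x
    have hX := hCx.inc d τ
    have hdiff : ∀ {φ : ℝ → Mat}, IsSpectralDensity φ → ∀ {p q : ℝ → ℕ → ℂ},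
        (∀ k, AEStronglyMeasurable (fun lam => p lam k) freqMeasure) →
        (∀ k, AEStronglyMeasurable (fun lam => q lam k) freqMeasure) →
        (∀ᵐ lam ∂freqMeasure, SqSum (p lam)) → (∀ᵐ lam ∂freqMeasure, SqSum (q lam)) →
        normSqL2 φ (fun lam k => p lam k + q lam k) ≤
          ENNReal.ofReal (1 + δ) * normSqL2 φ p + ENNReal.ofReal (1 + 1 / δ) * normSqL2 φ q := by
      intro φ hφ p q hp hq sp sq
      have m1 := (hφ.aesm_qform hp sp).aemeasurable.ennreal_ofReal
      have m2 := (hφ.aesm_qform hq sq).aemeasurable.ennreal_ofReal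
      unfold normSqL2
      rw [← lintegral_const_mul'' _ m1, ← lintegral_const_mul'' _ m2,
        ← lintegral_add_left' (m1.const_mul _)]
      refine lintegral_mono_ae ?_
      filter_upwards [hφ.ae_isTracePos, sp, sq] with lam h1 h2 h3
      have hd : 0 ≤ 1 / δ := by positivity
      rw [← ENNReal.ofReal_mul (by linarith), ← ENNReal.ofReal_mul (by linarith),
        ← ENNReal.ofReal_add (mul_nonneg (by linarith) (h1.qform_nonneg h2))
          (mul_nonneg (by linarith) (h1.qform_nonneg h3))]
      exact ENNReal.ofReal_le_ofReal (h1.qform_add_le h2 h3 hδ)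
    have hr : ∀ k, AEStronglyMeasurable (fun lam => h lam k - polyChar d τ x lam k) freqMeasure :=
      fun k => (hh.measurable k).sub (hX.aesm k)
    have hrs : ∀ᵐ lam ∂freqMeasure, SqSum fun k => h lam k - polyChar d τ x lam k := by
      filter_upwards [hhs, hX.sqSum] with lam h1 h2 using h1.sub h2
    have h1 : normSqL2 f (fun lam k => incFactor d τ lam * symbolB b lam k - polyChar d τ x lam k) ≤
        ENNReal.ofReal (1 + δ) *
          normSqL2 f (fun lam k => incFactor d τ lam * symbolB b lam k - h lam k) +
        ENNReal.ofReal (1 + 1 / δ) * normSqL2 f (fun lam k => h lam k - polyChar d τ x lam k) := by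
      have := hdiff hf (p := fun lam k => incFactor d τ lam * symbolB b lam k - h lam k)
        (q := fun lam k => h lam k - polyChar d τ x lam k)
        (fun k => (hB.aesm k).sub (hh.measurable k)) hr
        (by filter_upwards [hhs, hB.sqSum] with lam h1 h2 using h2.sub h1) hrs
      simpa only [sub_add_sub_cancel] using this
    have h2 : normSqL2 g (polyChar d τ x) ≤ ENNReal.ofReal (1 + δ) * normSqL2 g h +
        ENNReal.ofReal (1 + 1 / δ) * normSqL2 g (fun lam k => h lam k - polyChar d τ x lam k) := by
      have := hdiff hg (p := h) (q := fun lam k => -1 * (h lam k - polyChar d τ x lam k))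
        hh.measurable (fun k => (hr k).const_mul _) hhs
        (by filter_upwards [hrs] with lam h1 using h1.const_mul _)
      have e1 : (fun (lam : ℝ) (k : ℕ) => h lam k + -1 * (h lam k - polyChar d τ x lam k)) =
          polyChar d τ x := by funext lam k; ring
      have e2 : normSqL2 g (fun lam k => -1 * (h lam k - polyChar d τ x lam k)) =
          normSqL2 g (fun lam k => h lam k - polyChar d τ x lam k) := by
        refine lintegral_congr_ae ?_
        filter_upwards [hg.ae_isTracePos, hrs] with lam h1 h2
        rw [h1.qform_const_mul h2]; simp
      rwa [e1, e2] at this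
    have h3 : normSqL2 f (fun lam k => h lam k - polyChar d τ x lam k) +
        normSqL2 g (fun lam k => h lam k - polyChar d τ x lam k) ≤ e := by
      refine le_trans (le_of_eq ?_) hx.le
      unfold normSqL2
      rw [← lintegral_add_left' (hf.aesm_qform hr hrs).aemeasurable.ennreal_ofReal]
      refine lintegral_congr_ae ?_
      filter_upwards [hf.ae_isTracePos, hg.ae_isTracePos, hrs] with lam h1 h2 h3
      rw [h1.qform_add_mat h2 h3, ENNReal.ofReal_add (h1.qform_nonneg h3) (h2.qform_nonneg h3)]
    unfold mse
    rw [mul_left_comm, ← mul_add]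
    refine mul_le_mul_right ((add_le_add h1 h2).trans ?_) c
    rw [add_add_add_comm, ← mul_add, ← mul_add]
    exact add_le_add le_rfl (mul_le_mul_right h3 _)
  rcases eq_or_ne (mse d τ b h f g) ∞ with ht | ht
  · rw [ht]; exact le_top
  have key2 : ∀ δ : ℝ, 0 < δ →
      optMse d τ b f g ≤ ENNReal.ofReal (1 + δ) * mse d τ b h f g := by
    intro δ hδ
    refine ENNReal.le_of_forall_pos_le_add fun ε hε _ => ?_
    set K : ℝ≥0∞ := c * ENNReal.ofReal (1 + 1 / δ) with hK
    have hKt : K ≠ ∞ := ENNReal.mul_ne_top ENNReal.ofReal_ne_top ENNReal.ofReal_ne_top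
    have hε' : (ε : ℝ≥0∞) ≠ 0 := by exact_mod_cast hε.ne'
    refine (key δ hδ (ε / (K + 1)) (ENNReal.div_pos hε' (by simp [hKt]))).trans ?_
    refine add_le_add le_rfl ?_
    rw [← mul_assoc]
    refine (mul_le_mul_left (le_self_add : K ≤ K + 1) _).trans ?_
    exact ENNReal.mul_div_le
  have hl : Tendsto (fun δ : ℝ => ENNReal.ofReal (1 + δ) * mse d τ b h f g) (𝓝[>] 0)
      (𝓝 (mse d τ b h f g)) := by
    have h0 : Tendsto (fun δ : ℝ => 1 + δ) (𝓝[>] 0) (𝓝 1) := by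
      have : Tendsto (fun δ : ℝ => 1 + δ) (𝓝 0) (𝓝 (1 + 0)) := tendsto_const_nhds.add tendsto_id
      rw [add_zero] at this
      exact this.mono_left nhdsWithin_le_nhds
    have h1 := ENNReal.Tendsto.mul_const (ENNReal.tendsto_ofReal h0) (b := mse d τ b h f g)
      (Or.inr ht)
    simpa using h1
  refine ge_of_tendsto hl ?_
  filter_upwards [self_mem_nhdsWithin] with δ hδ using key2 δ hδ

end Approximation

/-! ## The optimal characteristic -/

section FormAlgebra

variable {f g : ℝ → Mat} {C D E : ℝ} {u v v' : ℝ → ℕ → ℂ}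

namespace IsSpectralDensity

theorem iform_add_right (hf : IsSpectralDensity f) (hu : IsBddVec C u) (hv : IsBddVec D v)
    (hv' : IsBddVec E v') :
    iform f u (fun lam k => v lam k + v' lam k) = iform f u v + iform f u v' := by
  rw [iform, iform, iform, ← integral_add (hf.integrable_bform hu hv) (hf.integrable_bform hu hv')]
  refine integral_congr_ae ?_
  filter_upwards [hf.ae_isTracePos, hu.sqSum, hv.sqSum, hv'.sqSum] with lam h h1 h2 h3
  exact h.bform_add_right h1 h2 h3

theorem iform_sub_left (hf : IsSpectralDensity f) (hv : IsBddVec D v) (hv' : IsBddVec E v')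
    (hu : IsBddVec C u) :
    iform f (fun lam k => v lam k - v' lam k) u = iform f v u - iform f v' u := by
  rw [iform, iform, iform, ← integral_sub (hf.integrable_bform hv hu) (hf.integrable_bform hv' hu)]
  refine integral_congr_ae ?_
  filter_upwards [hf.ae_isTracePos, hu.sqSum, hv.sqSum, hv'.sqSum] with lam h h1 h2 h3
  exact h.bform_sub_left h2 h3 h1

end IsSpectralDensity

theorem polyChar_eq_fun (d τ : ℕ) (x : (ℕ × ℕ) →₀ ℂ) :
    polyChar d τ x = fun lam k => incFactor d τ lam * polyVec x lam k := rfl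

theorem polyVec_zero (lam : ℝ) (k : ℕ) : polyVec 0 lam k = 0 := Finsupp.sum_zero_index

theorem polyVec_add (x y : (ℕ × ℕ) →₀ ℂ) (lam : ℝ) (k : ℕ) :
    polyVec (x + y) lam k = polyVec x lam k + polyVec y lam k := by
  refine Finsupp.sum_add_index' (fun i => by simp) fun i a b => ?_
  split_ifs
  · ring
  · simp

theorem polyVec_single (p : ℕ × ℕ) (c : ℂ) (lam : ℝ) (k : ℕ) :
    polyVec (Finsupp.single p c) lam k =
      c * Complex.exp (-(Complex.I * lam * p.2)) * if k = p.1 then 1 else 0 := by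
  rw [polyVec, Finsupp.sum_single_index (by simp)]
  by_cases h : p.1 = k
  · rw [if_pos h, if_pos h.symm, mul_one]
  · rw [if_neg h, if_neg (Ne.symm h), mul_zero]

theorem isBddCausal_polyVec {C : ℝ} {x : (ℕ × ℕ) →₀ ℂ} (h : IsBddVec C (polyVec x)) :
    IsBddCausal C (polyVec x) :=
  ⟨h.aesm, h.bound, fun k n hn => by rw [coef_polyVec, if_neg (by omega)]⟩

theorem IsBddCausal.sub {s t : ℝ → ℕ → ℂ} (hs : IsBddCausal C s) (ht : IsBddCausal D t) :
    IsBddCausal (2 * C + 2 * D) fun lam k => s lam k - t lam k where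
  aesm := (hs.toVec.sub ht.toVec).aesm
  bound := (hs.toVec.sub ht.toVec).bound
  coef_neg k n hn := by
    rw [coef_sub ((hs.l2Fam.memLp k).integrable (by norm_num))
      ((ht.l2Fam.memLp k).integrable (by norm_num)), hs.coef_neg k n hn, ht.coef_neg k n hn,
      sub_zero]

/-- Two forms that have the same nonnegative coefficients on the basis agree on causal
functions. -/
theorem iform_eq_of_coef {d τ : ℕ} (hf : IsSpectralDensity f) (hg : IsSpectralDensity g)
    (hu : IsBddVec C u) (hv : IsBddVec D v)
    (h : ∀ k n : ℕ, coef (fun lam => bform (f lam) (u lam)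
        fun l => incFactor d τ lam * if l = k then 1 else 0) n =
      coef (fun lam => bform (g lam) (v lam)
        fun l => incFactor d τ lam * if l = k then 1 else 0) n)
    {q : ℝ → ℕ → ℂ} (hq : IsBddCausal E q) :
    iform f u (fun lam k => incFactor d τ lam * q lam k) =
      iform g v (fun lam k => incFactor d τ lam * q lam k) := by
  -- By linearity monomials suffice. Pairing with a monomial of exponent n in the conjugated slot
  -- reads off the coefficient of index n, so only nonnegative indices occur.
  have hp : ∀ x : (ℕ × ℕ) →₀ ℂ, iform f u (polyChar d τ x) = iform g v (polyChar d τ x) := by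
    intro x
    induction x using Finsupp.induction_linear with
    | zero =>
      have : polyChar d τ 0 = fun _ _ => 0 := by
        funext lam k; rw [polyChar_eq, polyVec_zero, mul_zero]
      simp [this, iform, bform]
    | add x y hx hy =>
      obtain ⟨C₁, h1⟩ := exists_isBddVec_polyVec x
      obtain ⟨C₂, h2⟩ := exists_isBddVec_polyVec y
      have e : polyChar d τ (x + y) =
          fun lam k => incFactor d τ lam * polyVec x lam k + incFactor d τ lam * polyVec y lam k := by
        funext lam k; simp only [polyChar_eq, polyVec_add, mul_add]
      rw [e, hf.iform_add_right hu (h1.inc d τ) (h2.inc d τ),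
        hg.iform_add_right hv (h1.inc d τ) (h2.inc d τ)]
      exact congrArg₂ _ hx hy
    | single p c =>
      have key : ∀ (φ : ℝ → Mat) (z : ℝ → ℕ → ℂ), iform φ z (polyChar d τ (Finsupp.single p c)) =
          conj c * (2 * Real.pi * coef (fun lam => bform (φ lam) (z lam)
            fun l => incFactor d τ lam * if l = p.1 then 1 else 0) p.2) := by
        intro φ z
        have hpi : (Real.pi : ℂ) ≠ 0 := by exact_mod_cast Real.pi_ne_zero
        rw [coef, ← mul_assoc (2 * (Real.pi : ℂ)), mul_one_div_cancel (by simp [hpi]), one_mul,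
          ← integral_const_mul, iform]
        refine integral_congr_ae (Eventually.of_forall fun lam => ?_)
        dsimp only
        have e : polyChar d τ (Finsupp.single p c) lam = fun l =>
            (c * Complex.exp (-(Complex.I * lam * p.2))) *
              (incFactor d τ lam * if l = p.1 then 1 else 0) := by
          funext l; rw [polyChar_eq, polyVec_single]; ring
        rw [e, IsTracePos.bform_const_right, map_mul, ← Complex.exp_conj]
        simp only [map_neg, map_mul, Complex.conj_I, Complex.conj_ofReal, map_natCast]
        rw [show -(-Complex.I * (lam : ℂ) * (p.2 : ℂ)) = Complex.I * ((p.2 : ℤ) : ℂ) * lam by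
          push_cast; ring]
        ring
      rw [key, key, h]
  -- The same polynomials approximate q in both forms, so the identity passes to the limit.
  obtain ⟨x, h1, h2⟩ := hq.exists_polyChar d τ
  have hq' := hq.toVec.inc d τ
  have hX := fun n => (h1 n).inc d τ
  have l1 := hf.tendsto_iform (fun _ => hu) hX hu hq' (Eventually.of_forall fun lam => by
    simp [nsq]) h2
  have l2 := hg.tendsto_iform (fun _ => hv) hX hv hq' (Eventually.of_forall fun lam => by
    simp [nsq]) h2
  exact tendsto_nhds_unique (l1.congr fun n => hp (x n)) l2

theorem mse_eq {d τ : ℕ} {b : ℕ → ℕ → ℂ} (hb : CoeffCondition b) (hf : IsSpectralDensity f)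
    (hg : IsSpectralDensity g) {s : ℝ → ℕ → ℂ} (hs : IsBddVec C s) :
    mse d τ b (fun lam k => incFactor d τ lam * s lam k) f g =
      ENNReal.ofReal (1 / (2 * Real.pi) *
        (iq f (fun lam k => incFactor d τ lam * symbolB b lam k - incFactor d τ lam * s lam k) +
          iq g fun lam k => incFactor d τ lam * s lam k)) := by
  have h1 := (hb.isBddCausal.toVec.inc d τ).sub (hs.inc d τ)
  have h2 := hs.inc d τ
  rw [mse, hf.normSqL2_eq h1, hg.normSqL2_eq h2,
    ← ENNReal.ofReal_add (hf.iq_nonneg h1) (hg.iq_nonneg h2), ← ENNReal.ofReal_mul]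
  have := Real.pi_pos
  positivity

/-- Pythagoras' theorem for the mean square error. -/
theorem iq_error_eq {d τ : ℕ} {b : ℕ → ℕ → ℂ} (hb : CoeffCondition b) (hf : IsSpectralDensity f)
    (hg : IsSpectralDensity g) {s : ℝ → ℕ → ℂ} (hs : IsBddCausal C s)
    (h : ∀ {E : ℝ} {q : ℝ → ℕ → ℂ}, IsBddCausal E q →
      iform f (fun lam k => incFactor d τ lam * symbolB b lam k)
        (fun lam k => incFactor d τ lam * q lam k) =
      iform (fun lam => f lam + g lam) (fun lam k => incFactor d τ lam * s lam k)
        (fun lam k => incFactor d τ lam * q lam k))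
    {q : ℝ → ℕ → ℂ} (hq : IsBddCausal D q) :
    iq f (fun lam k => incFactor d τ lam * symbolB b lam k - incFactor d τ lam * q lam k) +
        iq g (fun lam k => incFactor d τ lam * q lam k) =
      (iq f (fun lam k => incFactor d τ lam * symbolB b lam k - incFactor d τ lam * s lam k) +
        iq g (fun lam k => incFactor d τ lam * s lam k)) +
      iq (fun lam => f lam + g lam)
        (fun lam k => incFactor d τ lam * s lam k - incFactor d τ lam * q lam k) := by
  have hB := hb.isBddCausal.toVec.inc d τ
  have hs' := hs.toVec.inc d τ
  have hq' := hq.toVec.inc d τ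
  have hF := hf.add hg
  -- The normal equations are tested on q and on s itself, which turns all products with B into
  -- products with s.
  rw [hf.iq_sub hB hq', hf.iq_sub hB hs', hF.iq_sub hs' hq', hf.iq_add_mat hg hs',
    hf.iq_add_mat hg hq', h hq, h hs, ← hF.iq_eq hs', hf.iq_add_mat hg hs']
  ring

/-- The orthogonality equations characterize the optimal estimate. -/
theorem isOptimalChar_of_orthogonal {d τ : ℕ} {b : ℕ → ℕ → ℂ} (hb : CoeffCondition b)
    (hf : IsSpectralDensity f) (hg : IsSpectralDensity g) {s : ℝ → ℕ → ℂ} (hs : IsBddCausal C s)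
    (h : ∀ {E : ℝ} {q : ℝ → ℕ → ℂ}, IsBddCausal E q →
      iform f (fun lam k => incFactor d τ lam * symbolB b lam k)
        (fun lam k => incFactor d τ lam * q lam k) =
      iform (fun lam => f lam + g lam) (fun lam k => incFactor d τ lam * s lam k)
        (fun lam k => incFactor d τ lam * q lam k)) :
    IsOptimalChar d τ b f g (fun lam k => incFactor d τ lam * s lam k) ∧
    ∀ x, mse d τ b (polyChar d τ x) f g =
      mse d τ b (fun lam k => incFactor d τ lam * s lam k) f g +
        ENNReal.ofReal (1 / (2 * Real.pi)) * normSqL2 (fun lam => f lam + g lam)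
          (fun lam k => incFactor d τ lam * s lam k - polyChar d τ x lam k) := by
  have hL := hs.memL20 d τ (hf.add hg)
  have hpi := Real.pi_pos
  have key : ∀ x, mse d τ b (polyChar d τ x) f g =
      mse d τ b (fun lam k => incFactor d τ lam * s lam k) f g +
        ENNReal.ofReal (1 / (2 * Real.pi)) * normSqL2 (fun lam => f lam + g lam)
          (fun lam k => incFactor d τ lam * s lam k - polyChar d τ x lam k) := by
    intro x
    obtain ⟨D, hD⟩ := exists_isBddVec_polyVec x
    have hd := (hs.toVec.inc d τ).sub (hD.inc d τ)
    have hB := (hb.isBddCausal.toVec.inc d τ).sub (hs.toVec.inc d τ)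
    rw [polyChar_eq_fun, mse_eq hb hf hg hD, mse_eq hb hf hg hs.toVec, (hf.add hg).normSqL2_eq hd, ← ENNReal.ofReal_mul (by positivity),
      ← ENNReal.ofReal_add (mul_nonneg (by positivity)
        (add_nonneg (hf.iq_nonneg hB) (hg.iq_nonneg (hs.toVec.inc d τ))))
        (mul_nonneg (by positivity) ((hf.add hg).iq_nonneg hd)), ← mul_add,
      iq_error_eq hb hf hg hs h (isBddCausal_polyVec hD)]
  refine ⟨⟨hL, le_antisymm (le_iInf fun x => ?_) (optMse_le_of_memL20 hb hf hg hL)⟩, key⟩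
  rw [key x]
  exact le_self_add

end FormAlgebra

/-! ### The normal equations in terms of the factors. -/

section Factored

variable {d τ : ℕ} {b : ℕ → ℕ → ℂ} {w : ℝ → ℂ} {M N : ℕ∞}

theorem tauFactor_l2Fam {Φ : ℝ → Matrix ℕ (Idx M) ℂ} {K : ℝ}
    (hΦ : L2Fam fun p : ℕ × Idx M => fun lam => Φ lam p.1 p.2)
    (hw : AEStronglyMeasurable w freqMeasure) (hK : ∀ᵐ x ∂freqMeasure, ‖w x‖ ^ 2 ≤ K) :
    L2Fam fun p : ℕ × Idx M => fun lam => tauFactor w Φ lam p.1 p.2 :=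
  hΦ.mul_bounded hw hK

theorem l2Fam_unit {F : ℝ → ℂ} (hF : MemLp F 2 freqMeasure) : L2Fam fun _ : Unit => F := by
  refine L2Fam.of_integrable_bound (fun _ => hF.1) hF.norm.integrable_sq
    (Eventually.of_forall fun lam => ⟨Summable.of_finite, ?_⟩)
  simp [nsq]

theorem tauFactor_isCausal {Φ : ℝ → Matrix ℕ (Idx M) ℂ} (cΦ : IsCausal Φ)
    (hΦτ : L2Fam fun p : ℕ × Idx M => fun lam => tauFactor w Φ lam p.1 p.2)
    (hw : IsWeightFactor d τ w) : IsCausal (tauFactor w Φ) := by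
  intro k i
  refine ⟨hΦτ.memLp (k, i), fun n => rfl, fun n hn => ?_⟩
  have := (l2Fam_unit hw.causal.memLp).coef_mul_neg (l2Fam_unit (cΦ k i).memLp)
    (fun _ => hw.causal.coef_neg) (fun _ => (cΦ k i).coef_neg) hn
  simp only [tsum_fintype, Finset.univ_unique, Finset.sum_singleton] at this
  exact this

/-- The vector `Ψ_τ^⊤ h`. -/
def charVec (w : ℝ → ℂ) (Ψ : ℝ → Matrix (Idx N) ℕ ℂ) (h : ℝ → Idx N → ℂ) (lam : ℝ) (k : ℕ) : ℂ :=
  ∑' i, tauInv w Ψ lam i k * h lam i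

/-- The vector `Ψ^⊤ h`. -/
def invVec (Ψ : ℝ → Matrix (Idx N) ℕ ℂ) (h : ℝ → Idx N → ℂ) (lam : ℝ) (k : ℕ) : ℂ :=
  ∑' i, Ψ lam i k * h lam i

theorem charVec_eq (w : ℝ → ℂ) (Ψ : ℝ → Matrix (Idx N) ℕ ℂ) (h : ℝ → Idx N → ℂ) (lam : ℝ)
    (k : ℕ) : charVec w Ψ h lam k = (w lam)⁻¹ * invVec Ψ h lam k := by
  rw [charVec, invVec, ← tsum_mul_left]
  exact tsum_congr fun i => by rw [tauInv, Matrix.smul_apply, smul_eq_mul, mul_assoc]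

variable {f F : ℝ → Mat} {G : ℝ → Mat} {Φ : ℝ → Matrix ℕ (Idx M) ℂ}
  {Θ : ℝ → Matrix ℕ (Idx N) ℂ} {Ψ : ℝ → Matrix (Idx N) ℕ ℂ} {h : ℝ → Idx N → ℂ} {C : ℝ}

/-- Each entry pairs a causal square integrable column of Ψ_τ with the causal h, so it is causal.
Here h is square integrable as a family because h = Θ^⊤ u with u bounded. The bound on Ψ_τ^⊤ h = w⁻¹
u comes from the lower bound on the weight. -/
theorem charVec_isBddCausal (hτ : 0 < τ) (hw : IsWeightFactor d τ w)
    (hΘ : IsCanonicalFactorization F Θ) (hΨ : IsInverseFactorization w Θ Ψ G)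
    (hmin : MinimalityCondition d τ G) (hm : ∀ i, MemLp (fun lam => h lam i) 2 freqMeasure)
    (hc : ∀ i, ∀ n : ℤ, n < 0 → coef (fun lam => h lam i) n = 0)
    (hu : ∀ᵐ lam ∂freqMeasure, SqSum (invVec Ψ h lam) ∧ nsq (invVec Ψ h lam) ≤ C ∧
      ∀ i, h lam i = tmul (Θ lam) (invVec Ψ h lam) i) :
    ∃ D, IsBddCausal D (charVec w Ψ h) := by
  obtain ⟨K, hK, hKb⟩ := hΨ.weight_bounds hτ hw hΘ
  have hh : L2Fam fun i lam => h lam i := by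
    refine L2Fam.of_integrable_bound (fun i => (hm i).1)
      (hΘ.l2Fam.integrable_nsq.mul_const C) ?_
    filter_upwards [hu, hΘ.l2Fam.ae_isHS] with lam h1 h2
    have h3 := h2.tmul h1.1
    have e : (fun i => h lam i) = tmul (Θ lam) (invVec Ψ h lam) := funext h1.2.2
    rw [e]
    exact ⟨h3.1, h3.2.trans (mul_le_mul_of_nonneg_left h1.2.1 (nsq_nonneg _))⟩
  refine ⟨K * C, fun k => ?_, ?_, fun k n hn => ?_⟩
  · have := ((hΨ.l2Fam_col hw hmin k).integrable_tsum hh.star).1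
    simp only [Complex.conj_conj] at this
    exact this
  · filter_upwards [hu, hKb] with lam h1 h2
    have e : charVec w Ψ h lam = fun k => (w lam)⁻¹ * invVec Ψ h lam k :=
      funext fun k => charVec_eq w Ψ h lam k
    rw [e, nsq_const_mul]
    exact ⟨h1.1.const_mul _, mul_le_mul h2.2.1 h1.2.1 (nsq_nonneg _) hK.le⟩
  · exact (hΨ.l2Fam_col hw hmin k).coef_mul_neg hh
      (fun i n hn => (hΨ.causal_tau i k).coef_neg n hn) hc hn

theorem tmul_indicator {ι : Type*} (A : Matrix ℕ ι ℂ) (c : ℂ) (k : ℕ) (i : ι) :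
    tmul A (fun l => c * if l = k then 1 else 0) i = c * A k i := by
  rw [tmul, tsum_eq_single k fun l hl => by rw [if_neg hl]; simp]
  simp

theorem sqSum_indicator (c : ℂ) (k : ℕ) : SqSum fun l : ℕ => c * if l = k then (1 : ℂ) else 0 :=
  SqSum.const_mul (summable_of_ne_finset_zero (s := {k}) fun l hl => by
    rw [if_neg (by simpa using hl)]; simp) c

theorem tmul_smul {ι : Type*} (A : Matrix ℕ ι ℂ) (c : ℂ) (v : ℕ → ℂ) (i : ι) :
    tmul (c • A) v i = c * tmul A v i := by
  rw [tmul, tmul, ← tsum_mul_left]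
  exact tsum_congr fun k => by rw [Matrix.smul_apply, smul_eq_mul]; ring

/-- The causal equation between `f` and the vector `Ψ_τ^⊤ h`. -/
theorem coef_bform_charVec (hτ : 0 < τ) (hb : CoeffCondition b) (hw : IsWeightFactor d τ w)
    (hf : IsSpectralDensity f) (hF : IsSpectralDensity F)
    (hle : ∀ᵐ lam ∂freqMeasure, ∀ v, SqSum v → qform (f lam) v ≤ qform (F lam) v)
    (hΦ : IsCanonicalFactorization f Φ) (hΘ : IsCanonicalFactorization F Θ)
    (hΨ : IsInverseFactorization w Θ Ψ G) (hop : IsL2Operator (matCoef (tauFactor w Φ)))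
    (hh : IsPsiCSeries (matCoef (tauInv w Ψ)) (matCoef (tauFactor w Φ)) b h)
    (hu : ∀ᵐ lam ∂freqMeasure, SqSum (invVec Ψ h lam) ∧
      ∀ i, h lam i = tmul (Θ lam) (invVec Ψ h lam) i) (k n : ℕ) :
    coef (fun lam => bform (f lam) (fun l => incFactor d τ lam * symbolB b lam l)
        fun l => incFactor d τ lam * if l = k then 1 else 0) n =
      coef (fun lam => bform (F lam) (fun l => incFactor d τ lam * charVec w Ψ h lam l)
        fun l => incFactor d τ lam * if l = k then 1 else 0) n := by
  obtain ⟨K, hK, hKb⟩ := hΨ.weight_bounds hτ hw hΘ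
  have hwK : ∀ᵐ x ∂freqMeasure, ‖w x‖ ^ 2 ≤ K := hKb.mono fun _ h => h.1
  have lΦ := tauFactor_l2Fam hΦ.l2Fam hw.aesm hwK
  have lΘ := tauFactor_l2Fam hΘ.l2Fam hw.aesm hwK
  have hI : ∀ᵐ lam ∂freqMeasure, IsInversePair (tauFactor w Θ lam) (tauInv w Ψ lam) := by
    filter_upwards [hΨ.ae_isInversePair hτ hw hΘ, hKb] with lam h1 h2
    exact h1.smul h2.2.2.1
  -- The inequality f ≤ F between forms becomes domination of the factors, and the common scalar w
  -- does not affect it.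
  have hdom : ∀ᵐ lam ∂freqMeasure, ∀ v, SqSum v →
      nsq (tmul (tauFactor w Φ lam) v) ≤ nsq (tmul (tauFactor w Θ lam) v) := by
    filter_upwards [hle, hΦ.factor, hΘ.factor, hΦ.l2Fam.ae_isHS, hΘ.l2Fam.ae_isHS,
      hf.ae_isTracePos, hF.ae_isTracePos] with lam h1 h2 h3 h4 h5 h6 h7 v hv
    have := h1 v hv
    rw [qform_of_factor h6 h4 h2 hv, qform_of_factor h7 h5 h3 hv] at this
    have e : ∀ {L : ℕ∞} (A : ℝ → Matrix ℕ (Idx L) ℂ), tmul (tauFactor w A lam) v =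
        fun i => w lam * tmul (A lam) v i := fun A => funext fun i => tmul_smul _ _ _ _
    rw [e, e, nsq_const_mul, nsq_const_mul]
    exact mul_le_mul_of_nonneg_left this (sq_nonneg _)
  have key := coef_causal_part_eq hb lΦ (tauFactor_isCausal hΦ.causal lΦ hw) hop lΘ
    (tauFactor_isCausal hΘ.causal lΘ hw) hΨ.l2Fam_row hΨ.causal_tau hI hdom hh k n
  -- β is the factor in the observations and w is the causal factor in Φ_τ. They have equal modulus,
  -- so β conj β may replace w conj w.
  have hww : ∀ {x : ℝ}, ‖incFactor d τ x‖ = ‖w x‖ →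
      incFactor d τ x * conj (incFactor d τ x) = w x * conj (w x) := fun {x} hx => by
    rw [Complex.mul_conj', Complex.mul_conj', hx]
  have e1 : coef (fun lam => ∑' p, tmul (tauFactor w Φ lam) (symbolB b lam) p *
      conj (tauFactor w Φ lam k p)) n =
      coef (fun lam => bform (f lam) (fun l => incFactor d τ lam * symbolB b lam l)
        fun l => incFactor d τ lam * if l = k then 1 else 0) n := by
    refine coef_congr ?_ n
    filter_upwards [hKb, hΦ.factor, hΦ.l2Fam.ae_isHS, hf.ae_isTracePos] with lam h1 h2 h3 h4
    rw [bform_of_factor h4 h3 h2 ((hb.sqSum_symbolB lam).1.const_mul _) (sqSum_indicator _ _)]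
    refine tsum_congr fun p => ?_
    rw [tmul_const_mul, tmul_indicator, tauFactor, tmul_smul, Matrix.smul_apply, smul_eq_mul,
      map_mul, map_mul, mul_mul_mul_comm, ← hww h1.2.2.2.2]
    ring
  have e2 : coef (fun lam => ∑' i, h lam i * conj (tauFactor w Θ lam k i)) n =
      coef (fun lam => bform (F lam) (fun l => incFactor d τ lam * charVec w Ψ h lam l)
        fun l => incFactor d τ lam * if l = k then 1 else 0) n := by
    refine coef_congr ?_ n
    filter_upwards [hKb, hΘ.factor, hΘ.l2Fam.ae_isHS, hF.ae_isTracePos, hu] with lam h1 h2 h3 h4 h5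
    have e : (fun l => incFactor d τ lam * charVec w Ψ h lam l) =
        fun l => (incFactor d τ lam * (w lam)⁻¹) * invVec Ψ h lam l :=
      funext fun l => by rw [charVec_eq, mul_assoc]
    rw [e, bform_of_factor h4 h3 h2 (h5.1.const_mul _) (sqSum_indicator _ _)]
    refine tsum_congr fun i => ?_
    rw [tmul_const_mul, tmul_indicator, ← h5.2 i, tauFactor, Matrix.smul_apply, smul_eq_mul,
      map_mul, map_mul]
    have hc : incFactor d τ lam * (w lam)⁻¹ * conj (incFactor d τ lam) = conj (w lam) := by
      rw [mul_right_comm, hww h1.2.2.2.2]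
      field_simp [h1.2.2.1]
    linear_combination (-(h lam i) * conj (Θ lam k i)) * hc
  rw [← e1, ← e2, key]

end Factored

/-! ## Bounded matrices and rank one forms -/

section RankOne

theorem BoundedBy.outer {x : ℕ → ℂ} (hx : SqSum x) : BoundedBy (outer x) (nsq x ^ 2) := by
  refine ⟨sq_nonneg _, fun s t a c => ?_⟩
  have hsum : ∀ (s : Finset ℕ) (a y : ℕ → ℂ), SqSum y →
      ‖∑ k ∈ s, a k * y k‖ ^ 2 ≤ nsq y * ∑ k ∈ s, ‖a k‖ ^ 2 := fun s a y hy => by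
    rw [← tsum_trunc_mul s a y, ← nsq_trunc, mul_comm (nsq y)]
    exact norm_tsum_mul_sq_le (SqSum.trunc s a) hy
  have e : ∑ k ∈ s, ∑ l ∈ t, a k * PCFilter.outer x k l * c l =
      (∑ k ∈ s, a k * x k) * ∑ l ∈ t, c l * conj (x l) := by
    rw [Finset.sum_mul_sum]
    exact Finset.sum_congr rfl fun k _ => Finset.sum_congr rfl fun l _ => by
      rw [PCFilter.outer]; ring
  rw [e, norm_mul, mul_pow]
  have h1 := hsum s a x hx
  have h2 := hsum t c (fun l => conj (x l)) hx.conj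
  rw [nsq_conj] at h2
  calc _ ≤ (nsq x * ∑ k ∈ s, ‖a k‖ ^ 2) * (nsq x * ∑ k ∈ t, ‖c k‖ ^ 2) :=
        mul_le_mul h1 h2 (sq_nonneg _) ((sq_nonneg _).trans h1)
    _ = _ := by ring

theorem BoundedBy.diagonal {c : ℕ → ℂ} {K : ℝ} (hc : ∀ k, ‖c k‖ ≤ K) :
    BoundedBy (Matrix.diagonal c) (K ^ 2) := by
  refine ⟨sq_nonneg _, fun s t x y => ?_⟩
  have e : ∑ k ∈ s, ∑ l ∈ t, x k * Matrix.diagonal c k l * y l =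
      ∑' k, trunc s x k * (c k * trunc t y k) := by
    rw [tsum_trunc_mul]
    refine Finset.sum_congr rfl fun k _ => ?_
    by_cases hk : k ∈ t
    · rw [Finset.sum_eq_single_of_mem k hk fun l _ hl => by
        rw [Matrix.diagonal_apply_ne _ (Ne.symm hl)]; ring, Matrix.diagonal_apply_eq, trunc,
        if_pos hk]
      ring
    · rw [trunc, if_neg hk]
      refine (Finset.sum_eq_zero fun l hl => ?_).trans (by ring)
      rw [Matrix.diagonal_apply_ne _ (fun h => hk (by rw [h]; exact hl))]; ring
  have hm : ∀ k, ‖c k * trunc t y k‖ ≤ ‖(K : ℂ) * trunc t y k‖ := fun k => by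
    rw [norm_mul, norm_mul]
    refine mul_le_mul_of_nonneg_right ((hc k).trans ?_) (norm_nonneg _)
    rw [Complex.norm_real]
    exact le_abs_self K
  have hs : SqSum fun k => (K : ℂ) * trunc t y k := (SqSum.trunc t y).const_mul _
  rw [e]
  refine (norm_tsum_mul_sq_le (SqSum.trunc s x) (hs.mono hm)).trans ?_
  rw [nsq_trunc]
  refine (mul_le_mul_of_nonneg_left (nsq_mono hs hm)
    (Finset.sum_nonneg fun _ _ => by positivity)).trans_eq ?_
  rw [nsq_const_mul, nsq_trunc, Complex.norm_real, Real.norm_eq_abs, sq_abs]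
  ring

theorem BoundedBy.transpose {A : Mat} {C : ℝ} (h : BoundedBy A C) : BoundedBy A.transpose C := by
  refine ⟨h.1, fun s t x y => ?_⟩
  have := h.2 t s y x
  rw [Finset.sum_comm] at this
  calc _ = ‖∑ k ∈ s, ∑ l ∈ t, y l * A l k * x k‖ ^ 2 := by
        congr 2
        exact Finset.sum_congr rfl fun k _ => Finset.sum_congr rfl fun l _ => by
          rw [Matrix.transpose_apply]; ring
    _ ≤ _ := this
    _ = _ := by ring

theorem BoundedBy.smul {A : Mat} {C : ℝ} (h : BoundedBy A C) (c : ℂ) :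
    BoundedBy (c • A) (‖c‖ ^ 2 * C) := by
  refine ⟨mul_nonneg (sq_nonneg _) h.1, fun s t x y => ?_⟩
  have e : ∑ k ∈ s, ∑ l ∈ t, x k * (c • A) k l * y l =
      c * ∑ k ∈ s, ∑ l ∈ t, x k * A k l * y l := by
    simp only [Finset.mul_sum]
    exact Finset.sum_congr rfl fun k _ => Finset.sum_congr rfl fun l _ => by
      rw [Matrix.smul_apply, smul_eq_mul]; ring
  rw [e, norm_mul, mul_pow, mul_assoc, mul_assoc]
  exact mul_le_mul_of_nonneg_left ((h.2 s t x y).trans_eq (mul_assoc _ _ _)) (sq_nonneg _)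

theorem BoundedBy.add {A B : Mat} {C D : ℝ} (h : BoundedBy A C) (h' : BoundedBy B D) :
    BoundedBy (A + B) (2 * C + 2 * D) := by
  refine ⟨by linarith [h.1, h'.1], fun s t x y => ?_⟩
  have e : ∑ k ∈ s, ∑ l ∈ t, x k * (A + B) k l * y l =
      ∑ k ∈ s, ∑ l ∈ t, x k * A k l * y l + ∑ k ∈ s, ∑ l ∈ t, x k * B k l * y l := by
    simp only [← Finset.sum_add_distrib]
    exact Finset.sum_congr rfl fun k _ => Finset.sum_congr rfl fun l _ => by
      rw [Matrix.add_apply]; ring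
  rw [e]
  refine (norm_add_sq_le_two _ _).trans ?_
  linarith [h.2 s t x y, h'.2 s t x y]

variable {A : Mat} {u x : ℕ → ℂ}

theorem bform_congr_outer (h : ∀ k l, u k * conj (u l) = x k * conj (x l)) (A : Mat) :
    bform A u u = bform A x x :=
  tsum_congr fun p => by linear_combination (A p.1 p.2) * h p.1 p.2

/-- A rank one matrix is not a nonzero multiple of the identity; the first two coordinates already
show this. -/
theorem eq_zero_of_outer_eq_smul_one {c : ℂ} (h : ∀ k l, u k * conj (u l) = (c • (1 : Mat)) k l) :
    ∀ k, u k = 0 := by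
  have h1 : ∀ k, u k * conj (u k) = c := fun k => by rw [h]; simp
  have h2 : u 0 * conj (u 1) = 0 := by rw [h]; simp
  have hc : c = 0 := by
    rcases mul_eq_zero.1 h2 with h3 | h3
    · rw [← h1 0, h3, zero_mul]
    · rw [← h1 1, h3, mul_zero]
  intro k
  have := h1 k
  rw [hc, Complex.mul_conj'] at this
  simpa using this

theorem norm_sq_of_outer {a : ℝ} {k : ℕ} (h : u k * conj (u k) = (a : ℂ)) : ‖u k‖ ^ 2 = a := by
  rw [Complex.mul_conj'] at h
  exact_mod_cast h

/-- A rank one diagonal matrix has at most one nonzero entry, so the squared norm of u is a single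
c_k. -/
theorem nsq_le_of_outer_eq_diagonal {c : ℕ → ℝ} {K : ℝ} (hK : 0 ≤ K) (hc : ∀ k, c k ≤ K)
    (h : ∀ k l, u k * conj (u l) = Matrix.diagonal (fun k => (c k : ℂ)) k l) : nsq u ≤ K := by
  by_cases h0 : ∀ k, u k = 0
  · rw [show u = fun _ => 0 from funext h0, nsq_zero]; exact hK
  · push Not at h0
    obtain ⟨k, hk⟩ := h0
    have h1 : ∀ l, l ≠ k → u l = 0 := fun l hl => by
      have := h k l
      rw [Matrix.diagonal_apply_ne _ (Ne.symm hl)] at this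
      simpa [hk] using this
    rw [nsq, tsum_eq_single k fun l hl => by simp [h1 l hl]]
    have := h k k
    rw [Matrix.diagonal_apply_eq] at this
    rw [norm_sq_of_outer this]
    exact hc k

theorem IsTracePos.qform_of_diagonal (hA : IsTracePos A) {c : ℕ → ℝ}
    (h : ∀ k l, u k * conj (u l) = Matrix.diagonal (fun k => (c k : ℂ)) k l) :
    qform A u = ∑' k, c k * (A k k).re := by
  rw [qform]
  have e : ∀ k, ∑' l, u k * A k l * conj (u l) = ((c k * (A k k).re : ℝ) : ℂ) := fun k => by
    rw [tsum_eq_single k fun l hl => by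
      rw [mul_right_comm, h, Matrix.diagonal_apply_ne _ (Ne.symm hl), zero_mul], mul_right_comm, h,
      Matrix.diagonal_apply_eq, hA.posSemidef.diag_eq_re k]
    simp
  simp only [e]
  rw [← Complex.ofReal_tsum, Complex.ofReal_re]

theorem IsTracePos.summable_diag_mul (hA : IsTracePos A) {c : ℕ → ℝ} {K : ℝ}
    (hc : ∀ k, |c k| ≤ K) : Summable fun k => c k * (A k k).re :=
  Summable.of_norm_bounded (hA.summable.mul_left K) fun k => by
    rw [Real.norm_eq_abs, abs_mul, abs_of_nonneg (hA.posSemidef.diag_re_nonneg k)]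
    exact mul_le_mul_of_nonneg_right (hc k) (hA.posSemidef.diag_re_nonneg k)

/-- For a rank one form, the pairing is the quadratic form. -/
theorem IsTracePos.bform_eq_conj_pairing (hA : IsTracePos A) (hu : SqSum u) {B : Mat}
    (hB : B.PosSemidef) {c : ℝ} (h : ∀ k l, u k * conj (u l) = c * B l k) :
    bform A u u = c * conj (pairing B A) := by
  rw [hA.bform_eq hu hu, pairing, Complex.conj_tsum, ← tsum_mul_left]
  refine tsum_congr fun k => ?_
  rw [Complex.conj_tsum, ← tsum_mul_left]
  refine tsum_congr fun l => ?_
  rw [map_mul, Complex.conj_conj, hB.conj_entry k l]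
  linear_combination (A k l) * h k l

/-- The matrix x x* - u u* is positive semidefinite. Its diagonal gives |u_k| ≤ |x_k|, and its 2×2
minors equal -|x_k u_l - x_l u_k|², so u is proportional to x. -/
theorem exists_smul_of_outer_le {Γ : Mat} (hΓ : (-Γ).PosSemidef)
    (h : ∀ k l, u k * conj (u l) = x k * conj (x l) + Γ k l) :
    (∀ k, ‖u k‖ ≤ ‖x k‖) ∧ ∃ c : ℂ, ‖c‖ ≤ 1 ∧ u = fun k => c * x k := by
  have hd : ∀ k, ((-Γ) k k).re = ‖x k‖ ^ 2 - ‖u k‖ ^ 2 := fun k => by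
    have h1 := h k k
    rw [Complex.mul_conj', Complex.mul_conj'] at h1
    have h2 : (-Γ) k k = ((‖x k‖ ^ 2 - ‖u k‖ ^ 2 : ℝ) : ℂ) := by
      rw [Matrix.neg_apply]; push_cast; linear_combination h1
    rw [h2, Complex.ofReal_re]
  have hle : ∀ k, ‖u k‖ ≤ ‖x k‖ := fun k => by
    have := hΓ.diag_re_nonneg k
    rw [hd] at this
    exact abs_le_of_sq_le_sq' (by linarith) (norm_nonneg _) |>.2
  have hcross : ∀ k l, x k * u l = x l * u k := fun k l => by
    have h1 := hΓ.norm_sq_le k l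
    have h2 : (-Γ) k l = x k * conj (x l) - u k * conj (u l) := by
      rw [Matrix.neg_apply, h]; ring
    rw [hd, hd, h2] at h1
    have h3 : ‖x k * u l - x l * u k‖ ^ 2 ≤ 0 := by
      simp only [Complex.sq_norm, Complex.normSq_apply, Complex.sub_re, Complex.sub_im,
        Complex.mul_re, Complex.mul_im, Complex.conj_re, Complex.conj_im] at h1 ⊢
      linarith
    have h4 : ‖x k * u l - x l * u k‖ = 0 := by
      have := sq_nonneg ‖x k * u l - x l * u k‖
      exact pow_eq_zero_iff (two_ne_zero) |>.1 (le_antisymm h3 this)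
    exact sub_eq_zero.1 (norm_eq_zero.1 h4)
  refine ⟨hle, ?_⟩
  by_cases h0 : ∀ k, x k = 0
  · refine ⟨0, by simp, funext fun k => ?_⟩
    have := hle k
    rw [h0 k, norm_zero] at this
    simpa using this
  · push Not at h0
    obtain ⟨k, hk⟩ := h0
    refine ⟨u k / x k, ?_, funext fun l => ?_⟩
    · rw [norm_div]
      exact div_le_one_of_le₀ (hle k) (norm_nonneg _)
    · have := hcross k l
      field_simp
      linear_combination this

theorem IsTracePos.bform_lincomb {B D : Mat} (hB : IsTracePos B) (hD : IsTracePos D) {a c : ℂ}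
    (h : ∀ k l, A k l = a * B k l + c * D k l) (hu : SqSum u) :
    bform A u u = a * bform B u u + c * bform D u u := by
  have h1 := (hB.summable_bform hu hu).mul_left a
  have h2 := (hD.summable_bform hu hu).mul_left c
  rw [bform, bform, bform, ← tsum_mul_left, ← tsum_mul_left, ← h1.tsum_add h2]
  exact tsum_congr fun p => by rw [h]; ring

theorem IsTracePos.qform_lincomb {B D : Mat} (hA : IsTracePos A) (hB : IsTracePos B)
    (hD : IsTracePos D) {a c : ℝ} (h : ∀ k l, A k l = a * B k l + c * D k l) (hu : SqSum u) :
    qform A u = a * qform B u + c * qform D u := by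
  rw [hA.qform_eq hu, hB.qform_eq hu, hD.qform_eq hu, hB.bform_lincomb hD h hu]
  simp

end RankOne

/-! ## Averages over the classes -/

section Averages

variable {f g : ℝ → Mat}

theorem integral_eq_of_avg {F : ℝ → ℂ} {c : ℂ} (h : avg F = c) :
    ∫ lam, F lam ∂freqMeasure = 2 * Real.pi * c := by
  have hpi : (Real.pi : ℂ) ≠ 0 := by exact_mod_cast Real.pi_ne_zero
  rw [← h, avg]
  field_simp

theorem IsSpectralDensity.integrable_entry (hf : IsSpectralDensity f) (k l : ℕ) :
    Integrable (fun lam => f lam k l) freqMeasure := by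
  refine (hf.integrable_rtr.const_mul 2).mono' (hf.measurable k l) ?_
  filter_upwards [hf.ae_isTracePos] with lam h
  have h1 : ∀ k, (f lam k k).re ≤ rtr (f lam) := fun k =>
    h.summable.le_tsum k fun j _ => h.posSemidef.diag_re_nonneg j
  linarith [h.posSemidef.norm_le_half k l, h1 k, h1 l]

theorem isBddVec_const {x : ℕ → ℂ} {K : ℝ} (hx : SqSum x) (hK : nsq x ≤ K) :
    IsBddVec K fun _ => x :=
  ⟨fun _ => aestronglyMeasurable_const, Eventually.of_forall fun _ => ⟨hx, hK⟩⟩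

/-- For a finitely supported constant vector the integrated form is a finite combination of
integrated entries. Truncation and `tendsto_iform` extend this to ℓ². -/
theorem iform_const_congr (hf : IsSpectralDensity f) (hg : IsSpectralDensity g)
    (h : ∀ k l, ∫ lam, f lam k l ∂freqMeasure = ∫ lam, g lam k l ∂freqMeasure) {x : ℕ → ℂ}
    (hx : SqSum x) : iform f (fun _ => x) (fun _ => x) = iform g (fun _ => x) (fun _ => x) := by
  have hfin : ∀ {φ : ℝ → Mat}, IsSpectralDensity φ → ∀ s : Finset ℕ,
      iform φ (fun _ => trunc s x) (fun _ => trunc s x) =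
        ∑ k ∈ s, ∑ l ∈ s, x k * conj (x l) * ∫ lam, φ lam k l ∂freqMeasure := by
    intro φ hφ s
    have hi : ∀ k l, Integrable (fun lam => x k * conj (x l) * φ lam k l) freqMeasure :=
      fun k l => (hφ.integrable_entry k l).const_mul _
    have e : ∑ k ∈ s, ∑ l ∈ s, x k * conj (x l) * ∫ lam, φ lam k l ∂freqMeasure =
        ∫ lam, ∑ k ∈ s, ∑ l ∈ s, x k * conj (x l) * φ lam k l ∂freqMeasure := by
      rw [integral_finsetSum _ fun k _ => integrable_finsetSum _ fun l _ => hi k l]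
      refine Finset.sum_congr rfl fun k _ => ?_
      rw [integral_finsetSum _ fun l _ => hi k l]
      exact Finset.sum_congr rfl fun l _ => (integral_const_mul _ _).symm
    rw [e]
    refine integral_congr_ae ?_
    filter_upwards [hφ.ae_isTracePos] with lam h
    rw [h.bform_eq (SqSum.trunc s x) (SqSum.trunc s x)]
    rw [tsum_eq_sum (s := s) fun k hk => by simp [trunc, hk]]
    refine Finset.sum_congr rfl fun k hk => ?_
    rw [tsum_eq_sum (s := s) fun l hl => by simp [trunc, hl]]
    refine Finset.sum_congr rfl fun l hl => ?_
    rw [trunc, trunc, if_pos hk, if_pos hl]; ring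
  have hlim : ∀ {φ : ℝ → Mat}, IsSpectralDensity φ →
      Tendsto (fun n => iform φ (fun _ => trunc (Finset.range n) x)
        (fun _ => trunc (Finset.range n) x)) atTop (𝓝 (iform φ (fun _ => x) (fun _ => x))) := by
    intro φ hφ
    have h1 := fun n : ℕ => isBddVec_const (SqSum.trunc (Finset.range n) x) (nsq_trunc_le hx _)
    have h2 := isBddVec_const hx le_rfl
    have h3 : ∀ᵐ _ ∂freqMeasure, Tendsto (fun n : ℕ => nsq fun k =>
        trunc (Finset.range n) x k - x k) atTop (𝓝 0) :=
      Eventually.of_forall fun _ => (tendsto_nsq_trunc_sub hx).comp tendsto_finset_range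
    exact hφ.tendsto_iform h1 h1 h2 h2 h3 h3
  refine tendsto_nhds_unique (hlim hf) ((hlim hg).congr fun n => ?_)
  rw [hfin hf, hfin hg]
  simp only [h]

theorem IsSpectralDensity.ae_abs_weighted_le (hf : IsSpectralDensity f) {c : ℕ → ℝ} {K : ℝ}
    (hc : ∀ k, |c k| ≤ K) :
    ∀ᵐ lam ∂freqMeasure, ‖∑' k, c k * (f lam k k).re‖ ≤ K * rtr (f lam) := by
  filter_upwards [hf.ae_isTracePos] with lam h
  rw [rtr, ← tsum_mul_left]
  refine tsum_of_norm_bounded (h.summable.mul_left K).hasSum fun k => ?_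
  rw [Real.norm_eq_abs, abs_mul, abs_of_nonneg (h.posSemidef.diag_re_nonneg k)]
  exact mul_le_mul_of_nonneg_right (hc k) (h.posSemidef.diag_re_nonneg k)

theorem IsSpectralDensity.integrable_weighted (hf : IsSpectralDensity f) {c : ℕ → ℝ} {K : ℝ}
    (hc : ∀ k, |c k| ≤ K) : Integrable (fun lam => ∑' k, c k * (f lam k k).re) freqMeasure := by
  refine (hf.integrable_rtr.const_mul K).mono' ?_ (hf.ae_abs_weighted_le hc)
  refine aestronglyMeasurable_of_tendsto_ae (atTop : Filter (Finset ℕ))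
    (f := fun s lam => ∑ k ∈ s, c k * (f lam k k).re) (fun s => ?_) ?_
  · exact Finset.aestronglyMeasurable_fun_sum _ fun k _ =>
      (Complex.continuous_re.comp_aestronglyMeasurable (hf.measurable k k)).const_mul _
  · filter_upwards [hf.ae_isTracePos] with lam h
    exact (h.summable_diag_mul hc).hasSum

theorem IsSpectralDensity.integral_weighted (hf : IsSpectralDensity f) {c : ℕ → ℝ} {K : ℝ}
    (hc : ∀ k, |c k| ≤ K) : ∫ lam, ∑' k, c k * (f lam k k).re ∂freqMeasure =
      ∑' k, c k * (∫ lam, f lam k k ∂freqMeasure).re := by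
  have hi : ∀ k, Integrable (fun lam => c k * (f lam k k).re) freqMeasure := fun k =>
    (hf.integrable_entry k k).re.const_mul (c k)
  have hs : Summable fun k => ∫ lam, ‖f lam k k‖ ∂freqMeasure := by
    refine (ENNReal.summable_toReal hf.trace_finite.ne).congr fun k => ?_
    rw [integral_norm_eq_lintegral_enorm (hf.measurable k k)]
  rw [← integral_tsum_of_summable_integral_norm hi]
  · refine tsum_congr fun k => ?_
    rw [integral_const_mul]
    congr 1
    exact integral_re (hf.integrable_entry k k)
  · refine Summable.of_nonneg_of_le (fun k => integral_nonneg fun _ => norm_nonneg _) (fun k => ?_)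
      (hs.mul_left K)
    rw [← integral_const_mul]
    refine integral_mono_of_nonneg (Eventually.of_forall fun _ => norm_nonneg _)
      ((hf.integrable_entry k k).norm.const_mul K) (Eventually.of_forall fun lam => ?_)
    dsimp only
    rw [norm_mul, Real.norm_eq_abs]
    exact mul_le_mul (hc k) (Complex.abs_re_le_norm _) (abs_nonneg _) ((abs_nonneg _).trans (hc k))

theorem iq_eq_zero {u : ℝ → ℕ → ℂ} (h : ∀ᵐ lam ∂freqMeasure, ∀ k, u lam k = 0) (f : ℝ → Mat) :
    iq f u = 0 := by
  refine integral_eq_zero_of_ae ?_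
  filter_upwards [h] with lam h
  simp [qform, h]

end Averages

/-! ## The saddle point inequalities -/

section Saddle

variable {N : ℕ∞} {Θ : ℝ → Matrix ℕ (Idx N) ℂ} {Ψ : ℝ → Matrix (Idx N) ℕ ℂ}
  {h hf hg : ℝ → Idx N → ℂ} {A : ℝ → Mat}

/-- The function `h` is `Θ^⊤ u`, where `u = Ψ^⊤ h` is bounded in `ℓ²`. -/
def FactorBound (K : ℝ) (Θ : ℝ → Matrix ℕ (Idx N) ℂ) (Ψ : ℝ → Matrix (Idx N) ℕ ℂ)
    (h : ℝ → Idx N → ℂ) : Prop :=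
  ∀ᵐ lam ∂freqMeasure, SqSum (invVec Ψ h lam) ∧ nsq (invVec Ψ h lam) ≤ K ∧
    ∀ i, h lam i = tmul (Θ lam) (invVec Ψ h lam) i

theorem FactorEquation.ae_outer (heq : FactorEquation h Θ A)
    (hI : ∀ᵐ lam ∂freqMeasure, IsInversePair (Θ lam) (Ψ lam))
    (hA : ∀ᵐ lam ∂freqMeasure, ∃ C, BoundedBy (A lam) C) :
    ∀ᵐ lam ∂freqMeasure,
      (∀ k l, invVec Ψ h lam k * conj (invVec Ψ h lam l) = A lam k l) ∧
      SqSum (invVec Ψ h lam) ∧ ∀ i, h lam i = tmul (Θ lam) (invVec Ψ h lam) i := by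
  filter_upwards [heq, hI, hA] with lam h1 h2 h3
  obtain ⟨C, hC⟩ := h3
  exact sandwich_factor h2 hC h1

theorem boundedBy_smul_one (c : ℂ) : BoundedBy (c • (1 : Mat)) (‖c‖ ^ 2 * 1 ^ 2) := by
  have h : (1 : Mat) = Matrix.diagonal fun _ => 1 := Matrix.diagonal_one.symm
  rw [h]
  exact (BoundedBy.diagonal (K := 1) fun _ => by simp).smul c

/-- A multiplier proportional to the identity forces u = 0. This settles the noise term of the first
pair and the signal term of the second, whatever the density. -/
theorem FactorEquation.eq_zero {c : ℝ → ℂ} (heq : FactorEquation h Θ fun lam => c lam • (1 : Mat))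
    (hI : ∀ᵐ lam ∂freqMeasure, IsInversePair (Θ lam) (Ψ lam)) :
    FactorBound 0 Θ Ψ h ∧ ∀ f, iq f (invVec Ψ h) = 0 := by
  have h1 := heq.ae_outer hI (Eventually.of_forall fun lam => ⟨_, boundedBy_smul_one (c lam)⟩)
  refine ⟨?_, fun f => iq_eq_zero (h1.mono fun lam h => eq_zero_of_outer_eq_smul_one h.1) f⟩
  filter_upwards [h1] with lam h2
  refine ⟨h2.2.1, ?_, h2.2.2⟩
  rw [show invVec Ψ h lam = fun _ => 0 from funext (eq_zero_of_outer_eq_smul_one h2.1), nsq_zero]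

variable {C : ClassData} {g₀ : ℝ → Mat}

/-- Here u(λ) u(λ)* = x x* with a constant x. A phase depending on λ does not change the form, so
the integrated form is the one at x, which depends on f only through the integral fixed by P. -/
theorem signal_invariant_zero {x : ℕ → ℂ} (hx : SqSum x)
    (heq : FactorEquation h Θ fun _ => outer x)
    (hI : ∀ᵐ lam ∂freqMeasure, IsInversePair (Θ lam) (Ψ lam)) :
    FactorBound (nsq x) Θ Ψ h ∧ ∀ f ∈ C.signalClass 0, ∀ f' ∈ C.signalClass 0,
      iq f (invVec Ψ h) = iq f' (invVec Ψ h) := by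
  have h1 := heq.ae_outer hI (Eventually.of_forall fun _ => ⟨_, BoundedBy.outer hx⟩)
  refine ⟨?_, ?_⟩
  · filter_upwards [h1] with lam h2
    refine ⟨h2.2.1, nsq_mono hx fun k => ?_, h2.2.2⟩
    have h3 := h2.1 k k
    rw [outer, Complex.mul_conj', Complex.mul_conj'] at h3
    have h4 : ‖invVec Ψ h lam k‖ ^ 2 = ‖x k‖ ^ 2 := by exact_mod_cast h3
    exact (pow_left_inj₀ (norm_nonneg _) (norm_nonneg _) two_ne_zero).1 h4 |>.le
  · have key : ∀ f, IsSpectralDensity f → iq f (invVec Ψ h) = (iform f (fun _ => x) fun _ => x).re :=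
      fun f hf => by
      rw [← hf.iq_eq (isBddVec_const hx le_rfl)]
      refine integral_congr_ae ?_
      filter_upwards [h1, hf.ae_isTracePos] with lam h2 h3
      rw [h3.qform_eq h2.2.1, h3.qform_eq hx, bform_congr_outer h2.1]
    intro f hf f' hf'
    rw [key f hf.1, key f' hf'.1, iform_const_congr hf.1 hf'.1 (fun k l => ?_) hx]
    rw [integral_eq_of_avg (hf.2 k l), integral_eq_of_avg (hf'.2 k l)]

/-- The form becomes Σ c_k² f_{kk}, and each diagonal integral is prescribed. -/
theorem signal_invariant_two {c : ℕ → ℝ} {K : ℝ} (hc : ∀ k, |c k| ≤ K)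
    (heq : FactorEquation h Θ fun _ => Matrix.diagonal fun k => ((c k ^ 2 : ℝ) : ℂ))
    (hI : ∀ᵐ lam ∂freqMeasure, IsInversePair (Θ lam) (Ψ lam)) :
    FactorBound (K ^ 2) Θ Ψ h ∧ ∀ f ∈ C.signalClass 2, ∀ f' ∈ C.signalClass 2,
      iq f (invVec Ψ h) = iq f' (invVec Ψ h) := by
  have hc2 : ∀ k, |c k ^ 2| ≤ K ^ 2 := fun k => by
    rw [abs_pow]; exact pow_le_pow_left₀ (abs_nonneg _) (hc k) 2
  have h1 := heq.ae_outer hI (Eventually.of_forall fun _ => ⟨_, BoundedBy.diagonal (K := K ^ 2)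
    fun k => by rw [Complex.norm_real]; exact hc2 k⟩)
  refine ⟨?_, ?_⟩
  · filter_upwards [h1] with lam h2
    exact ⟨h2.2.1, nsq_le_of_outer_eq_diagonal (sq_nonneg K)
      (fun k => (le_abs_self _).trans (hc2 k)) h2.1, h2.2.2⟩
  · have key : ∀ f, IsSpectralDensity f → iq f (invVec Ψ h) =
        ∑' k, c k ^ 2 * (∫ lam, f lam k k ∂freqMeasure).re := fun f hf => by
      rw [← hf.integral_weighted hc2]
      refine integral_congr_ae ?_
      filter_upwards [h1, hf.ae_isTracePos] with lam h2 h3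
      exact h3.qform_of_diagonal h2.1
    intro f hf f' hf'
    rw [key f hf.1, key f' hf'.1]
    refine tsum_congr fun k => ?_
    rw [integral_eq_of_avg (hf.2 k), integral_eq_of_avg (hf'.2 k)]

/-- The form is α² times the conjugate of ⟨B₁, f⟩, whose average is prescribed. Measurability of u
is not visible from the equation. It comes later from causality of Ψ_τ^⊤ h, hence the assumption
`IsBddVec`. -/
theorem signal_invariant_three {α : ℝ}
    (heq : FactorEquation h Θ fun _ => ((α ^ 2 : ℝ) : ℂ) • C.B₁.transpose)
    (hI : ∀ᵐ lam ∂freqMeasure, IsInversePair (Θ lam) (Ψ lam)) :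
    ∃ K, FactorBound K Θ Ψ h ∧ (IsBddVec K (invVec Ψ h) →
      ∀ f ∈ C.signalClass 3, ∀ f' ∈ C.signalClass 3, iq f (invVec Ψ h) = iq f' (invVec Ψ h)) := by
  obtain ⟨D, hD⟩ := C.B₁_bounded.boundedBy
  have hb := hD.transpose.smul ((α ^ 2 : ℝ) : ℂ)
  have h1 := heq.ae_outer hI (Eventually.of_forall fun _ => ⟨_, hb⟩)
  refine ⟨√(‖((α ^ 2 : ℝ) : ℂ)‖ ^ 2 * D), ?_, fun hv => ?_⟩
  · filter_upwards [h1] with lam h2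
    exact ⟨h2.2.1, Real.le_sqrt_of_sq_le (hb.nsq_le_of_outer h2.1).2, h2.2.2⟩
  · have key : ∀ f ∈ C.signalClass 3, iq f (invVec Ψ h) =
        (((α ^ 2 : ℝ) : ℂ) * conj (2 * Real.pi * (C.p : ℂ))).re := fun f hf => by
      rw [hf.1.iq_eq hv, ← integral_eq_of_avg hf.2, ← integral_conj, ← integral_const_mul, iform]
      congr 1
      refine integral_congr_ae ?_
      filter_upwards [h1, hf.1.ae_isTracePos] with lam h2 h3
      refine h3.bform_eq_conj_pairing h2.2.1 C.B₁_posSemidef fun k l => ?_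
      rw [h2.1, Matrix.smul_apply, Matrix.transpose_apply, smul_eq_mul]
    intro f hf f' hf'
    rw [key f hf, key f' hf']

/-- The form is Σ (c_k² + γ_k) g_{kk}. The c-part has a prescribed integral. Where γ_k < 0,
slackness puts the k-th diagonal entry of g⁰ at the smallest value the class allows, so γ_k g_{kk}
does not exceed its value at g⁰. -/
theorem noise_bound_one {c : ℕ → ℝ} {γ : ℕ → ℝ → ℝ} {K : ℝ} (hc : ∀ k, |c k| ≤ K)
    (hγ : ∀ᵐ lam ∂freqMeasure, (∃ K, ∀ k, |γ k lam| ≤ K) ∧ ∀ k, γ k lam ≤ 0 ∧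
        ((1 - C.ε) * (C.g₁ lam k k).re < (g₀ lam k k).re → γ k lam = 0))
    (heq : FactorEquation h Θ
      fun lam => Matrix.diagonal fun k => ((c k ^ 2 + γ k lam : ℝ) : ℂ))
    (hI : ∀ᵐ lam ∂freqMeasure, IsInversePair (Θ lam) (Ψ lam)) (hg₀ : g₀ ∈ C.noiseClass 1) :
    FactorBound (K ^ 2) Θ Ψ h ∧ (IsBddVec (K ^ 2) (invVec Ψ h) →
      ∀ g ∈ C.noiseClass 1, iq g (invVec Ψ h) ≤ iq g₀ (invVec Ψ h)) := by
  have hc2 : ∀ k, |c k ^ 2| ≤ K ^ 2 := fun k => by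
    rw [abs_pow]; exact pow_le_pow_left₀ (abs_nonneg _) (hc k) 2
  have h1 := heq.ae_outer hI (hγ.mono fun lam h => by
    obtain ⟨L, hL⟩ := h.1
    exact ⟨_, BoundedBy.diagonal (K := K ^ 2 + L) fun k => by
      rw [Complex.norm_real, Real.norm_eq_abs]
      exact (abs_add_le _ _).trans (add_le_add (hc2 k) (hL k))⟩)
  refine ⟨?_, fun hu g hg => ?_⟩
  · filter_upwards [h1, hγ] with lam h2 h3
    exact ⟨h2.2.1, nsq_le_of_outer_eq_diagonal (sq_nonneg K)
      (fun k => by linarith [(le_abs_self _).trans (hc2 k), (h3.2 k).1]) h2.1, h2.2.2⟩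
  · obtain ⟨W, hW, hgW⟩ := hg.2.1
    -- γ_k is not known to be measurable, so it stays inside the quadratic forms. The c-terms with
    -- prescribed integrals are added on opposite sides and cancel after integration.
    have hle : ∀ᵐ lam ∂freqMeasure,
        qform (g lam) (invVec Ψ h lam) + ∑' k, c k ^ 2 * (g₀ lam k k).re ≤
          qform (g₀ lam) (invVec Ψ h lam) + ∑' k, c k ^ 2 * (g lam k k).re := by
      filter_upwards [h1, hγ, hgW, hg.1.ae_isTracePos, hg₀.1.ae_isTracePos, hW.posSemidef]
        with lam h2 h3 h4 h5 h6 h7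
      obtain ⟨⟨L, hL⟩, h3⟩ := h3
      have hcL : ∀ k, |c k ^ 2 + γ k lam| ≤ K ^ 2 + L := fun k =>
        (abs_add_le _ _).trans (add_le_add (hc2 k) (hL k))
      rw [h5.qform_of_diagonal h2.1, h6.qform_of_diagonal h2.1,
        ← (h5.summable_diag_mul hcL).tsum_add (h6.summable_diag_mul hc2),
        ← (h6.summable_diag_mul hcL).tsum_add (h5.summable_diag_mul hc2)]
      refine ((h5.summable_diag_mul hcL).add (h6.summable_diag_mul hc2)).tsum_le_tsum (fun k => ?_)
        ((h6.summable_diag_mul hcL).add (h5.summable_diag_mul hc2))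
      have hk : γ k lam * (g lam k k).re ≤ γ k lam * (g₀ lam k k).re := by
        rcases eq_or_ne (γ k lam) 0 with h0 | h0
        · rw [h0]; simp
        · have h8 : (g₀ lam k k).re ≤ (1 - C.ε) * (C.g₁ lam k k).re := by
            by_contra hcon
            exact h0 ((h3 k).2 (not_le.1 hcon))
          have h9 : (g lam k k).re = (1 - C.ε) * (C.g₁ lam k k).re + C.ε * (W lam k k).re := by
            rw [h4 k]; simp
          have h10 := mul_nonneg C.ε_nonneg (h7.diag_re_nonneg k)
          exact mul_le_mul_of_nonpos_left (by linarith) (h3 k).1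
      linarith
    have hint := integral_mono_ae
      ((hg.1.integrable_qform hu).add (hg₀.1.integrable_weighted hc2))
      ((hg₀.1.integrable_qform hu).add (hg.1.integrable_weighted hc2)) hle
    simp only [Pi.add_apply] at hint
    rw [integral_add (hg.1.integrable_qform hu) (hg₀.1.integrable_weighted hc2),
      integral_add (hg₀.1.integrable_qform hu) (hg.1.integrable_weighted hc2),
      hg.1.integral_weighted hc2, hg₀.1.integral_weighted hc2] at hint
    simp only [integral_eq_of_avg (hg.2.2 _), integral_eq_of_avg (hg₀.2.2 _)] at hint
    exact le_of_add_le_add_right hint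

/-- Since u u* = (α² + γ) B₂^⊤ has rank at most one, either B₂^⊤ = y y* or u vanishes almost
everywhere. In the first case the form at u is α² + γ times the form at y, that is, times ⟨B₂, g⟩,
and slackness applies to this single number. -/
theorem noise_bound_two {α : ℝ} {γ : ℝ → ℝ}
    (hγ : ∀ᵐ lam ∂freqMeasure, γ lam ≤ 0 ∧
        ((1 - C.ε) * (pairing C.B₂ (C.g₁ lam)).re < (pairing C.B₂ (g₀ lam)).re → γ lam = 0))
    (heq : FactorEquation h Θ fun lam => ((α ^ 2 + γ lam : ℝ) : ℂ) • C.B₂.transpose)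
    (hI : ∀ᵐ lam ∂freqMeasure, IsInversePair (Θ lam) (Ψ lam)) (hg₀ : g₀ ∈ C.noiseClass 2) :
    ∃ K, FactorBound K Θ Ψ h ∧ (IsBddVec K (invVec Ψ h) →
      ∀ g ∈ C.noiseClass 2, iq g (invVec Ψ h) ≤ iq g₀ (invVec Ψ h)) := by
  obtain ⟨D, hD⟩ := C.B₂_bounded.boundedBy
  have h1 := heq.ae_outer hI (Eventually.of_forall fun lam =>
    ⟨_, hD.transpose.smul ((α ^ 2 + γ lam : ℝ) : ℂ)⟩)
  simp only [Matrix.smul_apply, Matrix.transpose_apply, smul_eq_mul] at h1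
  by_cases hy : ∃ y : ℕ → ℂ, SqSum y ∧ ∀ k l, C.B₂ l k = y k * conj (y l)
  · obtain ⟨y, hy, hyB⟩ := hy
    have hyc : IsBddVec (nsq y) fun _ => y := isBddVec_const hy le_rfl
    refine ⟨α ^ 2 * nsq y, ?_, fun hu g hg => ?_⟩
    · filter_upwards [h1, hγ] with lam h2 h3
      have h4 : ∀ k, ‖invVec Ψ h lam k‖ ≤ ‖(α : ℂ) * y k‖ := fun k => by
        have h5 : ‖invVec Ψ h lam k‖ ^ 2 = (α ^ 2 + γ lam) * ‖y k‖ ^ 2 :=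
          norm_sq_of_outer (by
            rw [h2.1, hyB, Complex.mul_conj']; push_cast; ring)
        refine abs_le_of_sq_le_sq' ?_ (norm_nonneg _) |>.2
        rw [h5, norm_mul, mul_pow, Complex.norm_real, Real.norm_eq_abs, sq_abs]
        exact mul_le_mul_of_nonneg_right (by linarith [h3.1]) (sq_nonneg _)
      refine ⟨h2.2.1, (nsq_mono (hy.const_mul _) h4).trans_eq ?_, h2.2.2⟩
      rw [nsq_const_mul, Complex.norm_real, Real.norm_eq_abs, sq_abs]
    · have hpair : ∀ A : Mat, IsTracePos A → bform A y y = conj (pairing C.B₂ A) := fun A hA => by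
        have := hA.bform_eq_conj_pairing hy C.B₂_posSemidef (c := 1)
          (fun k l => by rw [hyB]; simp)
        simpa using this
      have hre : ∀ A : Mat, IsTracePos A → (pairing C.B₂ A).re = qform A y := fun A hA => by
        rw [hA.qform_eq hy, hpair A hA, Complex.conj_re]
      have hconst : ∀ g ∈ C.noiseClass 2, iq g (fun _ => y) =
          (conj (2 * Real.pi * (C.q : ℂ))).re := fun g hg => by
        rw [hg.1.iq_eq hyc, ← integral_eq_of_avg hg.2.2, ← integral_conj, iform]
        congr 1
        refine integral_congr_ae ?_
        filter_upwards [hg.1.ae_isTracePos] with lam h3 using hpair _ h3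
      have hqu : ∀ g, IsSpectralDensity g → ∀ᵐ lam ∂freqMeasure,
          qform (g lam) (invVec Ψ h lam) = (α ^ 2 + γ lam) * qform (g lam) y := fun g hg => by
        filter_upwards [h1, hg.ae_isTracePos] with lam h2 h3
        rw [h3.qform_eq h2.2.1, h3.bform_eq_conj_pairing h2.2.1 C.B₂_posSemidef h2.1,
          Complex.re_ofReal_mul, Complex.conj_re, hre _ h3]
      obtain ⟨W, hW, hgW⟩ := hg.2.1
      have hle : ∀ᵐ lam ∂freqMeasure,
          qform (g lam) (invVec Ψ h lam) + α ^ 2 * qform (g₀ lam) y ≤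
            qform (g₀ lam) (invVec Ψ h lam) + α ^ 2 * qform (g lam) y := by
        filter_upwards [hqu g hg.1, hqu g₀ hg₀.1, hγ, hgW, hg.1.ae_isTracePos,
          hg₀.1.ae_isTracePos, hW.ae_isTracePos] with lam h2 h3 h4 h5 h6 h7 h8
        rw [h2, h3]
        have hk : γ lam * qform (g lam) y ≤ γ lam * qform (g₀ lam) y := by
          rcases eq_or_ne (γ lam) 0 with h0 | h0
          · rw [h0]; simp
          · have h9 : (pairing C.B₂ (g₀ lam)).re ≤ (1 - C.ε) * (pairing C.B₂ (C.g₁ lam)).re := by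
              by_contra hcon
              exact h0 (h4.2 (not_le.1 hcon))
            have h10 : (pairing C.B₂ (g lam)).re = (1 - C.ε) * (pairing C.B₂ (C.g₁ lam)).re +
                C.ε * (pairing C.B₂ (W lam)).re := by
              rw [h5]; simp
            rw [hre _ h6, hre _ h8] at h10
            rw [hre _ h7] at h9
            have h11 := mul_nonneg C.ε_nonneg (h8.qform_nonneg hy)
            exact mul_le_mul_of_nonpos_left (by linarith) h4.1
        linarith
      have hint := integral_mono_ae
        ((hg.1.integrable_qform hu).add ((hg₀.1.integrable_qform hyc).const_mul (α ^ 2)))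
        ((hg₀.1.integrable_qform hu).add ((hg.1.integrable_qform hyc).const_mul (α ^ 2))) hle
      simp only [Pi.add_apply] at hint
      rw [integral_add (hg.1.integrable_qform hu) ((hg₀.1.integrable_qform hyc).const_mul _),
        integral_add (hg₀.1.integrable_qform hu) ((hg.1.integrable_qform hyc).const_mul _),
        integral_const_mul, integral_const_mul] at hint
      have e : ∫ lam, qform (g lam) y ∂freqMeasure = ∫ lam, qform (g₀ lam) y ∂freqMeasure :=
        (hconst g hg).trans (hconst g₀ hg₀).symm
      rw [e] at hint
      exact le_of_add_le_add_right hint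
  -- A nonzero u at one frequency, divided by the square root of α² + γ, would be the excluded
  -- vector y.
  · have hz : ∀ᵐ lam ∂freqMeasure, ∀ k, invVec Ψ h lam k = 0 := by
      filter_upwards [h1] with lam h2
      by_contra hcon
      push Not at hcon
      obtain ⟨k, hk⟩ := hcon
      have h3 : ‖invVec Ψ h lam k‖ ^ 2 = (α ^ 2 + γ lam) * (C.B₂ k k).re :=
        norm_sq_of_outer (by
          rw [h2.1]
          conv_lhs => rw [C.B₂_posSemidef.diag_eq_re k]
          push_cast; ring)
      have h4 : 0 < (α ^ 2 + γ lam) * (C.B₂ k k).re := h3 ▸ by positivity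
      have hc : 0 < α ^ 2 + γ lam := pos_of_mul_pos_left h4 (C.B₂_posSemidef.diag_re_nonneg k)
      refine hy ⟨fun k => ((√(α ^ 2 + γ lam))⁻¹ : ℝ) * invVec Ψ h lam k, h2.2.1.const_mul _,
        fun k l => ?_⟩
      rw [map_mul, Complex.conj_ofReal, mul_mul_mul_comm, h2.1, ← mul_assoc, ← Complex.ofReal_mul,
        ← Complex.ofReal_mul, ← mul_inv, Real.mul_self_sqrt hc.le, inv_mul_cancel₀ hc.ne',
        Complex.ofReal_one, one_mul]
    refine ⟨0, ?_, fun _ g _ => by rw [iq_eq_zero hz, iq_eq_zero hz]⟩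
    filter_upwards [h1, hz] with lam h2 h3
    refine ⟨h2.2.1, ?_, h2.2.2⟩
    rw [show invVec Ψ h lam = fun _ => 0 from funext h3, nsq_zero]

/-- As Γ ≤ 0, u = c x with |c| ≤ 1. Where Γ = 0 the forms at u and x agree. Elsewhere slackness
gives g⁰ = (1-ε) g₁, so g = g⁰ + ε W and the excess ε W is at most as large at u as at x. The forms
at the constant x have equal integrals for g and g⁰. -/
theorem noise_bound_three {x : ℕ → ℂ} {Γ : ℝ → Mat} (hx : SqSum x)
    (hΓ : ∀ᵐ lam ∂freqMeasure, (-(Γ lam)).PosSemidef ∧ IsBoundedMat (Γ lam) ∧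
        ((g₀ lam - ((1 - C.ε : ℝ) : ℂ) • C.g₁ lam).PosSemidef ∧
          g₀ lam ≠ ((1 - C.ε : ℝ) : ℂ) • C.g₁ lam → Γ lam = 0))
    (heq : FactorEquation h Θ fun lam => outer x + Γ lam)
    (hI : ∀ᵐ lam ∂freqMeasure, IsInversePair (Θ lam) (Ψ lam)) (hg₀ : g₀ ∈ C.noiseClass 3) :
    FactorBound (nsq x) Θ Ψ h ∧ (IsBddVec (nsq x) (invVec Ψ h) →
      ∀ g ∈ C.noiseClass 3, iq g (invVec Ψ h) ≤ iq g₀ (invVec Ψ h)) := by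
  have h1 := heq.ae_outer hI (hΓ.mono fun lam h => by
    obtain ⟨D, hD⟩ := h.2.1.boundedBy
    exact ⟨_, (BoundedBy.outer hx).add hD⟩)
  simp only [Matrix.add_apply] at h1
  have hxc : IsBddVec (nsq x) fun _ => x := isBddVec_const hx le_rfl
  refine ⟨?_, fun hu g hg => ?_⟩
  · filter_upwards [h1, hΓ] with lam h2 h3
    exact ⟨h2.2.1, nsq_mono hx (exists_smul_of_outer_le h3.1 h2.1).1, h2.2.2⟩
  · obtain ⟨W, hW, hgW⟩ := hg.2.1
    obtain ⟨W₀, hW₀, hgW₀⟩ := hg₀.2.1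
    have hle : ∀ᵐ lam ∂freqMeasure,
        qform (g lam) (invVec Ψ h lam) + qform (g₀ lam) x ≤
          qform (g₀ lam) (invVec Ψ h lam) + qform (g lam) x := by
      filter_upwards [h1, hΓ, hgW, hgW₀, hg.1.ae_isTracePos, hg₀.1.ae_isTracePos,
        hW.ae_isTracePos, hW₀.ae_isTracePos, C.g₁_density.ae_isTracePos]
        with lam h2 h3 h4 h5 h6 h7 h8 h9 h10
      by_cases h0 : Γ lam = 0
      · have e : ∀ k l, invVec Ψ h lam k * conj (invVec Ψ h lam l) = x k * conj (x l) :=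
          fun k l => by rw [h2.1, h0]; simp [outer]
        rw [h6.qform_eq h2.2.1, h7.qform_eq h2.2.1, h6.qform_eq hx, h7.qform_eq hx,
          bform_congr_outer e, bform_congr_outer e]
        linarith
      -- Membership in the class makes the difference equal to ε W₀ ≥ 0. Hence Γ ≠ 0 can only mean
      -- that the difference is zero.
      · have hpsd : (g₀ lam - ((1 - C.ε : ℝ) : ℂ) • C.g₁ lam).PosSemidef := by
          have e : g₀ lam - ((1 - C.ε : ℝ) : ℂ) • C.g₁ lam = (C.ε : ℂ) • W₀ lam := by
            ext k l
            rw [Matrix.sub_apply, Matrix.smul_apply, Matrix.smul_apply, h5, smul_eq_mul,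
              smul_eq_mul]
            push_cast; ring
          rw [e]
          exact h9.posSemidef.smul (by exact_mod_cast C.ε_nonneg)
        have heq₀ : g₀ lam = ((1 - C.ε : ℝ) : ℂ) • C.g₁ lam := by
          by_contra hcon
          exact h0 (h3.2.2 ⟨hpsd, hcon⟩)
        have hgz : ∀ {z : ℕ → ℂ}, SqSum z →
            qform (g lam) z = qform (g₀ lam) z + C.ε * qform (W lam) z := fun {z} hz => by
          have := h6.qform_lincomb h7 h8 (a := 1) (c := C.ε) (fun k l => by
            rw [h4, heq₀, Matrix.smul_apply, smul_eq_mul]; push_cast; ring) hz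
          rw [this, one_mul]
        obtain ⟨c, hc, hcu⟩ := (exists_smul_of_outer_le h3.1 h2.1).2
        have hWu : qform (W lam) (invVec Ψ h lam) ≤ qform (W lam) x := by
          rw [hcu, h8.qform_const_mul hx]
          exact mul_le_of_le_one_left (h8.qform_nonneg hx)
            (pow_le_one₀ (norm_nonneg _) hc)
        rw [hgz h2.2.1, hgz hx]
        linarith [mul_le_mul_of_nonneg_left hWu C.ε_nonneg]
    have hint := integral_mono_ae
      ((hg.1.integrable_qform hu).add (hg₀.1.integrable_qform hxc))
      ((hg₀.1.integrable_qform hu).add (hg.1.integrable_qform hxc)) hle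
    simp only [Pi.add_apply] at hint
    rw [integral_add (hg.1.integrable_qform hu) (hg₀.1.integrable_qform hxc),
      integral_add (hg₀.1.integrable_qform hu) (hg.1.integrable_qform hxc)] at hint
    have e : ∫ lam, qform (g lam) x ∂freqMeasure = ∫ lam, qform (g₀ lam) x ∂freqMeasure := by
      have h2 := iform_const_congr hg.1 hg₀.1 (fun k l => by
        rw [integral_eq_of_avg (hg.2.2 k l), integral_eq_of_avg (hg₀.2.2 k l)]) hx
      have h3 := hg.1.iq_eq hxc
      have h4 := hg₀.1.iq_eq hxc
      rw [h2, ← h4] at h3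
      exact h3
    rw [e] at hint
    exact le_of_add_le_add_right hint

/-- The multiplier equations give a saddle point. -/
theorem MultiplierEquations.saddle {k : Fin 4} (heq : MultiplierEquations C g₀ Θ hf hg k)
    (hI : ∀ᵐ lam ∂freqMeasure, IsInversePair (Θ lam) (Ψ lam)) (hg₀ : g₀ ∈ C.noiseClass k) :
    (∃ K, FactorBound K Θ Ψ hf ∧ (IsBddVec K (invVec Ψ hf) →
      ∀ g ∈ C.noiseClass k, iq g (invVec Ψ hf) ≤ iq g₀ (invVec Ψ hf))) ∧
    ∃ K, FactorBound K Θ Ψ hg ∧ (IsBddVec K (invVec Ψ hg) →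
      ∀ f ∈ C.signalClass k, ∀ f' ∈ C.signalClass k,
        iq f (invVec Ψ hg) = iq f' (invVec Ψ hg)) := by
  match k, heq, hg₀ with
  | 0, ⟨v, α, γ, hv, _, h1, h2⟩, _ =>
    have a := h2.eq_zero hI
    have b := signal_invariant_zero (C := C) (memℓp_two_iff.1 hv) h1 hI
    exact ⟨⟨0, a.1, fun _ g _ => by rw [a.2, a.2]⟩, _, b.1, fun _ => b.2⟩
  | 1, ⟨α, αk, γ, ⟨K, hK⟩, hγ, h1, h2⟩, hg₀ =>
    have a := h1.eq_zero hI
    exact ⟨⟨_, noise_bound_one hK hγ h2 hI hg₀⟩, 0, a.1, fun _ f _ f' _ => by rw [a.2, a.2]⟩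
  | 2, ⟨αk, α, γ, ⟨K, hK⟩, hγ, h1, h2⟩, hg₀ =>
    have b := signal_invariant_two (C := C) hK h1 hI
    exact ⟨noise_bound_two hγ h2 hI hg₀, _, b.1, fun _ => b.2⟩
  | 3, ⟨α, v, Γ, hv, hΓ, h1, h2⟩, hg₀ =>
    exact ⟨⟨_, noise_bound_three (memℓp_two_iff.1 hv) hΓ h2 hI hg₀⟩,
      signal_invariant_three h1 hI⟩

end Saddle

/-! ## The robust solution in the frequency domain -/

section Congruence

variable {d τ : ℕ} {b : ℕ → ℕ → ℂ} {F f g : ℝ → Mat} {h h' : ℝ → ℕ → ℂ}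

theorem normSqL2_congr (e : ∀ᵐ lam ∂freqMeasure, h lam = h' lam) (F : ℝ → Mat) :
    normSqL2 F h = normSqL2 F h' :=
  lintegral_congr_ae (e.mono fun lam e => by dsimp only; rw [e])

theorem mse_congr (e : ∀ᵐ lam ∂freqMeasure, h lam = h' lam) (d τ : ℕ) (b : ℕ → ℕ → ℂ)
    (f g : ℝ → Mat) : mse d τ b h f g = mse d τ b h' f g := by
  rw [mse, mse, normSqL2_congr e g, normSqL2_congr
    (h' := fun lam k => incFactor d τ lam * symbolB b lam k - h' lam k)
    (e.mono fun lam e => by rw [e]) f]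

theorem MemL20.congr (e : ∀ᵐ lam ∂freqMeasure, h lam = h' lam) (H : MemL20 d τ F h) :
    MemL20 d τ F h' where
  measurable k := (H.measurable k).congr (e.mono fun lam e => by dsimp only; rw [e])
  vector := by filter_upwards [e, H.vector] with lam e h1 using e ▸ h1
  finite := normSqL2_congr e F ▸ H.finite
  approx ε hε := by
    obtain ⟨x, hx⟩ := H.approx ε hε
    exact ⟨x, by
      rwa [normSqL2_congr (h' := fun lam k => h lam k - polyChar d τ x lam k)
        (e.mono fun lam e => by rw [e]) F]⟩

theorem IsOptimalChar.congr (e : ∀ᵐ lam ∂freqMeasure, h lam = h' lam)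
    (H : IsOptimalChar d τ b f g h) : IsOptimalChar d τ b f g h' :=
  ⟨H.1.congr e, by rw [← mse_congr e, H.2]⟩

theorem IsMinimaxChar.congr {D : Set ((ℝ → Mat) × (ℝ → Mat))}
    (e : ∀ᵐ lam ∂freqMeasure, h lam = h' lam) (H : IsMinimaxChar d τ b D h) :
    IsMinimaxChar d τ b D h' :=
  ⟨fun q hq => (H.1 q hq).congr e, fun k hk => by
    simp only [← mse_congr e]
    exact H.2 k hk⟩

end Congruence

/-! ### The saddle point and its consequences. -/

section Solution

variable {d τ : ℕ} {b : ℕ → ℕ → ℂ} {w : ℝ → ℂ} {N : ℕ∞} {f g F G : ℝ → Mat}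
  {Θ : ℝ → Matrix ℕ (Idx N) ℂ} {Ψ : ℝ → Matrix (Idx N) ℕ ℂ}

theorem FactorBound.isBddVec {C D : ℝ} {h : ℝ → Idx N → ℂ} (hB : FactorBound C Θ Ψ h)
    (hw : AEStronglyMeasurable w freqMeasure) (hw0 : ∀ᵐ lam ∂freqMeasure, w lam ≠ 0)
    (hs : IsBddCausal D (charVec w Ψ h)) : IsBddVec C (invVec Ψ h) where
  aesm k := by
    refine (hw.mul (hs.aesm k)).congr ?_
    filter_upwards [hw0] with lam h0
    rw [Pi.mul_apply, charVec_eq, mul_inv_cancel_left₀ h0]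
  bound := hB.mono fun lam h => ⟨h.1, h.2.1⟩

theorem iq_charVec {h : ℝ → Idx N → ℂ} (hf : IsSpectralDensity f)
    (hw : ∀ᵐ lam ∂freqMeasure, w lam ≠ 0 ∧ ‖incFactor d τ lam‖ = ‖w lam‖)
    (hu : ∀ᵐ lam ∂freqMeasure, SqSum (invVec Ψ h lam)) :
    iq f (fun lam k => incFactor d τ lam * charVec w Ψ h lam k) = iq f (invVec Ψ h) := by
  refine integral_congr_ae ?_
  filter_upwards [hw, hu, hf.ae_isTracePos] with lam h1 h2 h3
  have e : (fun k => incFactor d τ lam * charVec w Ψ h lam k) =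
      fun k => (incFactor d τ lam * (w lam)⁻¹) * invVec Ψ h lam k :=
    funext fun k => by rw [charVec_eq, mul_assoc]
  rw [e, h3.qform_const_mul h2, norm_mul, norm_inv, h1.2,
    mul_inv_cancel₀ (norm_ne_zero_iff.2 h1.1), one_pow, one_mul]

/-- The forms of the signal and of the noise determine the decomposition of the symbol. -/
theorem symbolB_eq_of_orthogonal (hτ : 0 < τ) (hb : CoeffCondition b) (hf : IsSpectralDensity f)
    (hg : IsSpectralDensity g)
    (hΘ : IsCanonicalFactorization (fun lam => f lam + g lam) Θ)
    (hI : ∀ᵐ lam ∂freqMeasure, IsInversePair (Θ lam) (Ψ lam)) {C D : ℝ} {s t : ℝ → ℕ → ℂ}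
    (hs : IsBddCausal C s) (ht : IsBddCausal D t)
    (h1 : ∀ {E : ℝ} {q : ℝ → ℕ → ℂ}, IsBddCausal E q →
      iform f (fun lam k => incFactor d τ lam * symbolB b lam k)
        (fun lam k => incFactor d τ lam * q lam k) =
      iform (fun lam => f lam + g lam) (fun lam k => incFactor d τ lam * s lam k)
        (fun lam k => incFactor d τ lam * q lam k))
    (h2 : ∀ {E : ℝ} {q : ℝ → ℕ → ℂ}, IsBddCausal E q →
      iform g (fun lam k => incFactor d τ lam * symbolB b lam k)
        (fun lam k => incFactor d τ lam * q lam k) =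
      iform (fun lam => f lam + g lam) (fun lam k => incFactor d τ lam * t lam k)
        (fun lam k => incFactor d τ lam * q lam k)) :
    ∀ᵐ lam ∂freqMeasure, ∀ k, symbolB b lam k = s lam k + t lam k := by
  have hB := hb.isBddCausal
  have hr := (hB.sub hs).sub ht
  have hF := hf.add hg
  have hB' := hB.toVec.inc d τ
  have hs' := hs.toVec.inc d τ
  have ht' := ht.toVec.inc d τ
  have hr' := hr.toVec.inc d τ
  -- The remainder r = B - s - t is itself bounded and causal, so both normal equations may be
  -- tested on r. Together they make r orthogonal to itself in L²(f+g).
  have key : iq (fun lam => f lam + g lam)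
      (fun lam k => incFactor d τ lam * (symbolB b lam k - s lam k - t lam k)) = 0 := by
    have e : (fun (lam : ℝ) (k : ℕ) => incFactor d τ lam * (symbolB b lam k - s lam k - t lam k)) =
        fun lam k => incFactor d τ lam * symbolB b lam k - incFactor d τ lam * s lam k -
          incFactor d τ lam * t lam k := by funext lam k; ring
    rw [hF.iq_eq hr']
    nth_rewrite 1 [e]
    rw [hF.iform_sub_left (hB'.sub hs') ht' hr', hF.iform_sub_left hB' hs' hr', ← h1 hr, ← h2 hr,
      hf.iform_add_mat hg hB' hr']
    simp
  have h3 := (integral_eq_zero_iff_of_nonneg_ae (hF.ae_qform_nonneg hr')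
    (hF.integrable_qform hr')).1 key
  filter_upwards [h3, hΘ.factor, hΘ.l2Fam.ae_isHS, hF.ae_isTracePos, hI, hr'.sqSum, hr.toVec.sqSum,
    ae_incWeight_ne_zero hτ d] with lam g1 g2 g3 g4 g5 g6 g7 g8 k
  rw [Pi.zero_apply, qform_of_factor g4 g3 g2 g6] at g1
  -- The vanishing form is the squared norm of Θ^⊤(βr), and Θ^⊤ is injective because Θ has an
  -- inverse.
  have g9 : ∀ i, tmul (Θ lam)
      (fun k => incFactor d τ lam * (symbolB b lam k - s lam k - t lam k)) i = 0 := fun i => by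
    have := (g3.tmul g6).1.le_tsum i fun j _ => sq_nonneg _
    rw [nsq] at g1
    rw [g1] at this
    exact norm_eq_zero.1 (pow_eq_zero_iff two_ne_zero |>.1 (le_antisymm this (sq_nonneg _)))
  have g10 := g5.eq_zero_of_tmul g6 g9 k
  have g11 : incFactor d τ lam ≠ 0 := fun h0 => g8 (by rw [← norm_incFactor_sq, h0]; simp)
  have := (mul_eq_zero.1 g10).resolve_left g11
  linear_combination this

/-- The solution in the frequency domain: optimality, the least favourable densities and the
minimax property. -/
theorem exists_frequency_solution (hτ : 0 < τ) (hb : CoeffCondition b) {C : ClassData} {k : Fin 4}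
    (hw : IsWeightFactor d τ w) {MΦ MΩ : ℕ∞} {Φ : ℝ → Matrix ℕ (Idx MΦ) ℂ}
    {Om : ℝ → Matrix ℕ (Idx MΩ) ℂ} (hf₀ : f ∈ C.signalClass k) (hg₀ : g ∈ C.noiseClass k)
    (hΦ : IsCanonicalFactorization f Φ) (hΩ : IsCanonicalFactorization g Om)
    (hΘ : IsCanonicalFactorization (fun lam => f lam + g lam) Θ)
    (hΨ : IsInverseFactorization w Θ Ψ G)
    (hΦop : IsL2Operator (matCoef (tauFactor w Φ)))
    (hΩop : IsL2Operator (matCoef (tauFactor w Om)))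
    (hmin : MinimalityCondition d τ G) {hf hg : ℝ → Idx N → ℂ}
    (hhf : IsPsiCSeries (matCoef (tauInv w Ψ)) (matCoef (tauFactor w Φ)) b hf)
    (hhg : IsPsiCSeries (matCoef (tauInv w Ψ)) (matCoef (tauFactor w Om)) b hg)
    (heq : MultiplierEquations C g Θ hf hg k) :
    ∃ (D : ℝ) (s : ℝ → ℕ → ℂ), IsBddCausal D s ∧
      charF d τ w Ψ hf = (fun lam k => incFactor d τ lam * s lam k) ∧
      (∀ᵐ lam ∂freqMeasure,
        (fun k => incFactor d τ lam * s lam k) = charG d τ b w Ψ hg lam) ∧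
      IsLeastFavourable d τ b (C.pairClass k) f g ∧
      IsOptimalChar d τ b f g (fun lam k => incFactor d τ lam * s lam k) ∧
      IsMinimaxChar d τ b (C.pairClass k) (fun lam k => incFactor d τ lam * s lam k) ∧
      ∀ x, mse d τ b (polyChar d τ x) f g =
        mse d τ b (fun lam k => incFactor d τ lam * s lam k) f g +
          ENNReal.ofReal (1 / (2 * Real.pi)) * normSqL2 (fun lam => f lam + g lam)
            (fun lam k => incFactor d τ lam * s lam k - polyChar d τ x lam k) := by
  have hI := hΨ.ae_isInversePair hτ hw hΘ
  have cls : ∀ {φ}, φ ∈ C.signalClass k → IsSpectralDensity φ := fun {φ} h => by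
    fin_cases k <;> exact h.1
  have cln : ∀ {φ}, φ ∈ C.noiseClass k → IsSpectralDensity φ := fun {φ} h => by
    fin_cases k <;> exact h.1
  have df := cls hf₀
  have dg := cln hg₀
  have dF := df.add dg
  obtain ⟨⟨Ku, bu, su⟩, Kv, bv, sv⟩ := heq.saddle hI hg₀
  obtain ⟨K, hK, hKb⟩ := hΨ.weight_bounds hτ hw hΘ
  obtain ⟨Du, cu⟩ := charVec_isBddCausal hτ hw hΘ hΨ hmin (fun i => (hhf i).memLp)
    (fun i => (hhf i).coef_neg) bu
  obtain ⟨Dv, cv⟩ := charVec_isBddCausal hτ hw hΘ hΨ hmin (fun i => (hhg i).memLp)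
    (fun i => (hhg i).coef_neg) bv
  have hw0 : ∀ᵐ lam ∂freqMeasure, w lam ≠ 0 := hKb.mono fun _ h => h.2.2.1
  have hwβ : ∀ᵐ lam ∂freqMeasure, w lam ≠ 0 ∧ ‖incFactor d τ lam‖ = ‖w lam‖ :=
    hKb.mono fun _ h => ⟨h.2.2.1, h.2.2.2.2⟩
  have vu := bu.isBddVec hw.aesm hw0 cu
  have vv := bv.isBddVec hw.aesm hw0 cv
  have hB := hb.isBddCausal
  have lef : ∀ᵐ lam ∂freqMeasure, ∀ v, SqSum v → qform (f lam) v ≤ qform (f lam + g lam) v := by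
    filter_upwards [df.ae_isTracePos, dg.ae_isTracePos] with lam h1 h2 v hv
    rw [h1.qform_add_mat h2 hv]
    exact le_add_of_nonneg_right (h2.qform_nonneg hv)
  have leg : ∀ᵐ lam ∂freqMeasure, ∀ v, SqSum v → qform (g lam) v ≤ qform (f lam + g lam) v := by
    filter_upwards [df.ae_isTracePos, dg.ae_isTracePos] with lam h1 h2 v hv
    rw [h1.qform_add_mat h2 hv]
    exact le_add_of_nonneg_left (h1.qform_nonneg hv)
  -- The normal equations for the signal; `ov` is the counterpart for the noise, with g in place of
  -- f and h_g in place of h_f.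
  have ou : ∀ {E : ℝ} {q : ℝ → ℕ → ℂ}, IsBddCausal E q →
      iform f (fun lam k => incFactor d τ lam * symbolB b lam k)
        (fun lam k => incFactor d τ lam * q lam k) =
      iform (fun lam => f lam + g lam) (fun lam k => incFactor d τ lam * charVec w Ψ hf lam k)
        (fun lam k => incFactor d τ lam * q lam k) := fun {E q} hq =>
    iform_eq_of_coef df dF (hB.toVec.inc d τ) (cu.toVec.inc d τ)
      (coef_bform_charVec hτ hb hw df dF lef hΦ hΘ hΨ hΦop hhf (bu.mono fun _ h => ⟨h.1, h.2.2⟩)) hq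
  have ov : ∀ {E : ℝ} {q : ℝ → ℕ → ℂ}, IsBddCausal E q →
      iform g (fun lam k => incFactor d τ lam * symbolB b lam k)
        (fun lam k => incFactor d τ lam * q lam k) =
      iform (fun lam => f lam + g lam) (fun lam k => incFactor d τ lam * charVec w Ψ hg lam k)
        (fun lam k => incFactor d τ lam * q lam k) := fun {E q} hq =>
    iform_eq_of_coef dg dF (hB.toVec.inc d τ) (cv.toVec.inc d τ)
      (coef_bform_charVec hτ hb hw dg dF leg hΩ hΘ hΨ hΩop hhg (bv.mono fun _ h => ⟨h.1, h.2.2⟩)) hq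
  have dec := symbolB_eq_of_orthogonal hτ hb df dg hΘ hI cu cv ou ov
  obtain ⟨opt, pyth⟩ := isOptimalChar_of_orthogonal hb df dg cu ou
  set h₀ : ℝ → ℕ → ℂ := fun lam k => incFactor d τ lam * charVec w Ψ hf lam k with hh₀
  -- By `dec` the signal error βB - h⁰ is βΨ_τ^⊤ h_g, and |β| = |w| removes the weight. The formula
  -- holds for arbitrary densities, so it can be maximized over the class.
  have err : ∀ {φ γ : ℝ → Mat}, IsSpectralDensity φ → IsSpectralDensity γ →
      mse d τ b h₀ φ γ =
        ENNReal.ofReal (1 / (2 * Real.pi) * (iq φ (invVec Ψ hg) + iq γ (invVec Ψ hf))) := by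
    intro φ γ hφ hγ
    rw [hh₀, mse_eq hb hφ hγ cu.toVec, iq_charVec hγ hwβ vu.sqSum, ← iq_charVec hφ hwβ vv.sqSum]
    congr 3
    refine integral_congr_ae ?_
    filter_upwards [dec] with lam h1
    simp only [h1]
    congr 1
    funext k
    ring
  have saddle : ∀ q ∈ C.pairClass k, mse d τ b h₀ q.1 q.2 ≤ mse d τ b h₀ f g := by
    intro q hq
    rw [err (cls hq.1) (cln hq.2), err df dg]
    refine ENNReal.ofReal_le_ofReal (mul_le_mul_of_nonneg_left ?_ ?_)
    · rw [sv vv q.1 hq.1 f hf₀]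
      linarith [su vu q.2 hq.2]
    · have := Real.pi_pos
      positivity
  have hcommon : h₀ ∈ commonChars d τ (C.pairClass k) := fun q hq =>
    cu.memL20 d τ ((cls hq.1).add (cln hq.2))
  have hmem : (f, g) ∈ C.pairClass k := ⟨hf₀, hg₀⟩
  refine ⟨Du, charVec w Ψ hf, cu, rfl, ?_, ⟨hmem, fun q hq => ?_⟩, opt, ⟨hcommon, fun h hh => ?_⟩,
    pyth⟩
  · filter_upwards [dec] with lam h1
    funext k
    have h2 := h1 k
    rw [charG, h2]
    simp only [charVec]
    ring
  -- Δ(f,g) ≤ Δ(h⁰;f,g) ≤ Δ(h⁰;f⁰,g⁰) = Δ(f⁰,g⁰).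
  · exact (optMse_le_of_memL20 hb (cls hq.1) (cln hq.2) (hcommon q hq)).trans
      ((saddle q hq).trans_eq opt.2)
  -- Any competing h is also admissible for (f⁰, g⁰), where its error is at least the optimal one.
  · refine (iSup₂_le saddle).trans ?_
    rw [opt.2]
    exact (optMse_le_of_memL20 hb df dg (hh _ hmem)).trans
      (le_iSup₂ (f := fun q (_ : q ∈ C.pairClass k) => mse d τ b h q.1 q.2) (f, g) hmem)

end Solution

/-! ## The processes -/

section Isometry

variable {Ω : Type*} [MeasurableSpace Ω] {μ : Measure Ω} {T : ℝ} {d τ : ℕ}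
  {X Y : ℝ → Lp ℂ 2 μ} {f g : ℝ → Mat}

/-- The finite linear combination `∑ x_{kj} ξ_{k,-j}`. -/
def finSum (T : ℝ) (d τ : ℕ) (X : ℝ → Lp ℂ 2 μ) (x : (ℕ × ℕ) →₀ ℂ) : Lp ℂ 2 μ :=
  x.sum fun i c => c • genSeq T d τ X i.1 (-(i.2 : ℤ))

theorem finSum_add (x y : (ℕ × ℕ) →₀ ℂ) :
    finSum T d τ X (x + y) = finSum T d τ X x + finSum T d τ X y :=
  Finsupp.sum_add_index' (fun _ => zero_smul _ _) fun _ _ _ => add_smul _ _ _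

theorem finSum_smul (c : ℂ) (x : (ℕ × ℕ) →₀ ℂ) :
    finSum T d τ X (c • x) = c • finSum T d τ X x := by
  refine (Finsupp.sum_smul_index (h := fun (i : ℕ × ℕ) (c : ℂ) =>
    c • genSeq T d τ X i.1 (-(i.2 : ℤ))) fun _ => zero_smul _ _).trans ?_
  rw [finSum, Finsupp.smul_sum]
  simp only [mul_smul]

theorem finSum_single (p : ℕ × ℕ) (c : ℂ) :
    finSum T d τ X (Finsupp.single p c) = c • genSeq T d τ X p.1 (-(p.2 : ℤ)) :=
  Finsupp.sum_single_index (zero_smul _ _)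

theorem finSum_sub (x y : (ℕ × ℕ) →₀ ℂ) :
    finSum T d τ X (x - y) = finSum T d τ X x - finSum T d τ X y := by
  have : x - y = x + (-1 : ℂ) • y := by rw [neg_one_smul, sub_eq_add_neg]
  rw [this, finSum_add, finSum_smul, neg_one_smul, sub_eq_add_neg]

theorem finiteEstimate_eq (x : (ℕ × ℕ) →₀ ℂ) :
    finiteEstimate T d τ X Y x = finSum T d τ X x + finSum T d τ Y x := by
  rw [finiteEstimate, finSum, finSum, ← Finsupp.sum_add]
  simp only [smul_add]

theorem bform_indicator (A : Mat) (c e : ℂ) (k n : ℕ) :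
    bform A (fun l => c * if l = k then 1 else 0) (fun l => e * if l = n then 1 else 0) =
      c * A k n * conj e := by
  rw [bform, tsum_eq_single (k, n)]
  · simp
  · rintro ⟨p, q⟩ hpq
    by_cases hp : p = k
    · have hq : q ≠ n := fun h => hpq (by rw [hp, h])
      simp [hq]
    · simp [hp]

theorem incFactor_mul_conj (d τ : ℕ) (lam : ℝ) :
    incFactor d τ lam * conj (incFactor d τ lam) =
      (1 - Complex.exp (-(Complex.I * τ * lam))) ^ d *
          (1 - Complex.exp (Complex.I * τ * lam)) ^ d / (lam : ℂ) ^ (2 * d) := by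
  have h1 : conj (incFactor d τ lam) =
      (1 - Complex.exp (Complex.I * τ * lam)) ^ d / (-(Complex.I * lam)) ^ d := by
    rw [incFactor, map_div₀, map_pow, map_pow, map_sub, map_one, ← Complex.exp_conj]
    simp only [map_neg, map_mul, Complex.conj_I, Complex.conj_ofReal, map_natCast]
    congr 4
    · ring_nf
    · ring
  rw [h1, incFactor, div_mul_div_comm, ← mul_pow (Complex.I * (lam : ℂ)),
    show Complex.I * (lam : ℂ) * -(Complex.I * lam) = (lam : ℂ) ^ 2 by
      linear_combination (-(lam : ℂ) ^ 2) * Complex.I_sq, ← pow_mul,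
    show Complex.I * (lam : ℂ) * τ = Complex.I * τ * lam by ring]

theorem HasIncrementDensity.inner_genSeq (hτ : 0 < τ) (hX : HasIncrementDensity T d X f)
    (k n l j : ℕ) :
    inner ℂ (genSeq T d τ X n (-(j : ℤ))) (genSeq T d τ X k (-(l : ℤ))) =
      (1 / (2 * Real.pi) : ℂ) * iform f (polyChar d τ (Finsupp.single (k, l) 1))
        (polyChar d τ (Finsupp.single (n, j) 1)) := by
  rw [hX.covariance τ τ k n _ _ hτ hτ, iform]
  congr 1
  refine integral_congr_ae (Eventually.of_forall fun lam => ?_)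
  have e : ∀ p : ℕ × ℕ, polyChar d τ (Finsupp.single p 1) lam = fun m =>
      (incFactor d τ lam * Complex.exp (-(Complex.I * lam * p.2))) * if m = p.1 then 1 else 0 :=
    fun p => by funext m; rw [polyChar_eq, polyVec_single]; ring
  dsimp only
  rw [e, e, bform_indicator, map_mul, ← Complex.exp_conj]
  simp only [map_neg, map_mul, Complex.conj_I, Complex.conj_ofReal, map_natCast]
  have h2 : Complex.exp (Complex.I * ((-(l : ℤ) - -(j : ℤ) : ℤ) : ℂ) * lam) =
      Complex.exp (-(Complex.I * lam * l)) * Complex.exp (-(-Complex.I * lam * j)) := by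
    rw [← Complex.exp_add]
    congr 1
    push_cast
    ring
  rw [h2]
  linear_combination (-(Complex.exp (-(Complex.I * lam * l)) *
    Complex.exp (-(-Complex.I * lam * j)) * f lam k n)) * incFactor_mul_conj d τ lam

theorem polyChar_add (x y : (ℕ × ℕ) →₀ ℂ) : polyChar d τ (x + y) =
    fun lam k => polyChar d τ x lam k + polyChar d τ y lam k := by
  funext lam k
  simp only [polyChar_eq, polyVec_add, mul_add]

theorem polyChar_single (p : ℕ × ℕ) (c : ℂ) : polyChar d τ (Finsupp.single p c) =
    fun lam k => c * polyChar d τ (Finsupp.single p 1) lam k := by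
  funext lam k
  simp only [polyChar_eq, polyVec_single]
  ring

theorem polyChar_sub (x y : (ℕ × ℕ) →₀ ℂ) : polyChar d τ (x - y) =
    fun lam k => polyChar d τ x lam k - polyChar d τ y lam k := by
  funext lam k
  have := polyVec_add (x - y) y lam k
  rw [sub_add_cancel] at this
  simp only [polyChar_eq, this]
  ring

theorem exists_isBddVec_polyChar (d τ : ℕ) (x : (ℕ × ℕ) →₀ ℂ) :
    ∃ C, IsBddVec C (polyChar d τ x) := by
  obtain ⟨C, hC⟩ := exists_isBddVec_polyVec x
  exact ⟨_, hC.inc d τ⟩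

theorem iform_const_mul_left (f : ℝ → Mat) (c : ℂ) (u v : ℝ → ℕ → ℂ) :
    iform f (fun lam k => c * u lam k) v = c * iform f u v := by
  simp only [iform, IsTracePos.bform_const_left, integral_const_mul]

theorem iform_const_mul_right (f : ℝ → Mat) (c : ℂ) (u v : ℝ → ℕ → ℂ) :
    iform f u (fun lam k => c * v lam k) = conj c * iform f u v := by
  simp only [iform, IsTracePos.bform_const_right, integral_const_mul]

theorem IsSpectralDensity.iform_add_left {C D E : ℝ} {u u' v : ℝ → ℕ → ℂ}
    (hf : IsSpectralDensity f) (hu : IsBddVec C u) (hu' : IsBddVec D u') (hv : IsBddVec E v) :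
    iform f (fun lam k => u lam k + u' lam k) v = iform f u v + iform f u' v := by
  rw [iform, iform, iform, ← integral_add (hf.integrable_bform hu hv) (hf.integrable_bform hu' hv)]
  refine integral_congr_ae ?_
  filter_upwards [hf.ae_isTracePos, hu.sqSum, hu'.sqSum, hv.sqSum] with lam h h1 h2 h3
  exact h.bform_add_left h1 h2 h3

/-- The isometry between the time domain and the frequency domain. -/
theorem HasIncrementDensity.inner_finSum (hτ : 0 < τ) (hf : IsSpectralDensity f)
    (hX : HasIncrementDensity T d X f) (x y : (ℕ × ℕ) →₀ ℂ) :
    inner ℂ (finSum T d τ X y) (finSum T d τ X x) =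
      (1 / (2 * Real.pi) : ℂ) * iform f (polyChar d τ x) (polyChar d τ y) := by
  have hz : polyChar d τ 0 = fun _ _ => 0 := by
    funext lam k; rw [polyChar_eq, polyVec_zero, mul_zero]
  have hz' : finSum T d τ X 0 = 0 := Finsupp.sum_zero_index
  induction x using Finsupp.induction_linear with
  | zero => simp [hz, hz', iform, bform]
  | add x x' hx hx' =>
    obtain ⟨C, hC⟩ := exists_isBddVec_polyChar d τ x
    obtain ⟨C', hC'⟩ := exists_isBddVec_polyChar d τ x'
    obtain ⟨D, hD⟩ := exists_isBddVec_polyChar d τ y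
    rw [finSum_add, inner_add_right, hx, hx', polyChar_add, hf.iform_add_left hC hC' hD]
    ring
  | single p c =>
    induction y using Finsupp.induction_linear with
    | zero => simp [hz, hz', iform, bform]
    | add y y' hy hy' =>
      obtain ⟨C, hC⟩ := exists_isBddVec_polyChar d τ y
      obtain ⟨C', hC'⟩ := exists_isBddVec_polyChar d τ y'
      obtain ⟨D, hD⟩ := exists_isBddVec_polyChar d τ (Finsupp.single p c)
      rw [finSum_add, inner_add_left, hy, hy', polyChar_add, hf.iform_add_right hD hC hC']
      ring
    | single q e =>
      rw [finSum_single, finSum_single, inner_smul_left, inner_smul_right, hX.inner_genSeq hτ, polyChar_single p c,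
        polyChar_single q e, iform_const_mul_left, iform_const_mul_right]
      ring

theorem HasIncrementDensity.norm_finSum_sq (hτ : 0 < τ) (hf : IsSpectralDensity f)
    (hX : HasIncrementDensity T d X f) (x : (ℕ × ℕ) →₀ ℂ) :
    ‖finSum T d τ X x‖ ^ 2 = 1 / (2 * Real.pi) * iq f (polyChar d τ x) := by
  obtain ⟨C, hC⟩ := exists_isBddVec_polyChar d τ x
  have h1 := inner_self_eq_norm_sq_to_K (𝕜 := ℂ) (finSum T d τ X x)
  rw [hX.inner_finSum hτ hf] at h1
  have h2 := congrArg Complex.re h1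
  rw [hf.iq_eq hC]
  have e1 : ((1 / (2 * Real.pi) : ℂ) * iform f (polyChar d τ x) (polyChar d τ x)).re =
      1 / (2 * Real.pi) * (iform f (polyChar d τ x) (polyChar d τ x)).re := by
    rw [← Complex.re_ofReal_mul]
    push_cast
    rfl
  rw [e1] at h2
  rw [h2]
  norm_cast

/-- If φ is not integrable, its integral is 0 by convention and the conclusion persists. -/
theorem inner_setIntegral_eq_zero {S : Set ℝ} {φ : ℝ → Lp ℂ 2 μ} {V : Lp ℂ 2 μ}
    (h : ∀ t, inner ℂ V (φ t) = 0) : inner ℂ V (∫ t in S, φ t) = 0 := by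
  by_cases hi : Integrable φ (volume.restrict S)
  · rw [← integral_inner hi V]
    simp [h]
  · rw [integral_undef hi, inner_zero_right]

theorem inner_genSeq_eq_zero {V : Lp ℂ 2 μ} (h : ∀ t s, inner ℂ V (increment d X t s) = 0)
    (k : ℕ) (j : ℤ) : inner ℂ V (genSeq T d τ X k j) = 0 :=
  inner_setIntegral_eq_zero fun t => by rw [inner_smul_right, h, mul_zero]

theorem IsFilteringModel.inner_finSum (hM : IsFilteringModel T d X Y f g)
    (x y : (ℕ × ℕ) →₀ ℂ) : inner ℂ (finSum T d τ Y y) (finSum T d τ X x) = 0 := by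
  have h1 : ∀ k j k' j', inner ℂ (genSeq T d τ Y k j) (genSeq T d τ X k' j') = 0 := by
    intro k j k' j'
    refine inner_genSeq_eq_zero (fun t s => ?_) k' j'
    refine inner_eq_zero_symm.1 (inner_genSeq_eq_zero (fun t' s' => ?_) k j)
    exact inner_eq_zero_symm.1 (hM.uncorrelated t s t' s')
  rw [finSum, finSum, Finsupp.sum, Finsupp.sum, sum_inner]
  refine Finset.sum_eq_zero fun p _ => ?_
  rw [inner_sum]
  refine Finset.sum_eq_zero fun q _ => ?_
  rw [inner_smul_left, inner_smul_right, h1]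
  simp

end Isometry

/-! ### The functional of the signal and its optimal estimate. -/

section Functional

variable {Ω : Type*} [MeasurableSpace Ω] {μ : Measure Ω} {T : ℝ} {d τ : ℕ} {b : ℕ → ℕ → ℂ}
  {X Y : ℝ → Lp ℂ 2 μ} {f g : ℝ → Mat}

/-- The majorant Σ_j |b_{jk}| bounds all rectangular partial sums and the symbol, which gives both
the uniform bound and dominated convergence in ℓ². -/
theorem CoeffCondition.exists_rect_bound (hb : CoeffCondition b) :
    (∀ N, IsBddVec (symbolBound b) (polyVec (rect N fun p => b p.2 p.1))) ∧
    ∀ lam, Tendsto (fun N => nsq fun k =>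
      polyVec (rect N fun p => b p.2 p.1) lam k - symbolB b lam k) atTop (𝓝 0) := by
  obtain ⟨h1, h2⟩ := hb.bound
  set β : ℕ → ℝ := fun k => ∑' j, ‖b j k‖ with hβ
  have hβ0 : ∀ k, 0 ≤ β k := fun k => tsum_nonneg fun _ => norm_nonneg _
  have hnorm : ∀ (lam : ℝ) (j k : ℕ),
      ‖b j k * Complex.exp (-(Complex.I * lam * j))‖ = ‖b j k‖ := fun lam j k => by
    rw [norm_mul, norm_exp_neg_I_nat, mul_one]
  have hle : ∀ N lam k, ‖polyVec (rect N fun p => b p.2 p.1) lam k‖ ≤ ‖(β k : ℂ)‖ := by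
    intro N lam k
    rw [Complex.norm_real, Real.norm_of_nonneg (hβ0 k), polyVec_rect]
    split_ifs
    · refine (norm_sum_le _ _).trans ?_
      simp only [hnorm]
      exact (hb.summable_norm k).sum_le_tsum _ fun _ _ => norm_nonneg _
    · simpa using hβ0 k
  have hBle : ∀ lam k, ‖symbolB b lam k‖ ≤ ‖(β k : ℂ)‖ := fun lam k => by
    rw [Complex.norm_real, Real.norm_of_nonneg (hβ0 k), symbolB]
    refine tsum_of_norm_bounded (hb.summable_norm k).hasSum fun j => (hnorm lam j k).le
  refine ⟨fun N => isBddVec_polyVec_of_le fun lam => (nsq_mono h1 (hle N lam)).trans h2,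
    fun lam => ?_⟩
  have h0 : Tendsto (fun N => ∑' k, ‖polyVec (rect N fun p => b p.2 p.1) lam k -
      symbolB b lam k‖ ^ 2) atTop (𝓝 (∑' _ : ℕ, (0 : ℝ))) := by
    refine tendsto_tsum_of_dominated_convergence (bound := fun k => 4 * ‖(β k : ℂ)‖ ^ 2)
      (Summable.mul_left 4 h1) (fun k => ?_) (Eventually.of_forall fun N k => ?_)
    · have h3 : Tendsto (fun N => polyVec (rect N fun p => b p.2 p.1) lam k) atTop
          (𝓝 (symbolB b lam k)) := by
        refine ((hb.summable_symbolB lam k).hasSum.tendsto_sum_nat).congr' ?_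
        filter_upwards [eventually_gt_atTop k] with N hN
        rw [polyVec_rect, if_pos hN]
      have h4 := (h3.sub_const (symbolB b lam k)).norm.pow 2
      simpa using h4
    · rw [Real.norm_of_nonneg (sq_nonneg _)]
      have h3 := (norm_sub_le _ _).trans (add_le_add (hle N lam k) (hBle lam k))
      calc _ ≤ (‖(β k : ℂ)‖ + ‖(β k : ℂ)‖) ^ 2 := pow_le_pow_left₀ (norm_nonneg _) h3 2
        _ = _ := by ring
  simpa [nsq] using h0

/-- The norm of ξ_{kj} is at most σ_k, with σ_k² proportional to the integral of f_{kk}, so σ is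
square summable by finite trace. Cauchy–Schwarz in k and summability of ‖b_j‖ in j give absolute
convergence, and the iterated sum defining the functional is a genuine double sum. -/
theorem HasIncrementDensity.summable_signal (hτ : 0 < τ) (hb : CoeffCondition b)
    (hf : IsSpectralDensity f) (hX : HasIncrementDensity T d X f) :
    Summable fun p : ℕ × ℕ => b p.1 p.2 • genSeq T d τ X p.2 (-(p.1 : ℤ)) := by
  have hpi := Real.pi_pos
  set σ : ℕ → ℝ := fun k => √(1 / (2 * Real.pi) * ((τ : ℝ) ^ (2 * d) * ∫ lam, ‖f lam k k‖ ∂freqMeasure))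
    with hσ
  have hI : ∀ k, 0 ≤ ∫ lam, ‖f lam k k‖ ∂freqMeasure := fun k =>
    integral_nonneg fun _ => norm_nonneg _
  have hgen : ∀ (k j : ℕ), ‖genSeq T d τ X k (-(j : ℤ))‖ ≤ σ k := by
    intro k j
    refine Real.le_sqrt_of_sq_le ?_
    have e : genSeq T d τ X k (-(j : ℤ)) = finSum T d τ X (Finsupp.single (k, j) 1) := by
      rw [finSum_single, one_smul]
    rw [e, hX.norm_finSum_sq hτ hf, ← integral_const_mul]
    refine mul_le_mul_of_nonneg_left ?_ (by positivity)
    obtain ⟨C, hC⟩ := exists_isBddVec_polyChar d τ (Finsupp.single (k, j) 1)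
    refine integral_mono_ae (hf.integrable_qform hC)
      ((hf.integrable_entry k k).norm.const_mul _) ?_
    filter_upwards [hf.ae_isTracePos, hC.sqSum] with lam h1 h2
    have e : polyChar d τ (Finsupp.single (k, j) 1) lam = fun m =>
      (incFactor d τ lam * Complex.exp (-(Complex.I * lam * j))) * if m = k then 1 else 0 := by
      funext m; rw [polyChar_eq, polyVec_single]; ring
    rw [h1.qform_eq h2, e, bform_indicator]
    refine (Complex.re_le_norm _).trans ?_
    rw [norm_mul, norm_mul, RCLike.norm_conj, norm_mul, norm_exp_neg_I_nat, mul_one, mul_right_comm,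
      ← sq, norm_incFactor_sq]
    exact mul_le_mul_of_nonneg_right (incWeight_le d τ lam) (norm_nonneg _)
  have hσs : SqSum fun k => (σ k : ℂ) := by
    have h1 : Summable fun k => ∫ lam, ‖f lam k k‖ ∂freqMeasure := by
      refine (ENNReal.summable_toReal hf.trace_finite.ne).congr fun k => ?_
      rw [integral_norm_eq_lintegral_enorm (hf.measurable k k)]
    refine (((h1.mul_left ((τ : ℝ) ^ (2 * d))).mul_left (1 / (2 * Real.pi)))).congr fun k => ?_
    rw [Complex.norm_real, Real.norm_of_nonneg (Real.sqrt_nonneg _), Real.sq_sqrt]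
    have := hI k
    positivity
  have hj : ∀ j, (Summable fun k => ‖b j k * σ k‖) ∧
      ∑' k, ‖b j k * σ k‖ ≤ l2norm (b j) * √(nsq fun k => (σ k : ℂ)) := fun j =>
    ⟨(hb.sqSum j).summable_norm_mul hσs, by
      rw [l2norm_eq]; exact tsum_norm_mul_le (hb.sqSum j) hσs⟩
  have hprod : Summable fun p : ℕ × ℕ => ‖b p.1 p.2 * σ p.2‖ := by
    rw [summable_prod_of_nonneg fun _ => norm_nonneg _]
    exact ⟨fun j => (hj j).1, Summable.of_nonneg_of_le
      (fun j => tsum_nonneg fun _ => norm_nonneg _) (fun j => (hj j).2)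
      (hb.summable.mul_right _)⟩
  refine Summable.of_norm_bounded hprod fun p => ?_
  rw [norm_smul, norm_mul]
  refine mul_le_mul_of_nonneg_left ((hgen p.2 p.1).trans ?_) (norm_nonneg _)
  rw [Complex.norm_real]
  exact le_abs_self _

theorem HasIncrementDensity.tendsto_finSum (hτ : 0 < τ) (hb : CoeffCondition b)
    (hf : IsSpectralDensity f) (hX : HasIncrementDensity T d X f) :
    Tendsto (fun N => finSum T d τ X (rect N fun p => b p.2 p.1)) atTop
      (𝓝 (signalFunctional T d τ b X)) := by
  have h := hX.summable_signal hτ hb hf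
  have e : signalFunctional T d τ b X =
      ∑' p : ℕ × ℕ, b p.1 p.2 • genSeq T d τ X p.2 (-(p.1 : ℤ)) := h.tsum_prod.symm
  rw [e]
  have hsq : Tendsto (fun N : ℕ => Finset.range N ×ˢ Finset.range N) atTop atTop := by
    refine tendsto_atTop_finset_of_monotone (fun m n hmn => ?_) fun p => ?_
    · exact Finset.product_subset_product (Finset.range_mono hmn) (Finset.range_mono hmn)
    · exact ⟨max p.1 p.2 + 1, by simp⟩
  refine (h.hasSum.comp hsq).congr fun N => ?_
  refine Eq.trans ?_ (rect_sum N _ (fun (i : ℕ × ℕ) (c : ℂ) =>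
    c • genSeq T d τ X i.1 (-(i.2 : ℤ))) fun _ => zero_smul _ _).symm
  exact (Finset.sum_product _ _ _).trans (Finset.sum_product_right (Finset.range N)
    (Finset.range N) fun p => b p.2 p.1 • genSeq T d τ X p.1 (-(p.2 : ℤ))).symm

/-- The mean square error of a finite estimate. -/
theorem IsFilteringModel.norm_error_sq (hτ : 0 < τ) (hb : CoeffCondition b)
    (hf : IsSpectralDensity f) (hg : IsSpectralDensity g) (hM : IsFilteringModel T d X Y f g)
    (x : (ℕ × ℕ) →₀ ℂ) :
    ENNReal.ofReal (‖signalFunctional T d τ b X - finiteEstimate T d τ X Y x‖ ^ 2) =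
      mse d τ b (polyChar d τ x) f g := by
  obtain ⟨C, hC⟩ := exists_isBddVec_polyVec x
  have hC' := hC.inc d τ
  have hB := hb.isBddCausal.toVec.inc d τ
  rw [polyChar_eq_fun, mse_eq hb hf hg hC]
  congr 1
  obtain ⟨r1, r2⟩ := hb.exists_rect_bound
  have l1 : Tendsto (fun N => ‖finSum T d τ X (rect N fun p => b p.2 p.1) -
      finiteEstimate T d τ X Y x‖ ^ 2) atTop
      (𝓝 (‖signalFunctional T d τ b X - finiteEstimate T d τ X Y x‖ ^ 2)) :=
    ((hM.signal.tendsto_finSum hτ hb hf).sub_const _).norm.pow 2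
  -- Signal and noise are uncorrelated, so the error splits orthogonally and the isometry applies to
  -- each part. The functional is first replaced by rectangular sums, which are finite.
  have e1 : ∀ N, ‖finSum T d τ X (rect N fun p => b p.2 p.1) -
      finiteEstimate T d τ X Y x‖ ^ 2 = 1 / (2 * Real.pi) *
        (iq f (fun lam k => polyChar d τ (rect N fun p => b p.2 p.1) lam k - polyChar d τ x lam k) +
          iq g (polyChar d τ x)) := by
    intro N
    rw [finiteEstimate_eq, ← sub_sub, ← finSum_sub, mul_add, ← polyChar_sub,
      ← hM.signal.norm_finSum_sq hτ hf, ← hM.noise.norm_finSum_sq hτ hg,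
      @norm_sub_sq ℂ, inner_eq_zero_symm.1 (hM.inner_finSum _ _)]
    simp
  simp only [e1] at l1
  refine tendsto_nhds_unique l1 (Tendsto.const_mul _ (Tendsto.add_const _ ?_))
  have hR := fun N => (r1 N).inc d τ
  have hlim : ∀ᵐ lam ∂freqMeasure, Tendsto (fun N => nsq fun k =>
      (polyChar d τ (rect N fun p => b p.2 p.1) lam k - polyChar d τ x lam k) -
        (incFactor d τ lam * symbolB b lam k - incFactor d τ lam * polyVec x lam k))
      atTop (𝓝 0) := Eventually.of_forall fun lam => by
    have e : ∀ N, (nsq fun k =>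
        (polyChar d τ (rect N fun p => b p.2 p.1) lam k - polyChar d τ x lam k) -
        (incFactor d τ lam * symbolB b lam k - incFactor d τ lam * polyVec x lam k)) =
        ‖incFactor d τ lam‖ ^ 2 * nsq fun k =>
          polyVec (rect N fun p => b p.2 p.1) lam k - symbolB b lam k := fun N => by
      rw [← nsq_const_mul]
      congr 1
      funext k
      rw [polyChar_eq, polyChar_eq]; ring
    simp only [e]
    simpa using (r2 lam).const_mul (‖incFactor d τ lam‖ ^ 2)
  have hD := hB.sub hC'
  have hDN := fun N => (hR N).sub hC'
  rw [hf.iq_eq hD]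
  refine ((Complex.continuous_re.tendsto _).comp
    (hf.tendsto_iform hDN hDN hD hD hlim hlim)).congr fun N => ?_
  exact (hf.iq_eq (hDN N)).symm

theorem IsFilteringModel.optimalError_eq (hτ : 0 < τ) (hb : CoeffCondition b)
    (hf : IsSpectralDensity f) (hg : IsSpectralDensity g) (hM : IsFilteringModel T d X Y f g) :
    ENNReal.ofReal (optimalError T d τ b X Y) = optMse d τ b f g := by
  set A := signalFunctional T d τ b X with hA
  set S := Set.range (finiteEstimate T d τ X Y) with hS
  have hne : S.Nonempty := Set.range_nonempty _
  have hopt : optimalError T d τ b X Y = Metric.infDist A S ^ 2 := by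
    rw [optimalError, observed, Metric.infDist_closure]
  rw [hopt]
  refine le_antisymm (le_iInf fun x => ?_) ?_
  · rw [← hM.norm_error_sq hτ hb hf hg x]
    refine ENNReal.ofReal_le_ofReal (pow_le_pow_left₀ Metric.infDist_nonneg ?_ 2)
    rw [← dist_eq_norm]
    exact Metric.infDist_le_dist_of_mem (Set.mem_range_self x)
  · have hl : Tendsto (fun δ : ℝ => ENNReal.ofReal ((Metric.infDist A S + δ) ^ 2)) (𝓝[>] 0)
        (𝓝 (ENNReal.ofReal (Metric.infDist A S ^ 2))) := by
      have h0 : Tendsto (fun δ : ℝ => (Metric.infDist A S + δ) ^ 2) (𝓝 0)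
          (𝓝 ((Metric.infDist A S + 0) ^ 2)) := (tendsto_const_nhds.add tendsto_id).pow 2
      rw [add_zero] at h0
      exact ENNReal.tendsto_ofReal (h0.mono_left nhdsWithin_le_nhds)
    refine ge_of_tendsto hl ?_
    filter_upwards [self_mem_nhdsWithin] with δ hδ
    obtain ⟨_, ⟨x, rfl⟩, hx⟩ := (Metric.infDist_lt_iff hne).1
      (lt_add_of_pos_right (Metric.infDist A S) hδ)
    refine (iInf_le _ x).trans ?_
    rw [← hM.norm_error_sq hτ hb hf hg x]
    refine ENNReal.ofReal_le_ofReal (pow_le_pow_left₀ (norm_nonneg _) ?_ 2)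
    rw [← dist_eq_norm]
    exact hx.le

/-- The linear map `x ↦ ∑ x_{kj} (ξ_{k,-j} + η_{k,-j})`. -/
def estimateMap (T : ℝ) (d τ : ℕ) (X Y : ℝ → Lp ℂ 2 μ) : ((ℕ × ℕ) →₀ ℂ) →ₗ[ℂ] Lp ℂ 2 μ where
  toFun := finiteEstimate T d τ X Y
  map_add' x y := by simp only [finiteEstimate_eq, finSum_add]; abel
  map_smul' c x := by simp only [finiteEstimate_eq, finSum_smul, smul_add, RingHom.id_apply]

/-- The observed set is the closure of the range of a linear map, hence a closed subspace, and the
orthogonal projection onto it exists. -/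
theorem exists_optimalEstimate (T : ℝ) (d τ : ℕ) (b : ℕ → ℕ → ℂ) (X Y : ℝ → Lp ℂ 2 μ) :
    ∃ Z, IsOptimalEstimate T d τ b X Y Z := by
  set U : Submodule ℂ (Lp ℂ 2 μ) := (LinearMap.range (estimateMap T d τ X Y)).topologicalClosure
    with hU
  have hcl : observed T d τ X Y = (U : Set (Lp ℂ 2 μ)) := by
    rw [hU, Submodule.topologicalClosure_coe, LinearMap.coe_range]
    rfl
  have hc : CompleteSpace U := (Submodule.isClosed_topologicalClosure _).completeSpace_coe
  refine ⟨U.starProjection (signalFunctional T d τ b X), ?_, fun V hV => ?_⟩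
  · rw [hcl]
    exact U.starProjection_apply_mem _
  · rw [hcl] at hV
    exact inner_eq_zero_symm.1 (U.starProjection_inner_eq_zero _ V hV)

/-- Finite characteristics converging to h in L²(f+g) have, by Pythagoras, errors converging to the
minimum. A minimizing sequence in the observed subspace converges to the projection. -/
theorem IsFilteringModel.hasSpectralChar (hτ : 0 < τ) (hb : CoeffCondition b)
    (hf : IsSpectralDensity f) (hg : IsSpectralDensity g) (hM : IsFilteringModel T d X Y f g)
    {h : ℝ → ℕ → ℂ} (hL : MemL20 d τ (fun lam => f lam + g lam) h)
    (hopt : mse d τ b h f g = optMse d τ b f g)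
    (hpyth : ∀ x, mse d τ b (polyChar d τ x) f g = mse d τ b h f g +
      ENNReal.ofReal (1 / (2 * Real.pi)) * normSqL2 (fun lam => f lam + g lam)
        (fun lam k => h lam k - polyChar d τ x lam k))
    {Z : Lp ℂ 2 μ} (hZ : IsOptimalEstimate T d τ b X Y Z) : HasSpectralChar T d τ X Y f g Z h := by
  set A := signalFunctional T d τ b X with hA
  set m := Metric.infDist A (observed T d τ X Y) with hm
  choose x hx using fun n : ℕ => hL.approx ((n : ℝ≥0∞) + 1)⁻¹
    (ENNReal.inv_pos.2 (by simp))
  have hx0 : Tendsto (fun n => normSqL2 (fun lam => f lam + g lam)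
      (fun lam k => h lam k - polyChar d τ (x n) lam k)) atTop (𝓝 0) := by
    refine tendsto_of_tendsto_of_tendsto_of_le_of_le tendsto_const_nhds ?_ (fun _ => zero_le)
      fun n => (hx n).le
    have := (tendsto_add_atTop_iff_nat 1).2 ENNReal.tendsto_inv_nat_nhds_zero
    simpa using this
  refine ⟨x, ?_, hx0⟩
  have e1 : ∀ n, ENNReal.ofReal (‖A - finiteEstimate T d τ X Y (x n)‖ ^ 2) =
      ENNReal.ofReal (m ^ 2) + ENNReal.ofReal (1 / (2 * Real.pi)) *
        normSqL2 (fun lam => f lam + g lam) (fun lam k => h lam k - polyChar d τ (x n) lam k) :=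
    fun n => by
      rw [hM.norm_error_sq hτ hb hf hg, hpyth, hopt, ← hM.optimalError_eq hτ hb hf hg,
        optimalError]
  have l1 : Tendsto (fun n => ENNReal.ofReal (‖A - finiteEstimate T d τ X Y (x n)‖ ^ 2)) atTop
      (𝓝 (ENNReal.ofReal (m ^ 2))) := by
    simp only [e1]
    have := (ENNReal.Tendsto.const_mul hx0 (a := ENNReal.ofReal (1 / (2 * Real.pi)))
      (Or.inr ENNReal.ofReal_ne_top)).const_add (ENNReal.ofReal (m ^ 2))
    simpa using this
  have l2 : Tendsto (fun n => ‖A - finiteEstimate T d τ X Y (x n)‖ ^ 2) atTop (𝓝 (m ^ 2)) := by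
    have := (ENNReal.tendsto_toReal ENNReal.ofReal_ne_top).comp l1
    rw [ENNReal.toReal_ofReal (sq_nonneg _)] at this
    exact this.congr fun n => ENNReal.toReal_ofReal (sq_nonneg _)
  have hmZ : m ^ 2 ≤ ‖A - Z‖ ^ 2 := by
    refine pow_le_pow_left₀ Metric.infDist_nonneg ?_ 2
    rw [← dist_eq_norm]
    exact Metric.infDist_le_dist_of_mem hZ.1
  -- A - Z is orthogonal to the observed subspace, so ‖A - V‖² = ‖A - Z‖² + ‖V - Z‖² for each finite
  -- estimate V, and ‖A - Z‖ is at least the distance m.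
  have hp : ∀ n, ‖finiteEstimate T d τ X Y (x n) - Z‖ ^ 2 ≤
      ‖A - finiteEstimate T d τ X Y (x n)‖ ^ 2 - m ^ 2 := by
    intro n
    have h1 := hZ.2 _ (subset_closure (Set.mem_range_self (x n)))
    have h2 : inner ℂ (finiteEstimate T d τ X Y (x n) - Z) (A - Z) = 0 := by
      rw [inner_sub_left, h1, hZ.2 _ hZ.1, sub_zero]
    have h3 : A - finiteEstimate T d τ X Y (x n) =
        (A - Z) - (finiteEstimate T d τ X Y (x n) - Z) := by abel
    rw [h3, @norm_sub_sq ℂ _ _ _ _ (A - Z), inner_eq_zero_symm.1 h2]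
    simp only [map_zero, mul_zero, sub_zero]
    linarith
  rw [tendsto_iff_norm_sub_tendsto_zero]
  have l3 : Tendsto (fun n => ‖finiteEstimate T d τ X Y (x n) - Z‖ ^ 2) atTop (𝓝 0) := by
    have h4 := l2.sub_const (m ^ 2)
    rw [sub_self] at h4
    exact squeeze_zero (fun _ => sq_nonneg _) hp h4
  have l4 := l3.sqrt
  rw [Real.sqrt_zero] at l4
  exact l4.congr fun n => Real.sqrt_sq (norm_nonneg _)

end Functional

/-! ### From the frequency domain to the processes. -/

section Robust

variable {T : ℝ} {d τ : ℕ} {b : ℕ → ℕ → ℂ} {f₀ g₀ : ℝ → Mat}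

theorem HasSpectralChar.congr {Ω : Type*} [MeasurableSpace Ω] {μ : Measure Ω}
    {X Y : ℝ → Lp ℂ 2 μ} {Z : Lp ℂ 2 μ} {h h' : ℝ → ℕ → ℂ}
    (e : ∀ᵐ lam ∂freqMeasure, h lam = h' lam) (H : HasSpectralChar T d τ X Y f₀ g₀ Z h) :
    HasSpectralChar T d τ X Y f₀ g₀ Z h' := by
  obtain ⟨x, h1, h2⟩ := H
  refine ⟨x, h1, h2.congr fun n => normSqL2_congr (e.mono fun lam e => ?_) _⟩
  rw [e]

theorem IsRobustSolution.congr {D : Set ((ℝ → Mat) × (ℝ → Mat))} {h h' : ℝ → ℕ → ℂ}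
    (e : ∀ᵐ lam ∂freqMeasure, h lam = h' lam) (H : IsRobustSolution.{u} T d τ b D f₀ g₀ h) :
    IsRobustSolution.{u} T d τ b D f₀ g₀ h' where
  leastFavourable := H.leastFavourable
  optimal := H.optimal.congr e
  minimax := H.minimax.congr e
  estimate S _ μ _ X Y hM := by
    obtain ⟨⟨Z, h1, h2⟩, h3⟩ := H.estimate S μ X Y hM
    exact ⟨⟨Z, h1, h2.congr e⟩, h3⟩
  worstCase := H.worstCase

theorem isRobustSolution_of_frequency (hτ : 0 < τ) (hb : CoeffCondition b)
    {D : Set ((ℝ → Mat) × (ℝ → Mat))}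
    (hD : ∀ q ∈ D, IsSpectralDensity q.1 ∧ IsSpectralDensity q.2) {h : ℝ → ℕ → ℂ}
    (hl : IsLeastFavourable d τ b D f₀ g₀) (ho : IsOptimalChar d τ b f₀ g₀ h)
    (hm : IsMinimaxChar d τ b D h)
    (hpyth : ∀ x, mse d τ b (polyChar d τ x) f₀ g₀ = mse d τ b h f₀ g₀ +
      ENNReal.ofReal (1 / (2 * Real.pi)) * normSqL2 (fun lam => f₀ lam + g₀ lam)
        (fun lam k => h lam k - polyChar d τ x lam k)) :
    IsRobustSolution.{u} T d τ b D f₀ g₀ h where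
  leastFavourable := hl
  optimal := ho
  minimax := hm
  estimate S _ μ _ X Y hM := by
    obtain ⟨df, dg⟩ := hD _ hl.1
    obtain ⟨Z, hZ⟩ := exists_optimalEstimate T d τ b X Y
    exact ⟨⟨Z, hZ, hM.hasSpectralChar hτ hb df dg ho.1 ho.2 hpyth hZ⟩,
      hM.optimalError_eq hτ hb df dg⟩
  worstCase S S' _ _ μ μ' _ _ X₀ Y₀ X Y f g hq hM₀ hM := by
    obtain ⟨df, dg⟩ := hD _ hl.1
    obtain ⟨df', dg'⟩ := hD _ hq
    refine (ENNReal.ofReal_le_ofReal_iff (sq_nonneg _)).1 ?_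
    have h1 := hM.optimalError_eq hτ hb df' dg'
    have h2 := hM₀.optimalError_eq hτ hb df dg
    rw [optimalError] at h2
    rw [h1, h2]
    exact hl.2 _ hq

end Robust

end PCFilter

end

theorem theorem6 (T : ℝ) (hT : 0 < T) (d τ : ℕ) (hτ : 0 < τ)
    (a : ℝ → ℂ) (ha : ∀ R : ℝ, MeasureTheory.IntegrableOn a (Set.Icc 0 R))
    (hb : CoeffCondition (bVec T d τ a))
    (C : ClassData) (k : Fin 4)
    (w : ℝ → ℂ) (hw : IsWeightFactor d τ w)
    (f₀ g₀ G₀ : ℝ → Mat) {MΦ MΩ M : ℕ∞}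
    (Φ₀ : ℝ → Matrix ℕ (Idx MΦ) ℂ) (Ω₀ : ℝ → Matrix ℕ (Idx MΩ) ℂ)
    (Θ₀ : ℝ → Matrix ℕ (Idx M) ℂ) (Ψ₀ : ℝ → Matrix (Idx M) ℕ ℂ)
    -- restrictions on the densities from the class
    (hf₀ : f₀ ∈ C.signalClass k) (hg₀ : g₀ ∈ C.noiseClass k)
    -- canonical factorizations of `f₀`, `g₀`, `f₀ + g₀` and of the inverse of `f₀ + g₀`
    (hΦ : IsCanonicalFactorization f₀ Φ₀) (hΩ : IsCanonicalFactorization g₀ Ω₀)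
    (hΘ : IsCanonicalFactorization (fun lam => f₀ lam + g₀ lam) Θ₀)
    (hΨ : IsInverseFactorization w Θ₀ Ψ₀ G₀)
    -- the operators defined by the coefficients act in `ℓ²`
    (hΦop : IsL2Operator (matCoef (tauFactor w Φ₀)))
    (hΩop : IsL2Operator (matCoef (tauFactor w Ω₀)))
    (hmin : MinimalityCondition d τ G₀)
    -- the pair of equations
    (hf hg : ℝ → Idx M → ℂ)
    (hhf : IsPsiCSeries (matCoef (tauInv w Ψ₀)) (matCoef (tauFactor w Φ₀)) (bVec T d τ a) hf)
    (hhg : IsPsiCSeries (matCoef (tauInv w Ψ₀)) (matCoef (tauFactor w Ω₀)) (bVec T d τ a) hg)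
    (heq : MultiplierEquations C g₀ Θ₀ hf hg k) :
    (SolvesProblemF (bVec T d τ a) w (C.signalClass k) (C.noiseClass k) Φ₀ Ψ₀ →
      IsRobustSolution.{u} T d τ (bVec T d τ a) (C.pairClass k) f₀ g₀ (charF d τ w Ψ₀ hf)) ∧
    (SolvesProblemG (bVec T d τ a) w (C.signalClass k) (C.noiseClass k) Ω₀ Ψ₀ →
      IsRobustSolution.{u} T d τ (bVec T d τ a) (C.pairClass k) f₀ g₀
        (charG d τ (bVec T d τ a) w Ψ₀ hg)) := by
  obtain ⟨D, s, hs, hF, hG, hl, ho, hm, hp⟩ := exists_frequency_solution hτ hb hw hf₀ hg₀ hΦ hΩ hΘ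
    hΨ hΦop hΩop hmin hhf hhg heq
  have hD : ∀ q ∈ C.pairClass k, IsSpectralDensity q.1 ∧ IsSpectralDensity q.2 := by
    rintro ⟨f, g⟩ ⟨h1, h2⟩
    fin_cases k <;> exact ⟨h1.1, h2.1⟩
  have key := isRobustSolution_of_frequency.{u} (T := T) hτ hb hD hl ho hm hp
  -- The first formula is h⁰ identically. The second equals it only almost everywhere, through B = s
  -- + t, hence the passage by `IsRobustSolution.congr`.
  exact ⟨fun _ => hF ▸ key, fun _ => key.congr hG⟩
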